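/- Let $k$ be a field and let $Q$ be an infinite connected quiver which is strongly locally finite, that is, every vertex is the starting point and the ending point of only finitely many arrows, and there are only finitely many paths between any two vertices. Let $\mathrm{rep}^+(Q)$ be the category of finitely presented $k$-representations of $Q$, that is, of the representations $M$ with a short exact sequence $0\to P_1\to P_0\to M\to 0$ where $P_1,P_0$ are locally finite dimensional and are finite direct sums of representations $P_a\otimes U$ with $a\in Q_0$ and $U$ a $k$-space; here $P_a(x)$ has the paths from $a$ to $x$ as a basis. Let $\Gamma$ be the Auslander-Reiten quiver of $\mathrm{rep}^+(Q)$: its vertices are representatives of the isomorphism classes of indecomposable objects; writing $\mathrm{irr}(X,Y)=\mathrm{rad}(X,Y)/\mathrm{rad}^2(X,Y)$, with dimensions $d_{XY}$ over $\mathrm{End}(Y)/\mathrm{rad}(Y,Y)$ and $d'_{XY}$ over $\mathrm{End}(X)/\mathrm{rad}(X,X)$, there are $d_{XY}$ unvalued arrows $X\to Y$ if $d_{XY}=d'_{XY}$, and one arrow with valuation $(d_{XY},d'_{XY})$ otherwise; and $\tau Z=X$ if and only if $\mathrm{rep}^+(Q)$ has an almost split sequence $X\to Y\to Z$. A connected component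 of $\Gamma$ is called preprojective if it contains some $P_a$. A section of a connected translation quiver is a connected convex subquiver $\Delta$ without oriented cycles which meets each $\tau$-orbit exactly once; it is left-most (respectively right-most) if every vertex is of the form $\tau^{-n}x$ (respectively $\tau^{n}x$) with $n\in\mathbb N$ and $x\in\Delta$. A translation quiver is right stable if $\tau^{-n}x$ is defined for all its vertices $x$ and all $n\in\mathbb N$. The translation quiver $\mathbb N Q^{\mathrm{op}}$ has the vertices $(n,x)$ with $n\in\mathbb N$, $x\in Q_0$, an arrow $(n,x)\to(n,y)$ and an arrow $(n,y)\to(n+1,x)$ for each arrow $x\to y$ of $Q^{\mathrm{op}}$ and each $n\in\mathbb N$, and the translation $\tau(n+1,x)=(n,x)$, with $\tau(0,x)$ undefined. An embedding is an isomorphism onto a full translation subquiver. Then $\Gamma$ has a unique preprojective component $\mathcal P_Q$. It contains all the $P_x$ with $x\in Q_0$, and these generate a left-most section of $\mathcal P_Q$; consequently, $\mathcal P_Q$ embeds in $\mathbb N Q^{\mathrm{op}}$, with $P_x$ corresponding to $(0,x)$. Furthermore: (1) if $Q$ has no right infinite path (infinite path $x_0\to x_1\to x_2\to\cdots$), then $\mathcal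 P_Q$ is right stable and isomorphic to $\mathbb N Q^{\mathrm{op}}$, with $P_x$ corresponding to $(0,x)$; (2) if $Q$ has right infinite paths, then $\mathcal P_Q$ has a right-most section, and consequently all $\tau$-orbits in $\mathcal P_Q$ are finite. -/

import Mathlib

open CategoryTheory

universe u v w

namespace QuivRep

/-! ### Auslander-Reiten theory in a preadditive category -/

section AR

variable {C : Type u} [Category.{v} C] [Preadditive C]

/-- `X` is indecomposable: it is non-zero, and `X ≅ Y ⊕ Z` implies `Y = 0` or `Z = 0`. -/
def IsIndec (X : C) : Prop :=
  ¬ Limits.IsZero X ∧ ∀ (Y Z : C) (b : Limits.BinaryBicone Y Z),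
    Nonempty b.IsBilimit → Nonempty (X ≅ b.pt) → Limits.IsZero Y ∨ Limits.IsZero Z

/-- Right minimal: every endomorphism `h` of the domain with `f h = f` is an automorphism. -/
def IsRightMinimal {X Y : C} (f : X ⟶ Y) : Prop := ∀ h : X ⟶ X, h ≫ f = f → IsIso h

/-- Left minimal: every endomorphism `h` of the codomain with `h f = f` is an automorphism. -/
def IsLeftMinimal {X Y : C} (f : X ⟶ Y) : Prop := ∀ h : Y ⟶ Y, f ≫ h = f → IsIso h

/-- Right almost split: not a retraction, and every non-retraction to `Y` factors through `f`. -/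
def IsRightAlmostSplit {X Y : C} (f : X ⟶ Y) : Prop :=
  ¬ IsSplitEpi f ∧ ∀ (Z : C) (g : Z ⟶ Y), ¬ IsSplitEpi g → ∃ h : Z ⟶ X, h ≫ f = g

/-- Left almost split: not a section, and every non-section from `X` factors through `f`. -/
def IsLeftAlmostSplit {X Y : C} (f : X ⟶ Y) : Prop :=
  ¬ IsSplitMono f ∧ ∀ (Z : C) (g : X ⟶ Z), ¬ IsSplitMono g → ∃ h : Y ⟶ Z, f ≫ h = g

/-- `f` is a pseudo-kernel (weak kernel) of `g`. -/
def IsPseudoKernel {X Y Z : C} (f : X ⟶ Y) (g : Y ⟶ Z) : Prop :=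
  f ≫ g = 0 ∧ ∀ (W : C) (h : W ⟶ Y), h ≫ g = 0 → ∃ l : W ⟶ X, l ≫ f = h

/-- `g` is a pseudo-cokernel (weak cokernel) of `f`. -/
def IsPseudoCokernel {X Y Z : C} (f : X ⟶ Y) (g : Y ⟶ Z) : Prop :=
  f ≫ g = 0 ∧ ∀ (W : C) (h : Y ⟶ W), f ≫ h = 0 → ∃ l : Z ⟶ W, g ≫ l = h

/-- Almost split sequences `X ⟶ Y ⟶ Z` in a preadditive category. -/
structure IsAlmostSplitSeq {X Y Z : C} (f : X ⟶ Y) (g : Y ⟶ Z) : Prop where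
  mid_ne_zero : ¬ Limits.IsZero Y
  left_minimal : IsLeftMinimal f
  left_almostSplit : IsLeftAlmostSplit f
  pseudoKernel : IsPseudoKernel f g
  right_minimal : IsRightMinimal g
  right_almostSplit : IsRightAlmostSplit g
  pseudoCokernel : IsPseudoCokernel f g

/-- `f` lies in the radical `rad(X, Y)` of the category. -/
def InRad {X Y : C} (f : X ⟶ Y) : Prop := ∀ g : Y ⟶ X, IsIso (𝟙 X - f ≫ g)

theorem InRad.zero (X Y : C) : InRad (0 : X ⟶ Y) := fun g => by
  simp only [Limits.zero_comp, sub_zero]; infer_instance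

theorem InRad.add {X Y : C} {f g : X ⟶ Y} (hf : InRad f) (hg : InRad g) : InRad (f + g) := by
  intro h
  have h1 := hf h
  have h2 := hg (h ≫ inv (𝟙 X - f ≫ h))
  have e : 𝟙 X - (f + g) ≫ h
      = (𝟙 X - g ≫ h ≫ inv (𝟙 X - f ≫ h)) ≫ (𝟙 X - f ≫ h) := by
    rw [Preadditive.sub_comp]
    simp only [Category.id_comp, Category.assoc, IsIso.inv_hom_id, Category.comp_id,
      Preadditive.add_comp]
    abel
  rw [e]; infer_instance

theorem InRad.comp_right {X Y Z : C} {f : X ⟶ Y} (hf : InRad f) (h : Y ⟶ Z) :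
    InRad (f ≫ h) := fun g => by
  rw [Category.assoc]; exact hf (h ≫ g)

theorem InRad.comp_left {W X Y : C} {f : X ⟶ Y} (hf : InRad f) (e : W ⟶ X) :
    InRad (e ≫ f) := fun g => by
  have h1 := hf (g ≫ e)
  have k1 : (𝟙 X - f ≫ g ≫ e) ≫ inv (𝟙 X - f ≫ g ≫ e) = 𝟙 X := IsIso.hom_inv_id _
  have k2 : inv (𝟙 X - f ≫ g ≫ e) ≫ (𝟙 X - f ≫ g ≫ e) = 𝟙 X := IsIso.inv_hom_id _
  generalize inv (𝟙 X - f ≫ g ≫ e) = t at k1 k2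
  rw [Preadditive.sub_comp, Category.id_comp, sub_eq_iff_eq_add] at k1
  rw [Preadditive.comp_sub, Category.comp_id, sub_eq_iff_eq_add] at k2
  refine ⟨𝟙 W + e ≫ t ≫ f ≫ g, ?_, ?_⟩
  · have k3 : e ≫ t ≫ f ≫ g = e ≫ f ≫ g + e ≫ (f ≫ g ≫ e) ≫ t ≫ f ≫ g := by
      have := congrArg (fun s => e ≫ s ≫ f ≫ g) k1
      simpa [Preadditive.add_comp, Preadditive.comp_add] using this
    simp only [Preadditive.sub_comp, Preadditive.comp_add, Category.id_comp, Category.comp_id,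
      Category.assoc] at k3 ⊢
    rw [← sub_eq_zero] at k3 ⊢
    rw [← k3]; abel
  · have k3 : e ≫ t ≫ f ≫ g = e ≫ f ≫ g + e ≫ t ≫ (f ≫ g ≫ e) ≫ f ≫ g := by
      have := congrArg (fun s => e ≫ s ≫ f ≫ g) k2
      simpa [Preadditive.add_comp, Preadditive.comp_add] using this
    simp only [Preadditive.comp_sub, Preadditive.add_comp, Category.id_comp, Category.comp_id,
      Category.assoc] at k3 ⊢
    rw [← sub_eq_zero] at k3 ⊢
    rw [← k3]; abel

/-- `rad²(X, Y)`: the sums of compositions of two radical morphisms. -/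
def rad2 (X Y : C) : AddSubgroup (X ⟶ Y) :=
  AddSubgroup.closure
    {h | ∃ (Z : C) (f : X ⟶ Z) (g : Z ⟶ Y), InRad f ∧ InRad g ∧ f ≫ g = h}

theorem rad2_comp_right {X Y Z : C} {f : X ⟶ Y} (hf : f ∈ rad2 X Y) (h : Y ⟶ Z) :
    f ≫ h ∈ rad2 X Z := by
  induction hf using AddSubgroup.closure_induction with
  | mem x hx =>
    obtain ⟨W, a, b, ha, hb, rfl⟩ := hx
    exact AddSubgroup.subset_closure ⟨W, a, b ≫ h, ha, hb.comp_right h, by simp⟩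
  | zero => rw [Limits.zero_comp]; exact zero_mem _
  | add x y _ _ hx hy => rw [Preadditive.add_comp]; exact add_mem hx hy
  | neg x _ hx => rw [Preadditive.neg_comp]; exact neg_mem hx

theorem rad2_comp_left {W X Y : C} {f : X ⟶ Y} (hf : f ∈ rad2 X Y) (e : W ⟶ X) :
    e ≫ f ∈ rad2 W Y := by
  induction hf using AddSubgroup.closure_induction with
  | mem x hx =>
    obtain ⟨V, a, b, ha, hb, rfl⟩ := hx
    exact AddSubgroup.subset_closure ⟨V, e ≫ a, b, ha.comp_left e, hb, by simp⟩
  | zero => rw [Limits.comp_zero]; exact zero_mem _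
  | add x y _ _ hx hy => rw [Preadditive.comp_add]; exact add_mem hx hy
  | neg x _ hx => rw [Preadditive.comp_neg]; exact neg_mem hx

/-- `rad(X, Y)` as a left `End Y`-module. -/
def radR (X Y : C) : Submodule (End Y) (X ⟶ Y) where
  carrier := {f | InRad f}
  add_mem' := InRad.add
  zero_mem' := InRad.zero X Y
  smul_mem' e _ hf := InRad.comp_right hf e

/-- `rad²(X, Y)` as a left `End Y`-module. -/
def rad2R (X Y : C) : Submodule (End Y) (X ⟶ Y) where
  carrier := rad2 X Y
  add_mem' := add_mem
  zero_mem' := zero_mem _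
  smul_mem' e _ hf := rad2_comp_right hf e

/-- `rad(X, Y)` as a right `End X`-module. -/
def radL (X Y : C) : Submodule (End X)ᵐᵒᵖ (X ⟶ Y) where
  carrier := {f | InRad f}
  add_mem' := InRad.add
  zero_mem' := InRad.zero X Y
  smul_mem' e _ hf := InRad.comp_left hf e.unop

/-- `rad²(X, Y)` as a right `End X`-module. -/
def rad2L (X Y : C) : Submodule (End X)ᵐᵒᵖ (X ⟶ Y) where
  carrier := rad2 X Y
  add_mem' := add_mem
  zero_mem' := zero_mem _
  smul_mem' e _ hf := rad2_comp_left hf e.unop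

/-- `irr(X, Y) = rad(X, Y) / rad²(X, Y)` as a left `End Y`-module. -/
abbrev IrrR (X Y : C) : Type _ := radR X Y ⧸ (rad2R X Y).submoduleOf (radR X Y)

/-- `irr(X, Y) = rad(X, Y) / rad²(X, Y)` as a right `End X`-module. -/
abbrev IrrL (X Y : C) : Type _ := radL X Y ⧸ (rad2L X Y).submoduleOf (radL X Y)

/-- `rad(X, X)` as an ideal of `End X`. -/
def radEnd (X : C) : Ideal (End X) where
  carrier := {f | InRad (X := X) (Y := X) f}
  add_mem' := InRad.add
  zero_mem' := InRad.zero X X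
  smul_mem' e _ hf := InRad.comp_right hf e

instance (X : C) : (radEnd X).IsTwoSided where
  mul_mem_of_left b ha := InRad.comp_left ha b

/-- `rad(X, X)` as an ideal of the opposite ring of `End X`. -/
def radEndOp (X : C) : Ideal (End X)ᵐᵒᵖ where
  carrier := {f | InRad (X := X) (Y := X) f.unop}
  add_mem' := InRad.add
  zero_mem' := InRad.zero X X
  smul_mem' e _ hf := InRad.comp_left hf e.unop

instance (X : C) : (radEndOp X).IsTwoSided where
  mul_mem_of_left b ha := InRad.comp_right ha b.unop

theorem irrR_torsion (X Y : C) :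
    Module.IsTorsionBySet (End Y) (IrrR X Y) (radEnd Y : Set (End Y)) := by
  intro m a
  obtain ⟨f, rfl⟩ := Submodule.Quotient.mk_surjective _ m
  rw [← Submodule.Quotient.mk_smul, Submodule.Quotient.mk_eq_zero]
  exact AddSubgroup.subset_closure ⟨Y, f.1, a.1, f.2, a.2, rfl⟩

theorem irrL_torsion (X Y : C) :
    Module.IsTorsionBySet (End X)ᵐᵒᵖ (IrrL X Y) (radEndOp X : Set (End X)ᵐᵒᵖ) := by
  intro m a
  obtain ⟨f, rfl⟩ := Submodule.Quotient.mk_surjective _ m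
  rw [← Submodule.Quotient.mk_smul, Submodule.Quotient.mk_eq_zero]
  exact AddSubgroup.subset_closure ⟨X, a.1.unop, f.1, a.2, f.2, rfl⟩

/-- `d_{XY}`: the dimension of `irr(X, Y)` over `End(Y)/rad(Y, Y)`. -/
noncomputable def irrDim (X Y : C) : ℕ :=
  letI : Module (End Y ⧸ radEnd Y) (IrrR X Y) := (irrR_torsion X Y).module
  Module.finrank (End Y ⧸ radEnd Y) (IrrR X Y)

/-- `d'_{XY}`: the dimension of the right vector space `irr(X, Y)` over `End(X)/rad(X, X)`. -/
noncomputable def irrDim' (X Y : C) : ℕ :=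
  letI : Module ((End X)ᵐᵒᵖ ⧸ radEndOp X) (IrrL X Y) := (irrL_torsion X Y).module
  Module.finrank ((End X)ᵐᵒᵖ ⧸ radEndOp X) (IrrL X Y)

end AR

/-! ### Partially valued translation quivers -/

/-- The data of a partially valued translation quiver with possible multiple arrows.  An unvalued
arrow is an arrow with the trivial valuation `(1, 1)`; `tau z x` says that `τ z` is defined
and equal to `x`. -/
structure TransQuiver where
  V : Type u
  Arrow : V → V → Type v
  val : ∀ {x y : V}, Arrow x y → ℕ × ℕ
  tau : V → V → Prop

namespace TransQuiver

variable (Γ : TransQuiver.{u, v})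

/-- The full translation subquiver generated by a set of vertices. -/
def full (S : Set Γ.V) : TransQuiver.{u, v} where
  V := S
  Arrow x y := Γ.Arrow x y
  val a := Γ.val a
  tau z x := Γ.tau z x

/-- There is an arrow `x → y`. -/
def Adj (x y : Γ.V) : Prop := Nonempty (Γ.Arrow x y)

/-- `S` is the vertex set of a connected component. -/
def IsComponent (S : Set Γ.V) : Prop := ∃ x, S = {y | Relation.EqvGen Γ.Adj x y}

/-- `τ^n z` is defined and equal to `x`; equivalently `τ^{-n} x` is defined and equal to `z`. -/
def TauPow : ℕ → Γ.V → Γ.V → Prop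
  | 0, z, x => z = x
  | n + 1, z, x => ∃ y, Γ.tau z y ∧ TauPow n y x

/-- The `τ`-orbit of `x`. -/
def orbit (x : Γ.V) : Set Γ.V := {y | ∃ n, Γ.TauPow n x y ∨ Γ.TauPow n y x}

/-- Right stable: `τ^{-n} x` is defined for all vertices `x` and all `n ∈ ℕ`. -/
def IsRightStable : Prop := ∀ (x : Γ.V) (n : ℕ), ∃ z, Γ.TauPow n z x

/-- The full subquiver generated by `S` is a section: connected, convex, without oriented cycles,
and meeting each `τ`-orbit exactly once.  (A convex subquiver is full, so it is determined
by its vertices.) -/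
structure IsSection (S : Set Γ.V) : Prop where
  nonempty : S.Nonempty
  connected : ∀ x y : S, Relation.EqvGen (fun a b : S => Γ.Adj a b) x y
  convex : ∀ x ∈ S, ∀ y ∈ S, ∀ z, Relation.ReflTransGen Γ.Adj x z →
    Relation.ReflTransGen Γ.Adj z y → z ∈ S
  acyclic : ∀ x : S, ¬ Relation.TransGen (fun a b : S => Γ.Adj a b) x x
  meets_orbits : ∀ z, ∃! x, x ∈ S ∧ x ∈ Γ.orbit z

/-- A section `S` such that all vertices are of the form `τ^{-n} x` with `n ∈ ℕ` and `x ∈ S`. -/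
def IsLeftMostSection (S : Set Γ.V) : Prop :=
  Γ.IsSection S ∧ ∀ z, ∃ x ∈ S, ∃ n, Γ.TauPow n z x

/-- A section `S` such that all vertices are of the form `τ^n x` with `n ∈ ℕ` and `x ∈ S`. -/
def IsRightMostSection (S : Set Γ.V) : Prop :=
  Γ.IsSection S ∧ ∀ z, ∃ x ∈ S, ∃ n, Γ.TauPow n x z

end TransQuiver

universe u' v'

/-- An embedding of `Γ` in `Δ`, that is, an isomorphism of `Γ` with a full translation subquiver
of `Δ`. -/
structure TransEmbedding (Γ : TransQuiver.{u, v}) (Δ : TransQuiver.{u', v'}) where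
  obj : Γ.V → Δ.V
  obj_injective : Function.Injective obj
  arrow : ∀ x y, Γ.Arrow x y ≃ Δ.Arrow (obj x) (obj y)
  val_eq : ∀ x y (a : Γ.Arrow x y), Δ.val (arrow x y a) = Γ.val a
  tau_iff : ∀ z x, Γ.tau z x ↔ Δ.tau (obj z) (obj x)

/-- The stable translation quiver `ℤΔ`: every arrow `α : x → y` of `Δ` and every `n ∈ ℤ` give arrows
`(n, x) → (n, y)` and `(n, y) → (n + 1, x)`, and `τ (n, x) = (n - 1, x)`. -/
def ZQuiver (D : Type u) [Quiver.{v} D] : TransQuiver.{u, v} where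
  V := ℤ × D
  Arrow p q := {_a : p.2 ⟶ q.2 // q.1 = p.1} ⊕ {_a : q.2 ⟶ p.2 // q.1 = p.1 + 1}
  val _ := (1, 1)
  tau z x := x = (z.1 - 1, z.2)

/-- `ℕΔ`, the full translation subquiver of `ℤΔ` generated by the `(n, x)` with `n ≥ 0`. -/
def NQuiver (D : Type u) [Quiver.{v} D] : TransQuiver.{u, v} :=
  (ZQuiver D).full {p | 0 ≤ p.1}

/-- The Auslander-Reiten quiver of a (Hom-finite Krull-Schmidt) category.  The vertices form a
complete set of representatives of the isomorphism classes of indecomposable objects.  A valued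
arrow `X → Y` with symmetric valuation `(d, d)` is replaced by `d` unvalued arrows, and
`τ Z = X` if and only if there is an almost split sequence `X ⟶ Y ⟶ Z`. -/
noncomputable def arQuiver (C : Type u) [Category.{v} C] [Preadditive C] : TransQuiver.{u, 0} where
  V := {X : Skeleton C // IsIndec ((fromSkeleton C).obj X)}
  Arrow X Y :=
    letI d := irrDim ((fromSkeleton C).obj X.1) ((fromSkeleton C).obj Y.1)
    letI d' := irrDim' ((fromSkeleton C).obj X.1) ((fromSkeleton C).obj Y.1)
    Fin (if d = d' then d else 1)
  val {X Y} _ :=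
    letI d := irrDim ((fromSkeleton C).obj X.1) ((fromSkeleton C).obj Y.1)
    letI d' := irrDim' ((fromSkeleton C).obj X.1) ((fromSkeleton C).obj Y.1)
    if d = d' then (1, 1) else (d, d')
  tau Z X := ∃ (Y : C) (f : (fromSkeleton C).obj X.1 ⟶ Y) (g : Y ⟶ (fromSkeleton C).obj Z.1),
    IsAlmostSplitSeq f g

/-! ### Quivers and their representations -/

/-- Strongly locally finite: locally finite (finitely many arrows start, and finitely many arrows
end, in each vertex) and interval-finite (finitely many paths between any two vertices). -/
structure StronglyLocallyFinite (Q : Type u) [Quiver.{v} Q] : Prop where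
  finite_out : ∀ x : Q, Finite (Σ y : Q, (x ⟶ y))
  finite_in : ∀ x : Q, Finite (Σ y : Q, (y ⟶ x))
  interval_finite : ∀ x y : Q, Finite (Quiver.Path x y)

/-- `Q` has a right infinite path: an infinite sequence of arrows `x₀ → x₁ → x₂ → ⋯`. -/
def HasRightInfinitePath (Q : Type u) [Quiver.{v} Q] : Prop :=
  ∃ x : ℕ → Q, ∀ n, Nonempty (x n ⟶ x (n + 1))

section Rep

variable (k : Type w) [Field k] (Q : Type u) [Quiver.{v} Q]

/-- `Rep(Q)`: the category of `k`-representations of `Q`. -/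
abbrev Rep : Type _ := Paths Q ⥤ ModuleCat.{max u v w} k

variable {Q}

/-- `P_a`: the space `P_a(x)` has the paths from `a` to `x` as a basis, and an arrow acts
by composition. -/
noncomputable def P (a : Q) : Rep.{u, v, w} k Q where
  obj x := ModuleCat.of k (Quiver.Path a x →₀ k)
  map p := ModuleCat.ofHom (Finsupp.lmapDomain k k (fun q => Quiver.Path.comp q p))
  map_id x := by
    ext1
    exact Finsupp.lmapDomain_id k k
  map_comp f g := by
    ext1
    have h : (fun q => Quiver.Path.comp q (f ≫ g)) =
        (fun q => Quiver.Path.comp q g) ∘ (fun q : Quiver.Path a _ => Quiver.Path.comp q f) := by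
      funext q
      exact (Quiver.Path.comp_assoc q f g).symm
    refine Eq.trans ?_ (Finsupp.lmapDomain_comp k k _ _)
    exact congrArg (Finsupp.lmapDomain k k) h

/-- The functor `- ⊗ V` on vector spaces. -/
noncomputable def tensorWith (V : ModuleCat.{u'} k) : ModuleCat.{u'} k ⥤ ModuleCat.{u'} k where
  obj M := ModuleCat.of k (TensorProduct k M V)
  map f := ModuleCat.ofHom (LinearMap.rTensor V f.hom)
  map_id M := by
    ext1
    exact LinearMap.rTensor_id V M
  map_comp f g := by
    ext1
    exact LinearMap.rTensor_comp V g.hom f.hom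

variable {k}

/-- Locally finite dimensional representations; they form the category `rep(Q)`. -/
def IsLocallyFinite (M : Rep.{u, v, w} k Q) : Prop := ∀ x, Module.Finite k (M.obj x)

/-- `M` lies in `Proj(Q)`: it is isomorphic to a finite direct sum of representations `P_a ⊗ U`. -/
def InProj (M : Rep.{u, v, w} k Q) : Prop :=
  ∃ (n : ℕ) (a : Fin n → Q) (U : Fin n → ModuleCat.{max u v w} k),
    Nonempty (M ≅ ∐ fun i => P k (a i) ⋙ tensorWith k (U i))

/-- `M` is finitely presented: there is a short exact sequence `0 ⟶ P₁ ⟶ P₀ ⟶ M ⟶ 0` where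
`P₁` and `P₀` lie in `proj(Q)`, that is, in `Proj(Q)` and are locally finite dimensional. -/
def IsFinPres (M : Rep.{u, v, w} k Q) : Prop :=
  ∃ S : ShortComplex (Rep.{u, v, w} k Q), S.ShortExact ∧ S.X₃ = M ∧
    (InProj S.X₁ ∧ IsLocallyFinite S.X₁) ∧ (InProj S.X₂ ∧ IsLocallyFinite S.X₂)

variable (k Q)

/-- `rep⁺(Q)`: the full subcategory of the finitely presented representations. -/
abbrev RepPlus : Type _ :=
  ObjectProperty.FullSubcategory (fun M : Rep.{u, v, w} k Q => IsFinPres M)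

/-- The Auslander-Reiten quiver of `rep⁺(Q)`. -/
noncomputable abbrev arRepPlus : TransQuiver := arQuiver (RepPlus.{u, v, w} k Q)

variable {k Q}

/-- The vertex `X` of the Auslander-Reiten quiver of `rep⁺(Q)` is (the representative of) `P_a`. -/
def IsP (a : Q) (X : (arRepPlus.{u, v, w} k Q).V) : Prop :=
  Nonempty (((fromSkeleton (RepPlus.{u, v, w} k Q)).obj X.1).obj ≅ P k a)

variable (k Q)

/-- The vertices of the Auslander-Reiten quiver of `rep⁺(Q)` of the form `P_a`, `a ∈ Q₀`. -/
def projVertices : Set (arRepPlus.{u, v, w} k Q).V := {X | ∃ a : Q, IsP a X}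

variable {k Q}

/-- A preprojective component: a connected component containing some of the `P_a`. -/
def IsPreprojectiveComponent (C : Set (arRepPlus.{u, v, w} k Q).V) : Prop :=
  (arRepPlus.{u, v, w} k Q).IsComponent C ∧ (C ∩ projVertices k Q).Nonempty

end Rep
end QuivRep

/-! The component is knitted from the projectives. `XO n x` is the `n`-th inverse translate of
`P_x`, and `Dom n x` says that the earlier terms of the orbit are finite dimensional, which is what
is needed for the inverse translation to be continued. The component consists of the `XO n x` with
`Dom n x`, and the pair `(n, x)` is the coordinate of the vertex in `ℕQᵒᵖ`.

Finite presentation is replaced by the intrinsic condition `IsFP` (`isFinPres_iff`). Its main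
ingredient is the joint map `jm M z` of all arrows ending in `z`: its cokernel counts the generators
at `z` and its kernel the relations. A representation with `IsFP` and all `jm` injective is free.
Injectivity passes to subrepresentations, so kernels of free covers are free, and `rep⁺(Q)` is
closed under extensions and retracts.

The Auslander-Reiten formula `D Ext¹(Y, Z) ≅ Hom(Z, T)` is encoded by one linear form on `Hom(P₁,
T)`, where `P₁` is the first term of a projective presentation of `Y` (`IsARForm`). Such a form
gives an almost split sequence from `T` to `Y` when both are local, and it transports morphisms
between `T` and `Y`. There are two sources of forms. From a finite dimensional `M`, the inverse
Nakayama functor applied to the standard injective coresolution of `M` gives a map of free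
representations `trMap M` with cokernel `TrD M`; the trace is a form if `trMap M` is injective. From
`Y`, the translate is `z ↦ D Ext¹(Y, P_z)`, which is finite dimensional if `Ext¹(Y, P_z) = 0` for
almost all `z` (`IsTF`), a property inherited along irreducible morphisms (`IsTF.of_irrNZ`).

The induction is `isGood_XO`. If the objects up to level `n` are known with their predecessors, a
finite dimensional `XO n x` has, up to isomorphism, finitely many local objects mapping
non-trivially to it, all finite dimensional (`hasFinPreds_of_isGood`). Hence `trMap` is injective
there: otherwise an injective representation would map to `XO n x`, and through it infinitely many
finite dimensional bricks would enter, because `Q` is infinite and connected (`mono_trMap`). So the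
next inverse translate exists. Conversely, an irreducible successor `Y` of an object of the
component is some `P_y`, or has a finite dimensional translate which is a predecessor of that object
and so already of the form `XO m y`; then `Y` is `XO (m + 1) y` (`exists_iso_right`).

All objects of the component are bricks, so the valuations are trivial, and almost split sequences
give the arrow numbers recursively from those between projectives (`irrK_XO`). What remains is
combinatorics (`Coords`), governed by one fact: predecessors of finite dimensional objects of the
component are finite dimensional. If there is no right infinite path, all finitely presented
representations are finite dimensional and no orbit ends. Otherwise some `P_x` is infinite
dimensional; its orbit ends, so do the neighbouring orbits, hence all of them, and the infinite
dimensional objects form the right-most section. -/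

namespace QuivRep

/-! ### Radical, almost split and irreducible morphisms in preadditive categories -/

section Radical

variable {C : Type u} [Category.{v} C] [Preadditive C]

/-- `X` is non-zero and, for each endomorphism `u`, one of `u` and `1 - u` is invertible. -/
def IsLoc (X : C) : Prop :=
  ¬ Limits.IsZero X ∧ ∀ u : X ⟶ X, IsIso u ∨ IsIso (𝟙 X - u)

/-- If `t` is the inverse of `1 - gf`, then `1 + f t g` is the inverse of `1 - fg`. This makes the
radical left-right symmetric. -/
theorem isIso_one_sub_comm {X Y : C} (f : X ⟶ Y) (g : Y ⟶ X) (h : IsIso (𝟙 Y - g ≫ f)) :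
    IsIso (𝟙 X - f ≫ g) := by
  have k1 : (𝟙 Y - g ≫ f) ≫ inv (𝟙 Y - g ≫ f) = 𝟙 Y := IsIso.hom_inv_id _
  have k2 : inv (𝟙 Y - g ≫ f) ≫ (𝟙 Y - g ≫ f) = 𝟙 Y := IsIso.inv_hom_id _
  generalize inv (𝟙 Y - g ≫ f) = t at k1 k2
  rw [Preadditive.sub_comp, Category.id_comp, sub_eq_iff_eq_add] at k1
  rw [Preadditive.comp_sub, Category.comp_id, sub_eq_iff_eq_add] at k2
  refine ⟨𝟙 X + f ≫ t ≫ g, ?_, ?_⟩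
  · have k3 := congrArg (fun s => f ≫ s ≫ g) k1
    simp only [Preadditive.add_comp, Preadditive.comp_add, Category.id_comp,
      Category.assoc] at k3
    simp only [Preadditive.sub_comp, Preadditive.comp_add, Category.id_comp, Category.comp_id,
      Category.assoc]
    rw [← sub_eq_zero] at k3 ⊢
    rw [← k3]; abel
  · have k3 := congrArg (fun s => f ≫ s ≫ g) k2
    simp only [Preadditive.add_comp, Preadditive.comp_add, Category.id_comp,
      Category.assoc] at k3
    simp only [Preadditive.comp_sub, Preadditive.add_comp, Category.id_comp, Category.comp_id,
      Category.assoc]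
    rw [← sub_eq_zero] at k3 ⊢
    rw [← k3]; abel

theorem isIso_of_isSplitMono_of_isSplitEpi {X Y : C} (f : X ⟶ Y) (h1 : IsSplitMono f)
    (h2 : IsSplitEpi f) : IsIso f := by
  have := h1; have := h2
  exact isIso_of_mono_of_isSplitEpi f

theorem IsLoc.inRad_of_not_isSplitMono {X Y : C} (hX : IsLoc X) {f : X ⟶ Y}
    (hf : ¬ IsSplitMono f) : InRad f := by
  intro g
  rcases hX.2 (f ≫ g) with h | h
  · exact absurd (IsSplitMono.mk' ⟨g ≫ inv (f ≫ g), by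
      rw [← Category.assoc, IsIso.hom_inv_id]⟩) hf
  · exact h

theorem IsLoc.inRad_of_not_isSplitEpi {X Y : C} (hY : IsLoc Y) {f : X ⟶ Y}
    (hf : ¬ IsSplitEpi f) : InRad f := by
  intro g
  rcases hY.2 (g ≫ f) with h | h
  · exact absurd (IsSplitEpi.mk' ⟨inv (g ≫ f) ≫ g, by
      rw [Category.assoc, IsIso.inv_hom_id]⟩) hf
  · exact isIso_one_sub_comm f g h

theorem InRad.not_isSplitMono {X Y : C} (hX : ¬ Limits.IsZero X) {f : X ⟶ Y} (hf : InRad f) :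
    ¬ IsSplitMono f := by
  intro h
  have h1 := hf (retraction f)
  rw [IsSplitMono.id, sub_self] at h1
  apply hX
  rw [Limits.IsZero.iff_id_eq_zero, ← IsIso.hom_inv_id (0 : X ⟶ X), Limits.zero_comp]

theorem InRad.not_isSplitEpi {X Y : C} (hY : ¬ Limits.IsZero Y) {f : X ⟶ Y} (hf : InRad f) :
    ¬ IsSplitEpi f := by
  intro h
  have h1 := hf (section_ f)
  have h2 : section_ f ≫ (𝟙 X - f ≫ section_ f) = 0 := by
    rw [Preadditive.comp_sub, Category.comp_id, ← Category.assoc, IsSplitEpi.id,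
      Category.id_comp, sub_self]
  have h3 : section_ f = 0 := by
    rw [← cancel_mono (𝟙 X - f ≫ section_ f), h2, Limits.zero_comp]
  apply hY
  rw [Limits.IsZero.iff_id_eq_zero, ← IsSplitEpi.id f, h3, Limits.zero_comp]

theorem IsLoc.isIndec {X : C} (hX : IsLoc X) : IsIndec X := by
  refine ⟨hX.1, ?_⟩
  rintro Y Z b ⟨hb⟩ ⟨e⟩
  have hid : b.fst ≫ b.inl + b.snd ≫ b.inr = 𝟙 b.pt :=
    Limits.IsBilimit.binary_total hb
  rcases hX.2 (e.hom ≫ (b.fst ≫ b.inl) ≫ e.inv) with h | h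
  · right
    have h1 : IsIso (b.fst ≫ b.inl) := by
      have : b.fst ≫ b.inl = e.inv ≫ (e.hom ≫ (b.fst ≫ b.inl) ≫ e.inv) ≫ e.hom := by simp
      rw [this]; infer_instance
    have h2 : b.inr = 0 := by
      rw [← cancel_mono (b.fst ≫ b.inl)]
      simp
    rw [Limits.IsZero.iff_id_eq_zero, ← b.inr_snd, h2, Limits.zero_comp]
  · left
    have h1 : IsIso (b.snd ≫ b.inr) := by
      have : b.snd ≫ b.inr = e.inv ≫ (𝟙 X - e.hom ≫ (b.fst ≫ b.inl) ≫ e.inv) ≫ e.hom := by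
        rw [← eq_sub_iff_add_eq'] at hid
        rw [hid]; simp
      rw [this]; infer_instance
    have h2 : b.inl = 0 := by
      rw [← cancel_mono (b.snd ≫ b.inr)]
      simp
    rw [Limits.IsZero.iff_id_eq_zero, ← b.inl_fst, h2, Limits.zero_comp]

/-- `irr(X, Y) ≠ 0`. -/
def IrrNZ (X Y : C) : Prop := ∃ f : X ⟶ Y, InRad f ∧ f ∉ rad2 X Y

theorem IrrNZ.congr {X Y X' Y' : C} (h : IrrNZ X Y) (e : X ≅ X') (e' : Y ≅ Y') :
    IrrNZ X' Y' := by
  obtain ⟨f, hf, hf2⟩ := h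
  refine ⟨e.inv ≫ f ≫ e'.hom, (hf.comp_right _).comp_left _, fun h => hf2 ?_⟩
  have := rad2_comp_left (rad2_comp_right h e'.inv) e.hom
  simpa using this

/-- With local ends, a morphism that is not a section (respectively not a retraction) is radical, so
otherwise the composite would be a generator of `rad²`. -/
theorem isSplitMono_or_isSplitEpi_of_notMem_rad2 {X Y Z : C} (hX : IsLoc X) (hY : IsLoc Y)
    {a : X ⟶ Z} {b : Z ⟶ Y} (h : a ≫ b ∉ rad2 X Y) : IsSplitMono a ∨ IsSplitEpi b := by
  by_contra hc
  rw [not_or] at hc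
  exact h (AddSubgroup.subset_closure ⟨Z, a, b, hX.inRad_of_not_isSplitMono hc.1,
    hY.inRad_of_not_isSplitEpi hc.2, rfl⟩)

/-! #### Almost split morphisms and irreducible morphisms -/

/-- The first factor of a product of two radical morphisms is not a section, hence extends along
`f`; the second factor keeps the extension radical. -/
theorem exists_rad_factor_left {X E Y : C} {f : X ⟶ E} (hf : IsLeftAlmostSplit f)
    (hX : IsLoc X) {h : X ⟶ Y} (hh : h ∈ rad2 X Y) : ∃ t : E ⟶ Y, InRad t ∧ f ≫ t = h := by
  induction hh using AddSubgroup.closure_induction with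
  | mem x hx =>
    obtain ⟨W, a, b, ha, hb, rfl⟩ := hx
    obtain ⟨a', rfl⟩ := hf.2 W a (ha.not_isSplitMono hX.1)
    exact ⟨a' ≫ b, hb.comp_left a', by simp⟩
  | zero => exact ⟨0, InRad.zero _ _, by simp⟩
  | add x y _ _ hx hy =>
    obtain ⟨s, hs, rfl⟩ := hx
    obtain ⟨t, ht, rfl⟩ := hy
    exact ⟨s + t, hs.add ht, by simp⟩
  | neg x _ hx =>
    obtain ⟨s, hs, rfl⟩ := hx
    refine ⟨s ≫ (-𝟙 _), hs.comp_right _, by simp⟩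

theorem exists_rad_factor_right {Y E Z : C} {g : E ⟶ Z} (hg : IsRightAlmostSplit g)
    (hZ : IsLoc Z) {h : Y ⟶ Z} (hh : h ∈ rad2 Y Z) : ∃ t : Y ⟶ E, InRad t ∧ t ≫ g = h := by
  induction hh using AddSubgroup.closure_induction with
  | mem x hx =>
    obtain ⟨W, a, b, ha, hb, rfl⟩ := hx
    obtain ⟨b', rfl⟩ := hg.2 W b (hb.not_isSplitEpi hZ.1)
    exact ⟨a ≫ b', ha.comp_right b', by simp⟩
  | zero => exact ⟨0, InRad.zero _ _, by simp⟩
  | add x y _ _ hx hy =>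
    obtain ⟨s, hs, rfl⟩ := hx
    obtain ⟨t, ht, rfl⟩ := hy
    exact ⟨s + t, hs.add ht, by simp⟩
  | neg x _ hx =>
    obtain ⟨s, hs, rfl⟩ := hx
    refine ⟨s ≫ (-𝟙 _), hs.comp_right _, by simp⟩

/-- A left almost split morphism with a radical pseudo-cokernel. -/
theorem comp_mem_rad2_iff_left {X E Y Z : C} {f : X ⟶ E} {g : E ⟶ Z} (hf : IsLeftAlmostSplit f)
    (hX : IsLoc X) (hg : InRad g) (hfg : ∀ (W : C) (h : E ⟶ W), f ≫ h = 0 → ∃ l, g ≫ l = h)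
    (h : E ⟶ Y) : f ≫ h ∈ rad2 X Y ↔ InRad h := by
  constructor
  · intro hh
    obtain ⟨t, ht, hft⟩ := exists_rad_factor_left hf hX hh
    -- Two extensions along `f` differ by a morphism through the radical `g`, so `h` is radical
    -- together with `t`.
    obtain ⟨l, hl⟩ := hfg Y (h - t) (by rw [Preadditive.comp_sub, hft, sub_self])
    have : h = t + g ≫ l := by rw [hl]; abel
    rw [this]
    exact ht.add (hg.comp_right l)
  · intro hh
    exact AddSubgroup.subset_closure ⟨E, f, h, hX.inRad_of_not_isSplitMono hf.1, hh, rfl⟩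

/-- A right almost split morphism with a radical pseudo-kernel. -/
theorem comp_mem_rad2_iff_right {X E Y Z : C} {f : X ⟶ E} {g : E ⟶ Z}
    (hg : IsRightAlmostSplit g)
    (hZ : IsLoc Z) (hf : InRad f) (hfg : ∀ (W : C) (h : W ⟶ E), h ≫ g = 0 → ∃ l, l ≫ f = h)
    (h : Y ⟶ E) : h ≫ g ∈ rad2 Y Z ↔ InRad h := by
  constructor
  · intro hh
    obtain ⟨t, ht, hft⟩ := exists_rad_factor_right hg hZ hh
    obtain ⟨l, hl⟩ := hfg Y (h - t) (by rw [Preadditive.sub_comp, hft, sub_self])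
    have : h = t + l ≫ f := by rw [hl]; abel
    rw [this]
    exact ht.add (hf.comp_left l)
  · intro hh
    exact AddSubgroup.subset_closure ⟨E, h, g, hh, hZ.inRad_of_not_isSplitEpi hg.1, rfl⟩

theorem not_inRad_iff {E Y : C} (hY : IsLoc Y) {t : E ⟶ Y} :
    ¬ InRad t ↔ ∃ s : Y ⟶ E, IsIso (s ≫ t) := by
  constructor
  · intro h
    by_contra hc
    push Not at hc
    refine h (fun g => isIso_one_sub_comm t g ?_)
    exact (hY.2 (g ≫ t)).resolve_left (hc g)
  · rintro ⟨s, hs⟩ ht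
    refine (ht.comp_left s).not_isSplitMono hY.1 ?_
    infer_instance

theorem not_inRad_iff' {E Y : C} (hY : IsLoc Y) {s : Y ⟶ E} :
    ¬ InRad s ↔ ∃ t : E ⟶ Y, IsIso (s ≫ t) := by
  constructor
  · intro h
    by_contra hc
    push Not at hc
    exact h fun g => (hY.2 (s ≫ g)).resolve_left (hc g)
  · rintro ⟨t, hs⟩ ht
    refine (ht.comp_right t).not_isSplitMono hY.1 ?_
    infer_instance

/-- Composition with `f` identifies `irr(X, Y)` with `Hom(E, Y)` modulo its radical part. -/
theorem irrNZ_left_iff {X E Y Z : C} {f : X ⟶ E} {g : E ⟶ Z} (hf : IsLeftAlmostSplit f)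
    (hX : IsLoc X) (hg : InRad g) (hfg : ∀ (W : C) (h : E ⟶ W), f ≫ h = 0 → ∃ l, g ≫ l = h) :
    IrrNZ X Y ↔ ∃ t : E ⟶ Y, ¬ InRad t := by
  constructor
  · rintro ⟨a, ha, ha2⟩
    obtain ⟨t, rfl⟩ := hf.2 Y a (ha.not_isSplitMono hX.1)
    exact ⟨t, fun ht => ha2 ((comp_mem_rad2_iff_left hf hX hg hfg t).2 ht)⟩
  · rintro ⟨t, ht⟩
    exact ⟨f ≫ t, (hX.inRad_of_not_isSplitMono hf.1).comp_right t,
      fun h => ht ((comp_mem_rad2_iff_left hf hX hg hfg t).1 h)⟩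

theorem irrNZ_right_iff {X E Y Z : C} {f : X ⟶ E} {g : E ⟶ Z} (hg : IsRightAlmostSplit g)
    (hZ : IsLoc Z) (hf : InRad f) (hfg : ∀ (W : C) (h : W ⟶ E), h ≫ g = 0 → ∃ l, l ≫ f = h) :
    IrrNZ Y Z ↔ ∃ t : Y ⟶ E, ¬ InRad t := by
  constructor
  · rintro ⟨a, ha, ha2⟩
    obtain ⟨t, rfl⟩ := hg.2 Y a (ha.not_isSplitEpi hZ.1)
    exact ⟨t, fun ht => ha2 ((comp_mem_rad2_iff_right hg hZ hf hfg t).2 ht)⟩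
  · rintro ⟨t, ht⟩
    exact ⟨t ≫ g, (hZ.inRad_of_not_isSplitEpi hg.1).comp_left t,
      fun h => ht ((comp_mem_rad2_iff_right hg hZ hf hfg t).1 h)⟩

theorem IsAlmostSplitSeq.inRad_left {X E Z : C} {f : X ⟶ E} {g : E ⟶ Z}
    (h : IsAlmostSplitSeq f g) (hX : IsLoc X) : InRad f :=
  hX.inRad_of_not_isSplitMono h.left_almostSplit.1

theorem IsAlmostSplitSeq.inRad_right {X E Z : C} {f : X ⟶ E} {g : E ⟶ Z}
    (h : IsAlmostSplitSeq f g) (hZ : IsLoc Z) : InRad g :=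
  hZ.inRad_of_not_isSplitEpi h.right_almostSplit.1

/-- Both sides say that the local object `Y` is a direct summand of the middle term. -/
theorem IsAlmostSplitSeq.irrNZ_iff {X E Y Z : C} {f : X ⟶ E} {g : E ⟶ Z}
    (h : IsAlmostSplitSeq f g) (hX : IsLoc X) (hZ : IsLoc Z) (hY : IsLoc Y) :
    IrrNZ X Y ↔ IrrNZ Y Z := by
  rw [irrNZ_left_iff h.left_almostSplit hX (h.inRad_right hZ) h.pseudoCokernel.2,
    irrNZ_right_iff h.right_almostSplit hZ (h.inRad_left hX) h.pseudoKernel.2]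
  constructor
  · rintro ⟨t, ht⟩
    obtain ⟨s, hs⟩ := (not_inRad_iff hY).1 ht
    exact ⟨s, (not_inRad_iff' hY).2 ⟨t, hs⟩⟩
  · rintro ⟨s, ht⟩
    obtain ⟨t, hs⟩ := (not_inRad_iff' hY).1 ht
    exact ⟨t, (not_inRad_iff hY).2 ⟨s, hs⟩⟩

/-- Minimal right almost split morphisms with the same codomain are isomorphic. -/
theorem exists_iso_of_isRightAlmostSplit {E E' Z : C} {g : E ⟶ Z} {g' : E' ⟶ Z}
    (h : IsRightAlmostSplit g) (hm : IsRightMinimal g) (h' : IsRightAlmostSplit g')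
    (hm' : IsRightMinimal g') : ∃ e : E ≅ E', e.hom ≫ g' = g := by
  obtain ⟨a, ha⟩ := h'.2 _ g h.1
  obtain ⟨b, hb⟩ := h.2 _ g' h'.1
  have := hm (a ≫ b) (by rw [Category.assoc, hb, ha])
  have := hm' (b ≫ a) (by rw [Category.assoc, ha, hb])
  have h1 : IsSplitMono a := IsSplitMono.mk' ⟨b ≫ inv (a ≫ b), by
    rw [← Category.assoc, IsIso.hom_inv_id]⟩
  have h2 : IsSplitEpi a := IsSplitEpi.mk' ⟨inv (b ≫ a) ≫ b, by
    rw [Category.assoc, IsIso.inv_hom_id]⟩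
  have := isIso_of_isSplitMono_of_isSplitEpi a h1 h2
  exact ⟨asIso a, ha⟩

end Radical

/-! ### Dimensions of `irr(X, Y)` over the base field, and local endomorphism algebras -/

section LinearRadical

variable (k : Type w) [Field k] {C : Type u} [Category.{v} C] [Preadditive C] [Linear k C]

/-- All endomorphisms of the non-zero object `X` are scalars. -/
def IsBrick (X : C) : Prop := ¬ Limits.IsZero X ∧ ∀ u : X ⟶ X, ∃ c : k, u = c • 𝟙 X

variable {k} in
theorem IsBrick.isIso_smul {X : C} {c : k} (hc : c ≠ 0) : IsIso (c • 𝟙 X) :=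
  ⟨c⁻¹ • 𝟙 X, by simp [smul_smul, hc], by simp [smul_smul, hc]⟩

variable {k} in
theorem IsBrick.isLoc {X : C} (hX : IsBrick k X) : IsLoc X := by
  refine ⟨hX.1, fun u => ?_⟩
  obtain ⟨c, rfl⟩ := hX.2 u
  by_cases hc : c = 0
  · right
    subst hc
    simp only [zero_smul, sub_zero]
    infer_instance
  · exact Or.inl (IsBrick.isIso_smul hc)

variable {k} in
theorem IsBrick.smul_injective {X : C} (hX : IsBrick k X) {c d : k} (h : c • 𝟙 X = d • 𝟙 X) :
    c = d := by
  by_contra hne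
  have h0 : (c - d) • 𝟙 X = 0 := by rw [sub_smul, h, sub_self]
  have := IsBrick.isIso_smul (X := X) (sub_ne_zero.2 hne)
  apply hX.1
  rw [h0] at this
  rw [Limits.IsZero.iff_id_eq_zero, ← IsIso.hom_inv_id (0 : X ⟶ X), Limits.zero_comp]

variable {k} in
theorem IsBrick.inRad_iff {X : C} (hX : IsBrick k X) (u : X ⟶ X) : InRad u ↔ u = 0 := by
  constructor
  · intro hu
    obtain ⟨c, rfl⟩ := hX.2 u
    by_cases hc : c = 0
    · simp [hc]
    · exact absurd (by have := IsBrick.isIso_smul (X := X) hc; infer_instance)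
        (hu.not_isSplitMono hX.1)
  · rintro rfl
    exact InRad.zero _ _

/-- The radical as a subspace. -/
def radK (X Y : C) : Submodule k (X ⟶ Y) where
  carrier := {f | InRad f}
  add_mem' := InRad.add
  zero_mem' := InRad.zero X Y
  smul_mem' c f hf := by
    have : c • f = (c • 𝟙 X) ≫ f := by simp
    rw [this]; exact hf.comp_left _

/-- The square of the radical as a subspace. -/
def rad2K (X Y : C) : Submodule k (X ⟶ Y) where
  carrier := rad2 X Y
  add_mem' := add_mem
  zero_mem' := zero_mem _
  smul_mem' c f hf := by
    have : c • f = (c • 𝟙 X) ≫ f := by simp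
    rw [this]; exact rad2_comp_left hf _

/-- The dimension over `k` of `irr(X, Y)`. -/
noncomputable def irrK (X Y : C) : ℕ :=
  Module.finrank k (radK k X Y ⧸ (rad2K k X Y).submoduleOf (radK k X Y))

/-- For a brick, the residue algebra of the endomorphism ring is `k` itself, acting through scalar
multiples of the identity. So both dimensions of an arrow between bricks are the `k`-dimension
`irrK`. -/
theorem irrDim_eq_irrK {X Y : C} (hY : IsBrick k Y) : irrDim X Y = irrK k X Y := by
  let _ : Module (End Y ⧸ radEnd Y) (IrrR X Y) := (irrR_torsion X Y).module
  symm
  refine congrArg Cardinal.toNat ?_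
  refine rank_eq_of_equiv_equiv
    (fun c : k => (Ideal.Quotient.mk (radEnd Y) (c • 𝟙 Y : Y ⟶ Y)))
    { toFun := Quotient.map' (fun x => ⟨x.1, x.2⟩) fun a b h => by
        rw [Submodule.quotientRel_def] at h ⊢
        exact h
      invFun := Quotient.map' (fun x => ⟨x.1, x.2⟩) fun a b h => by
        rw [Submodule.quotientRel_def] at h ⊢
        exact h
      left_inv := by rintro ⟨x⟩; rfl
      right_inv := by rintro ⟨x⟩; rfl
      map_add' := by rintro ⟨x⟩ ⟨y⟩; rfl } ?_ ?_
  · constructor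
    · intro c d h
      rw [Ideal.Quotient.eq] at h
      have h' : InRad ((c • 𝟙 Y : Y ⟶ Y) - d • 𝟙 Y) := h
      rw [hY.inRad_iff, sub_eq_zero] at h'
      exact hY.smul_injective h'
    · intro q
      obtain ⟨u, rfl⟩ := Ideal.Quotient.mk_surjective q
      obtain ⟨c, hc⟩ := hY.2 u
      exact ⟨c, by rw [hc]⟩
  · rintro c ⟨x⟩
    refine congrArg (Submodule.Quotient.mk (p := (rad2R X Y).submoduleOf (radR X Y))) ?_
    ext
    change c • x.1 = x.1 ≫ (c • 𝟙 Y)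
    simp

theorem irrDim'_eq_irrK {X Y : C} (hX : IsBrick k X) : irrDim' X Y = irrK k X Y := by
  let _ : Module ((End X)ᵐᵒᵖ ⧸ radEndOp X) (IrrL X Y) := (irrL_torsion X Y).module
  symm
  refine congrArg Cardinal.toNat ?_
  refine rank_eq_of_equiv_equiv
    (fun c : k => (Ideal.Quotient.mk (radEndOp X) (MulOpposite.op (c • 𝟙 X : X ⟶ X))))
    { toFun := Quotient.map' (fun x => ⟨x.1, x.2⟩) fun a b h => by
        rw [Submodule.quotientRel_def] at h ⊢
        exact h
      invFun := Quotient.map' (fun x => ⟨x.1, x.2⟩) fun a b h => by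
        rw [Submodule.quotientRel_def] at h ⊢
        exact h
      left_inv := by rintro ⟨x⟩; rfl
      right_inv := by rintro ⟨x⟩; rfl
      map_add' := by rintro ⟨x⟩ ⟨y⟩; rfl } ?_ ?_
  · constructor
    · intro c d h
      rw [Ideal.Quotient.eq] at h
      have h' : InRad ((c • 𝟙 X : X ⟶ X) - d • 𝟙 X) := h
      rw [hX.inRad_iff, sub_eq_zero] at h'
      exact hX.smul_injective h'
    · intro q
      obtain ⟨u, rfl⟩ := Ideal.Quotient.mk_surjective q
      obtain ⟨c, hc⟩ := hX.2 u.unop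
      exact ⟨c, congrArg (fun t => Ideal.Quotient.mk (radEndOp X) (MulOpposite.op t)) hc.symm⟩
  · rintro c ⟨x⟩
    refine congrArg (Submodule.Quotient.mk (p := (rad2L X Y).submoduleOf (radL X Y))) ?_
    ext
    change c • x.1 = (c • 𝟙 X) ≫ x.1
    simp

theorem irrDim_eq_zero {X Y : C} (h0 : ¬ Limits.IsZero Y) (h : ¬ IrrNZ X Y) : irrDim X Y = 0 := by
  let _ : Module (End Y ⧸ radEnd Y) (IrrR X Y) := (irrR_torsion X Y).module
  -- Over the zero ring every module has `finrank` one, so the vanishing needs the residue ring to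
  -- be non-zero.
  have : Nontrivial (End Y ⧸ radEnd Y) := by
    rw [Ideal.Quotient.nontrivial_iff, Ideal.ne_top_iff_one]
    exact fun h1 => InRad.not_isSplitMono h0 (f := 𝟙 Y) h1 inferInstance
  have : Subsingleton (IrrR X Y) := by
    rw [Submodule.Quotient.subsingleton_iff, eq_top_iff]
    intro f _
    by_contra hf
    exact h ⟨f.1, f.2, hf⟩
  exact Module.finrank_zero_of_subsingleton

theorem irrDim'_eq_zero {X Y : C} (h0 : ¬ Limits.IsZero X) (h : ¬ IrrNZ X Y) : irrDim' X Y = 0 := by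
  let _ : Module ((End X)ᵐᵒᵖ ⧸ radEndOp X) (IrrL X Y) := (irrL_torsion X Y).module
  have : Nontrivial ((End X)ᵐᵒᵖ ⧸ radEndOp X) := by
    rw [Ideal.Quotient.nontrivial_iff, Ideal.ne_top_iff_one]
    exact fun h1 => InRad.not_isSplitMono h0 (f := 𝟙 X) h1 inferInstance
  have : Subsingleton (IrrL X Y) := by
    rw [Submodule.Quotient.subsingleton_iff, eq_top_iff]
    intro f _
    by_contra hf
    exact h ⟨f.1, f.2, hf⟩
  exact Module.finrank_zero_of_subsingleton

theorem irrK_pos_iff {X Y : C} [Module.Finite k (X ⟶ Y)] : 0 < irrK k X Y ↔ IrrNZ X Y := by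
  rw [irrK, Module.finrank_pos_iff, ← not_iff_not, not_nontrivial_iff_subsingleton,
    Submodule.Quotient.subsingleton_iff, eq_top_iff]
  constructor
  · rintro h ⟨f, hf, hf2⟩
    exact hf2 (h (show (⟨f, hf⟩ : radK k X Y) ∈ ⊤ from trivial))
  · intro h f _
    by_contra hf
    exact h ⟨f.1, f.2, hf⟩

variable {k} in
-- Since `End Y = k`, composition is a bilinear pairing of `Hom(Y, E)` and `Hom(E, Y)` with values
-- in `k`. Its two kernels are the radical subspaces, and the two quotients by the kernels have the
-- rank of the pairing as dimension.
theorem finrank_quotient_radK_comm {E Y : C} (hY : IsBrick k Y) [Module.Finite k (Y ⟶ E)]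
    [Module.Finite k (E ⟶ Y)] :
    Module.finrank k ((E ⟶ Y) ⧸ radK k E Y) = Module.finrank k ((Y ⟶ E) ⧸ radK k Y E) := by
  choose c hc using hY.2
  have hcu : ∀ u a, u = a • 𝟙 Y → c u = a := fun u a h =>
    hY.smul_injective ((hc u).symm.trans h)
  let B : (Y ⟶ E) →ₗ[k] (E ⟶ Y) →ₗ[k] k := LinearMap.mk₂ k (fun s t => c (s ≫ t))
    (fun s s' t => hcu _ _ (by rw [add_smul, ← hc, ← hc, Preadditive.add_comp]))
    (fun a s t => hcu _ _ (by rw [smul_eq_mul, mul_smul, ← hc, Linear.smul_comp]))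
    (fun s t t' => hcu _ _ (by rw [add_smul, ← hc, ← hc, Preadditive.comp_add]))
    (fun a s t => hcu _ _ (by rw [smul_eq_mul, mul_smul, ← hc, Linear.comp_smul]))
  have key : ∀ u : Y ⟶ Y, c u = 0 ↔ ¬ IsIso u := by
    intro u
    constructor
    · intro h hu
      rw [hc u, h, zero_smul] at hu
      apply hY.1
      rw [Limits.IsZero.iff_id_eq_zero, ← IsIso.hom_inv_id (0 : Y ⟶ Y), Limits.zero_comp]
    · intro h
      by_contra h'
      rw [hc u] at h
      exact h (IsBrick.isIso_smul h')
  have h1 : LinearMap.ker B = radK k Y E := by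
    ext s
    rw [LinearMap.mem_ker]
    change _ ↔ InRad s
    rw [← not_iff_not, not_inRad_iff' hY.isLoc, ← not_iff_not]
    push Not
    simp_rw [← key]
    exact LinearMap.ext_iff
  have h2 : LinearMap.ker B.flip = radK k E Y := by
    ext s
    rw [LinearMap.mem_ker]
    change _ ↔ InRad s
    rw [← not_iff_not, not_inRad_iff hY.isLoc, ← not_iff_not]
    push Not
    simp_rw [← key]
    exact LinearMap.ext_iff
  rw [← h1, ← h2, (LinearMap.quotKerEquivRange B).finrank_eq,
    (LinearMap.quotKerEquivRange B.flip).finrank_eq]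
  have h3 : B.flip = B.dualMap ∘ₗ (Module.evalEquiv k (E ⟶ Y)).toLinearMap := by
    ext t s
    rfl
  rw [h3, LinearMap.range_comp_of_range_eq_top _ (LinearEquiv.range _),
    LinearMap.finrank_range_dualMap_eq_finrank_range]

/-- Composition with `f` maps `Hom(E, Y)` onto `irr(X, Y)`, and its kernel is the radical part by
`comp_mem_rad2_iff_left`. -/
theorem irrK_eq_left {X E Y Z : C} {f : X ⟶ E} {g : E ⟶ Z}
    (h : IsAlmostSplitSeq f g) (hX : IsLoc X) (hZ : IsLoc Z) :
    irrK k X Y = Module.finrank k ((E ⟶ Y) ⧸ radK k E Y) := by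
  have hiff := comp_mem_rad2_iff_left (Y := Y) h.left_almostSplit hX (h.inRad_right hZ)
    h.pseudoCokernel.2
  let φ : (E ⟶ Y) →ₗ[k] radK k X Y :=
    { toFun := fun t => ⟨f ≫ t, (h.inRad_left hX).comp_right t⟩
      map_add' := fun a b => Subtype.ext (by simp)
      map_smul' := fun a b => Subtype.ext (by simp) }
  let ψ := (Submodule.mkQ ((rad2K k X Y).submoduleOf (radK k X Y))).comp φ
  have hψ : Function.Surjective ψ := by
    refine (Submodule.mkQ_surjective _).comp ?_
    rintro ⟨a, ha⟩
    obtain ⟨t, rfl⟩ := h.left_almostSplit.2 Y a (InRad.not_isSplitMono hX.1 ha)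
    exact ⟨t, rfl⟩
  have hk : LinearMap.ker ψ = radK k E Y := by
    ext t
    rw [LinearMap.mem_ker]
    change Submodule.Quotient.mk _ = _ ↔ InRad t
    rw [Submodule.Quotient.mk_eq_zero]
    exact hiff t
  rw [← hk, (LinearMap.quotKerEquivOfSurjective ψ hψ).finrank_eq]
  rfl

theorem irrK_eq_right {X E Y Z : C} {f : X ⟶ E} {g : E ⟶ Z}
    (hg : IsRightAlmostSplit g) (hZ : IsLoc Z) (hf : InRad f)
    (hfg : ∀ (W : C) (h : W ⟶ E), h ≫ g = 0 → ∃ l, l ≫ f = h) :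
    irrK k Y Z = Module.finrank k ((Y ⟶ E) ⧸ radK k Y E) := by
  have hiff := comp_mem_rad2_iff_right (Y := Y) hg hZ hf hfg
  let φ : (Y ⟶ E) →ₗ[k] radK k Y Z :=
    { toFun := fun t => ⟨t ≫ g, (hZ.inRad_of_not_isSplitEpi hg.1).comp_left t⟩
      map_add' := fun a b => Subtype.ext (by simp)
      map_smul' := fun a b => Subtype.ext (by simp) }
  let ψ := (Submodule.mkQ ((rad2K k Y Z).submoduleOf (radK k Y Z))).comp φ
  have hψ : Function.Surjective ψ := by
    refine (Submodule.mkQ_surjective _).comp ?_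
    rintro ⟨a, ha⟩
    obtain ⟨t, rfl⟩ := hg.2 Y a (InRad.not_isSplitEpi hZ.1 ha)
    exact ⟨t, rfl⟩
  have hk : LinearMap.ker ψ = radK k Y E := by
    ext t
    rw [LinearMap.mem_ker]
    change Submodule.Quotient.mk _ = _ ↔ InRad t
    rw [Submodule.Quotient.mk_eq_zero]
    exact hiff t
  rw [← hk, (LinearMap.quotKerEquivOfSurjective ψ hψ).finrank_eq]
  rfl

/-- The knitting rule: both numbers are the multiplicity of `Y` in the middle term. -/
theorem irrK_eq_of_isAlmostSplitSeq {X E Y Z : C} {f : X ⟶ E} {g : E ⟶ Z}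
    (h : IsAlmostSplitSeq f g) (hX : IsLoc X) (hZ : IsLoc Z) (hY : IsBrick k Y)
    [Module.Finite k (Y ⟶ E)] [Module.Finite k (E ⟶ Y)] :
    irrK k X Y = irrK k Y Z := by
  rw [irrK_eq_left k h hX hZ,
    irrK_eq_right k h.right_almostSplit hZ (h.inRad_left hX) h.pseudoKernel.2, finrank_quotient_radK_comm hY]

variable {k} in
/-- An indecomposable object with split idempotents and finite dimensional endomorphism algebra
has a local endomorphism algebra. -/
theorem isLoc_of_forall_idempotent {X : C} [Module.Finite k (X ⟶ X)] (hX : ¬ Limits.IsZero X)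
    (h : ∀ e : X ⟶ X, e ≫ e = e → e = 0 ∨ e = 𝟙 X) : IsLoc X := by
  refine ⟨hX, fun u => ?_⟩
  have : Module.Finite k (End X) := ‹Module.Finite k (X ⟶ X)›
  let a : End X := u
  have hint : IsIntegral k a := Algebra.IsIntegral.isIntegral a
  -- Fitting's decomposition: the minimal polynomial is `X ^ n * q` with `q` prime to `X`, and the
  -- Bézout relation between `X ^ (n + 1)` and `q` produces an idempotent in `k[a]`.
  obtain ⟨q, hnq, hq⟩ := Polynomial.exists_eq_pow_rootMultiplicity_mul_and_not_dvd
    (minpoly k a) (minpoly.ne_zero hint) 0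
  rw [Polynomial.C_0, sub_zero] at hnq hq
  obtain ⟨n, hn⟩ : ∃ n, n = (minpoly k a).rootMultiplicity 0 := ⟨_, rfl⟩
  rw [← hn] at hnq
  obtain ⟨r, s, hrs⟩ : IsCoprime ((Polynomial.X : Polynomial k) ^ (n + 1)) q :=
    ((Polynomial.irreducible_X.coprime_iff_not_dvd).2 hq).pow_left
  have hm : a ^ n * Polynomial.aeval a q = 0 := by
    rw [← Polynomial.aeval_X_pow (R := k) a, ← map_mul, ← hnq]
    exact minpoly.aeval k a
  obtain ⟨R, hR⟩ : ∃ R, R = Polynomial.aeval a r := ⟨_, rfl⟩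
  obtain ⟨S, hS⟩ : ∃ S, S = Polynomial.aeval a s := ⟨_, rfl⟩
  obtain ⟨Z, hZ⟩ : ∃ Z, Z = Polynomial.aeval a q := ⟨_, rfl⟩
  have h1 : R * a ^ (n + 1) + S * Z = 1 := by
    have := congrArg (Polynomial.aeval a) hrs
    simpa [← hR, ← hS, ← hZ] using this
  have hc1 : Commute a R := by
    have : Commute (Polynomial.aeval a (Polynomial.X : Polynomial k)) (Polynomial.aeval a r) := by
      rw [commute_iff_eq, ← map_mul, ← map_mul, mul_comm]
    rwa [Polynomial.aeval_X, ← hR] at this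
  rw [← hZ] at hm
  have h2 : (R * a ^ (n + 1)) * (S * Z) = 0 := by
    have hcZ : Commute S Z := by
      rw [hS, hZ, commute_iff_eq, ← map_mul, ← map_mul, mul_comm]
    rw [hcZ.eq, pow_succ', mul_assoc, mul_assoc, ← mul_assoc (a ^ n), hm]
    simp
  have h3 : (R * a ^ (n + 1)) * (R * a ^ (n + 1)) = R * a ^ (n + 1) := by
    calc (R * a ^ (n + 1)) * (R * a ^ (n + 1))
        = (R * a ^ (n + 1)) * (R * a ^ (n + 1) + S * Z) := by rw [mul_add, h2, add_zero]
      _ = R * a ^ (n + 1) := by rw [h1, mul_one]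
  -- The idempotent `0` forces `a` to be nilpotent, and the idempotent `1` makes `a` invertible.
  rcases h (R * a ^ (n + 1) : End X) h3 with h4 | h4
  · right
    have h4' : R * a ^ (n + 1) = 0 := h4
    rw [h4', zero_add] at h1
    have hcZ : Z * S = 1 := by
      rw [← h1, hS, hZ, ← map_mul, ← map_mul, mul_comm]
    have h5 : a ^ n = 0 := by
      rw [← mul_one (a ^ n), ← hcZ, ← mul_assoc, hm, zero_mul]
    have h6 : IsUnit (1 - a) := IsNilpotent.isUnit_one_sub ⟨n, h5⟩
    exact (isUnit_iff_isIso (1 - a)).1 h6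
  · left
    have h4' : R * a ^ (n + 1) = 1 := h4
    refine (isUnit_iff_isIso a).1 (isUnit_iff_exists.2 ⟨R * a ^ n, ?_, ?_⟩)
    · rw [← mul_assoc, hc1.eq, mul_assoc, ← pow_succ', h4']
    · rw [mul_assoc, ← pow_succ, h4']

end LinearRadical

/-! ### Short exact sequences and almost split sequences in abelian categories -/

section AlmostSplit

variable {A : Type u} [Category.{v} A] [Abelian A]

theorem shortExact_desc {S : ShortComplex A} (hS : S.ShortExact) {Z : A} (d : S.X₂ ⟶ Z)
    (h : S.f ≫ d = 0) : ∃ r : S.X₃ ⟶ Z, S.g ≫ r = d :=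
  have := hS.epi_g
  ⟨hS.exact.desc d h, hS.exact.g_desc d h⟩

theorem shortExact_lift {S : ShortComplex A} (hS : S.ShortExact) {Z : A} (d : Z ⟶ S.X₂)
    (h : d ≫ S.g = 0) : ∃ r : Z ⟶ S.X₁, r ≫ S.f = d :=
  have := hS.mono_f
  ⟨hS.exact.lift d h, hS.exact.lift_f d h⟩

theorem shortExact_of_desc {X Y Z : A} {f : X ⟶ Y} {g : Y ⟶ Z} [Mono f] [Epi g] (w : f ≫ g = 0)
    (h : ∀ (W : A) (d : Y ⟶ W), f ≫ d = 0 → ∃ r, g ≫ r = d) :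
    (ShortComplex.mk f g w).ShortExact where
  exact := ShortComplex.exact_of_g_is_cokernel _
    (Limits.CokernelCofork.IsColimit.ofπ' g w fun d hd => ⟨(h _ d hd).choose, (h _ d hd).choose_spec⟩)
  mono_f := ‹_›
  epi_g := ‹_›

theorem shortExact_of_lift {X Y Z : A} {f : X ⟶ Y} {g : Y ⟶ Z} [Mono f] [Epi g] (w : f ≫ g = 0)
    (h : ∀ (W : A) (d : W ⟶ Y), d ≫ g = 0 → ∃ r, r ≫ f = d) :
    (ShortComplex.mk f g w).ShortExact where
  exact := ShortComplex.exact_of_f_is_kernel _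
    (Limits.KernelFork.IsLimit.ofι' f w fun d hd => ⟨(h _ d hd).choose, (h _ d hd).choose_spec⟩)
  mono_f := ‹_›
  epi_g := ‹_›

/-- A short exact sequence with local end terms which starts with a left almost split morphism
is an almost split sequence. -/
theorem isAlmostSplitSeq_of_shortExact {S : ShortComplex A} (hS : S.ShortExact)
    (h1 : IsLoc S.X₁) (h3 : IsLoc S.X₃) (hf : IsLeftAlmostSplit S.f) :
    IsAlmostSplitSeq S.f S.g := by
  have hmono := hS.mono_f
  have hepi := hS.epi_g
  have hg : ¬ IsSplitEpi S.g := by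
    intro h
    apply hf.1
    obtain ⟨r, hr⟩ := shortExact_lift hS (𝟙 _ - S.g ≫ section_ S.g) (by simp)
    refine IsSplitMono.mk' ⟨r, ?_⟩
    rw [← cancel_mono S.f, Category.assoc, hr]
    simp
  refine ⟨?_, ?_, hf, ⟨S.zero, fun W h hh => shortExact_lift hS h hh⟩, ?_, ⟨hg, ?_⟩,
    ⟨S.zero, fun W h hh => shortExact_desc hS h hh⟩⟩
  · intro h0
    exact h1.1 (h0.of_mono S.f)
  · intro h hh
    obtain ⟨t, ht⟩ := shortExact_desc hS (𝟙 _ - h) (by simp [hh])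
    have : IsIso (𝟙 S.X₃ - t ≫ S.g) := by
      refine (h3.2 (t ≫ S.g)).resolve_left fun hi => hg ?_
      exact IsSplitEpi.mk' ⟨inv (t ≫ S.g) ≫ t, by rw [Category.assoc, IsIso.inv_hom_id]⟩
    have := isIso_one_sub_comm S.g t this
    rwa [ht, sub_sub_cancel] at this
  · intro h hh
    obtain ⟨t, ht⟩ := shortExact_lift hS (𝟙 _ - h) (by simp [hh])
    have : IsIso (𝟙 S.X₁ - S.f ≫ t) := by
      refine (h1.2 (S.f ≫ t)).resolve_left fun hi => hf.1 ?_
      exact IsSplitMono.mk' ⟨t ≫ inv (S.f ≫ t), by rw [← Category.assoc, IsIso.hom_inv_id]⟩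
    have := isIso_one_sub_comm t S.f this
    rwa [ht, sub_sub_cancel] at this
  · intro W h hh
    by_contra hc
    push Not at hc
    -- The sequence is pulled back along `h`. If the pulled back sequence split, `h` would factor
    -- through `S.g`; so its first map is not a section and extends along `S.f`.
    let ι' : S.X₁ ⟶ Limits.pullback S.g h := Limits.pullback.lift S.f 0 (by simp)
    have hι1 : ι' ≫ Limits.pullback.fst S.g h = S.f := Limits.pullback.lift_fst _ _ _
    have hι2 : ι' ≫ Limits.pullback.snd S.g h = 0 := Limits.pullback.lift_snd _ _ _
    have hι : ¬ IsSplitMono ι' := by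
      intro hs
      have hk : (𝟙 _ - retraction ι' ≫ ι') ≫ Limits.pullback.fst S.g h ≫ S.g
          = (Limits.pullback.snd S.g h) ≫ h := by
        rw [← Category.assoc, Preadditive.sub_comp, Category.assoc, hι1, Preadditive.sub_comp,
          Category.assoc, Category.assoc, S.zero, Limits.comp_zero, sub_zero, Category.id_comp,
          Limits.pullback.condition]
      have hse : (ShortComplex.mk ι' (Limits.pullback.snd S.g h) hι2).ShortExact := by
        have : Mono ι' := inferInstance
        refine shortExact_of_lift hι2 fun W x hx => ?_
        obtain ⟨e, he⟩ := shortExact_lift hS (x ≫ Limits.pullback.fst S.g h) (by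
          rw [Category.assoc, Limits.pullback.condition, ← Category.assoc, hx, Limits.zero_comp])
        refine ⟨e, ?_⟩
        apply Limits.pullback.hom_ext
        · rw [Category.assoc, hι1, he]
        · rw [Category.assoc, hι2, Limits.comp_zero, hx]
      obtain ⟨r, hr⟩ := shortExact_desc hse (𝟙 _ - retraction ι' ≫ ι') (by simp)
      apply hc (r ≫ Limits.pullback.fst S.g h)
      have : Epi (Limits.pullback.snd S.g h) := inferInstance
      rw [← cancel_epi (Limits.pullback.snd S.g h), ← hk, ← Category.assoc, ← Category.assoc,
        ← Category.assoc]
      exact congrArg (fun t => (t ≫ _) ≫ _) hr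
    obtain ⟨q, hq⟩ := hf.2 _ ι' hι
    obtain ⟨r, hr⟩ := shortExact_desc hS (q ≫ Limits.pullback.snd S.g h)
      (by rw [← Category.assoc, hq, hι2])
    rcases h3.2 (r ≫ h) with hu | hu
    · exact hh (IsSplitEpi.mk' ⟨inv (r ≫ h) ≫ r, by rw [Category.assoc, IsIso.inv_hom_id]⟩)
    -- Here `r` is the map induced on the end terms. If `1 - r h` is invertible, the morphism `t`
    -- satisfies `t g = 1 - r h`, so that `S.g` would split.
    · obtain ⟨t, ht⟩ := shortExact_desc hS (𝟙 _ - q ≫ Limits.pullback.fst S.g h)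
        (by rw [Preadditive.comp_sub, ← Category.assoc, hq, hι1, Category.comp_id, sub_self])
      have h4 : t ≫ S.g = 𝟙 _ - r ≫ h := by
        rw [← cancel_epi S.g, ← Category.assoc, ht, Preadditive.sub_comp, Category.assoc,
          Limits.pullback.condition, ← Category.assoc, ← hr]
        simp
      rw [← h4] at hu
      exact hg (IsSplitEpi.mk' ⟨inv (t ≫ S.g) ≫ t, by rw [Category.assoc, IsIso.inv_hom_id]⟩)

/-- A short exact sequence `0 ⟶ P1 ⟶ P0 ⟶ Y ⟶ 0` with `P0` projective. -/
structure Pres (Y : A) where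
  P1 : A
  P0 : A
  i : P1 ⟶ P0
  p : P0 ⟶ Y
  w : i ≫ p = 0
  shortExact : (ShortComplex.mk i p w).ShortExact
  proj : Projective P0

namespace Pres

variable {Y Y' Y'' : A} (π : Pres Y) (π' : Pres Y') (π'' : Pres Y'')

theorem desc {Z : A} (d : π.P0 ⟶ Z) (h : π.i ≫ d = 0) : ∃ r : Y ⟶ Z, π.p ≫ r = d :=
  shortExact_desc π.shortExact d h

theorem lift {Z : A} (d : Z ⟶ π.P0) (h : d ≫ π.p = 0) : ∃ r : Z ⟶ π.P1, r ≫ π.i = d :=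
  shortExact_lift π.shortExact d h

/-- The middle term of the short exact sequence obtained by pushing out along a morphism. -/
noncomputable def pushObj {T : A} (c : π.P1 ⟶ T) : A := Limits.pushout π.i c

/-- The canonical morphism to the pushout. -/
noncomputable def pushInl {T : A} (c : π.P1 ⟶ T) : π.P0 ⟶ π.pushObj c :=
  Limits.pushout.inl π.i c

/-- The monomorphism of the pushed out sequence. -/
noncomputable def pushF {T : A} (c : π.P1 ⟶ T) : T ⟶ π.pushObj c :=
  Limits.pushout.inr π.i c

/-- The epimorphism of the pushed out sequence. -/
noncomputable def pushG {T : A} (c : π.P1 ⟶ T) : π.pushObj c ⟶ Y :=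
  Limits.pushout.desc π.p (0 : T ⟶ Y) (by rw [π.w, Limits.comp_zero])

theorem push_zero {T : A} (c : π.P1 ⟶ T) : π.pushF c ≫ π.pushG c = 0 :=
  Limits.pushout.inr_desc _ _ _

theorem pushInl_g {T : A} (c : π.P1 ⟶ T) : π.pushInl c ≫ π.pushG c = π.p :=
  Limits.pushout.inl_desc _ _ _

theorem i_pushInl {T : A} (c : π.P1 ⟶ T) : π.i ≫ π.pushInl c = c ≫ (π.pushF c) :=
  Limits.pushout.condition

theorem push_desc {T Z : A} (c : π.P1 ⟶ T) (a : π.P0 ⟶ Z) (b : T ⟶ Z) (h : π.i ≫ a = c ≫ b) :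
    ∃ d : π.pushObj c ⟶ Z, π.pushInl c ≫ d = a ∧ (π.pushF c) ≫ d = b :=
  ⟨Limits.pushout.desc a b h, Limits.pushout.inl_desc _ _ _, Limits.pushout.inr_desc _ _ _⟩

theorem push_shortExact {T : A} (c : π.P1 ⟶ T) : (ShortComplex.mk (π.pushF c) (π.pushG c) (π.push_zero c)).ShortExact := by
  have h1 : Mono π.i := π.shortExact.mono_f
  have h2 : Epi π.p := π.shortExact.epi_g
  have hp := π.pushInl_g c
  have he : Epi (π.pushG c) := by
    have : Epi (π.pushInl c ≫ (π.pushG c)) := by rw [hp]; exact h2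
    exact epi_of_epi (π.pushInl c) _
  have hm : Mono (π.pushF c) := inferInstanceAs (Mono (Limits.pushout.inr π.i c))
  refine shortExact_of_desc (π.push_zero c) fun W d hd => ?_
  obtain ⟨r, hr⟩ := π.desc (π.pushInl c ≫ d) (by
    rw [← Category.assoc, π.i_pushInl, Category.assoc, hd, Limits.comp_zero])
  refine ⟨r, Limits.pushout.hom_ext ?_ ?_⟩
  · change π.pushInl c ≫ _ ≫ r = π.pushInl c ≫ d
    rw [← Category.assoc, hp, hr]
  · change (π.pushF c) ≫ (π.pushG c) ≫ r = (π.pushF c) ≫ d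
    rw [← Category.assoc, π.push_zero c, hd, Limits.zero_comp]

/-- The pushed out sequence splits if and only if the morphism extends. -/
theorem push_split {T : A} (c : π.P1 ⟶ T) :
    IsSplitEpi (π.pushG c) ↔ ∃ s : π.P0 ⟶ T, π.i ≫ s = c := by
  have := (π.push_shortExact c).mono_f
  constructor
  · intro h
    obtain ⟨s, hs⟩ := shortExact_lift (π.push_shortExact c)
      (π.pushInl c - π.p ≫ section_ (π.pushG c)) (by
        rw [Preadditive.sub_comp, Category.assoc, IsSplitEpi.id, pushInl_g]; simp)
    refine ⟨s, ?_⟩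
    rw [← cancel_mono (π.pushF c), Category.assoc, hs, Preadditive.comp_sub, i_pushInl,
      ← Category.assoc, π.w]
    simp
  · rintro ⟨s, hs⟩
    obtain ⟨r, hr⟩ := π.desc (π.pushInl c - s ≫ (π.pushF c)) (by
      rw [Preadditive.comp_sub, i_pushInl, ← Category.assoc, hs, sub_self])
    refine IsSplitEpi.mk' ⟨r, ?_⟩
    have : Epi π.p := π.shortExact.epi_g
    rw [← cancel_epi π.p, ← Category.assoc, hr, Preadditive.sub_comp, pushInl_g, Category.assoc,
      (π.push_zero c)]
    simp

theorem exists_lifts (u : Y ⟶ Y') : ∃ (u0 : π.P0 ⟶ π'.P0) (u1 : π.P1 ⟶ π'.P1),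
    u0 ≫ π'.p = π.p ≫ u ∧ u1 ≫ π'.i = π.i ≫ u0 := by
  have := π.proj
  have : Epi π'.p := π'.shortExact.epi_g
  let u0 := Projective.factorThru (π.p ≫ u) π'.p
  have hu0 : u0 ≫ π'.p = π.p ≫ u := Projective.factorThru_comp _ _
  obtain ⟨u1, hu1⟩ := π'.lift (π.i ≫ u0) (by
    rw [Category.assoc, hu0, ← Category.assoc, π.w, Limits.zero_comp])
  exact ⟨u0, u1, hu0, hu1⟩

end Pres

/-! ### The Auslander-Reiten formula as a linear form -/

section Form

variable (k : Type w) [Field k] [Linear k A]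

variable {k} in
/-- A linear form on `Hom(P1, T)` which induces, for all `Z`, a duality of `Ext¹(Y, Z)` and
`Hom(Z, T)`: the functionals on `Ext¹(Y, Z)` are represented by the morphisms `Z ⟶ T`. -/
structure IsARForm {T Y : A} (π : Pres Y) (ρ : (π.P1 ⟶ T) →ₗ[k] k) : Prop where
  comp_eq_zero : ∀ d : π.P0 ⟶ T, ρ (π.i ≫ d) = 0
  exists_repr : ∀ (Z : A) (l : (π.P1 ⟶ Z) →ₗ[k] k), (∀ d : π.P0 ⟶ Z, l (π.i ≫ d) = 0) →
    ∃ φ : Z ⟶ T, ∀ c, l c = ρ (c ≫ φ)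
  eq_zero : ∀ (Z : A) (φ : Z ⟶ T), (∀ c, ρ (c ≫ φ) = 0) → φ = 0

variable {k} {T Y T' Y' T'' Y'' : A} {π : Pres Y} {π' : Pres Y'} {π'' : Pres Y''}
  {ρ : (π.P1 ⟶ T) →ₗ[k] k} {ρ' : (π'.P1 ⟶ T') →ₗ[k] k} {ρ'' : (π''.P1 ⟶ T'') →ₗ[k] k}

namespace IsARForm

/-- If `c` is a non-zero class in `Ext¹(Y, Z)`, some functional vanishing on the trivial classes
does not vanish on `c`; it is represented by a morphism `φ`. -/
theorem extends_of_forall (h : IsARForm π ρ) {Z : A} (c : π.P1 ⟶ Z)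
    (hc : ∀ φ : Z ⟶ T, ρ (c ≫ φ) = 0) : ∃ s : π.P0 ⟶ Z, π.i ≫ s = c := by
  by_contra hne
  let W : Submodule k (π.P1 ⟶ Z) := LinearMap.range (Linear.leftComp k Z π.i)
  have hW : c ∉ W := fun ⟨s, hs⟩ => hne ⟨s, hs⟩
  obtain ⟨l, hl, hker⟩ := Submodule.exists_le_ker_of_notMem hW
  obtain ⟨φ, hφ⟩ := h.exists_repr Z l fun d => hker ⟨d, rfl⟩
  exact hl ((hφ c).trans (hc φ))

/-- If the induced map from `Hom(P₁, Z)` to the dual of `Hom(Z, T)` were not onto, some non-zero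
element of the double dual, that is, of `Hom(Z, T)`, would be orthogonal to all `c`. -/
theorem exists_of_dual (h : IsARForm π ρ) {Z : A} [Module.Finite k (Z ⟶ T)]
    (l : (Z ⟶ T) →ₗ[k] k) : ∃ c : π.P1 ⟶ Z, ∀ φ, l φ = ρ (c ≫ φ) := by
  let B : (π.P1 ⟶ Z) →ₗ[k] Module.Dual k (Z ⟶ T) :=
    LinearMap.mk₂ k (fun c φ => ρ (c ≫ φ)) (by intros; simp) (by intros; simp) (by intros; simp)
      (by intros; simp)
  have hB : LinearMap.range B = ⊤ := by
    by_contra hne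
    obtain ⟨l, hl⟩ : ∃ l, l ∉ LinearMap.range B := by
      by_contra hc
      push Not at hc
      exact hne (eq_top_iff.2 fun x _ => hc x)
    obtain ⟨m, hm, hker⟩ := Submodule.exists_le_ker_of_notMem hl
    obtain ⟨φ, rfl⟩ := (Module.evalEquiv k (Z ⟶ T)).surjective m
    have : φ = 0 := h.eq_zero Z φ fun c => hker ⟨c, rfl⟩
    exact hm (by rw [this, map_zero, LinearMap.zero_apply])
  obtain ⟨c, hc⟩ := LinearMap.range_eq_top.1 hB l
  exact ⟨c, fun φ => by rw [← hc]; rfl⟩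

/-- The almost split sequence starting in `T`. -/
theorem exists_almostSplit (h : IsARForm π ρ) (hT : IsLoc T) (hY : IsLoc Y)
    [Module.Finite k (T ⟶ T)] : ∃ c : π.P1 ⟶ T, IsAlmostSplitSeq (π.pushF c) (π.pushG c) := by
  -- The extension is chosen in the socle of `Ext¹(Y, T)`: it corresponds to a functional on `End T`
  -- which kills the radical but not the identity. Pushing it out along a non-section gives the zero
  -- class, while the extension itself does not split.
  have h1 : 𝟙 T ∉ radK k T T := fun h => InRad.not_isSplitMono hT.1 h inferInstance
  obtain ⟨l, hl, hker⟩ := Submodule.exists_le_ker_of_notMem h1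
  obtain ⟨c, hc⟩ := h.exists_of_dual l
  refine ⟨c, isAlmostSplitSeq_of_shortExact (π.push_shortExact c) hT hY ⟨?_, ?_⟩⟩
  · intro hs
    apply hl
    have : c = π.i ≫ π.pushInl c ≫ retraction (π.pushF c) := by
      rw [← Category.assoc, π.i_pushInl, Category.assoc, IsSplitMono.id, Category.comp_id]
    rw [hc, Category.comp_id, this, h.comp_eq_zero]
  · intro Z g hg
    obtain ⟨s, hs⟩ := h.extends_of_forall (c ≫ g) fun φ => by
      rw [Category.assoc, ← hc]
      exact hker ((hT.inRad_of_not_isSplitMono hg).comp_right φ)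
    obtain ⟨d, -, hd⟩ := π.push_desc c s g hs
    exact ⟨d, hd⟩

end IsARForm

/-- `φ : T ⟶ T'` and `u : Y ⟶ Y'` correspond to each other under the dualities. -/
def ARRel (ρ : (π.P1 ⟶ T) →ₗ[k] k) (ρ' : (π'.P1 ⟶ T') →ₗ[k] k) (φ : T ⟶ T') (u : Y ⟶ Y') : Prop :=
  ∃ (u0 : π.P0 ⟶ π'.P0) (u1 : π.P1 ⟶ π'.P1), u0 ≫ π'.p = π.p ≫ u ∧ u1 ≫ π'.i = π.i ≫ u0 ∧
    ∀ c : π'.P1 ⟶ T, ρ (u1 ≫ c) = ρ' (c ≫ φ)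

namespace ARRel

theorem id (ρ : (π.P1 ⟶ T) →ₗ[k] k) : ARRel ρ ρ (𝟙 T) (𝟙 Y) :=
  ⟨𝟙 _, 𝟙 _, by simp, by simp, by simp⟩

theorem comp {φ : T ⟶ T'} {φ' : T' ⟶ T''} {u : Y ⟶ Y'} {u' : Y' ⟶ Y''} (h : ARRel ρ ρ' φ u)
    (h' : ARRel ρ' ρ'' φ' u') : ARRel ρ ρ'' (φ ≫ φ') (u ≫ u') := by
  obtain ⟨u0, u1, h0, h1, h2⟩ := h
  obtain ⟨v0, v1, k0, k1, k2⟩ := h'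
  refine ⟨u0 ≫ v0, u1 ≫ v1, ?_, ?_, fun c => ?_⟩
  · rw [Category.assoc, k0, ← Category.assoc, h0, Category.assoc]
  · rw [Category.assoc, k1, ← Category.assoc, h1, Category.assoc]
  · rw [Category.assoc, h2, Category.assoc, k2, Category.assoc]

theorem sub {φ φ' : T ⟶ T'} {u u' : Y ⟶ Y'} (h : ARRel ρ ρ' φ u)
    (h' : ARRel ρ ρ' φ' u') : ARRel ρ ρ' (φ - φ') (u - u') := by
  obtain ⟨u0, u1, h0, h1, h2⟩ := h
  obtain ⟨v0, v1, k0, k1, k2⟩ := h'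
  exact ⟨u0 - v0, u1 - v1, by simp [h0, k0], by simp [h1, k1], fun c => by simp [h2, k2]⟩

theorem smul {φ : T ⟶ T'} {u : Y ⟶ Y'} (a : k) (h : ARRel ρ ρ' φ u) :
    ARRel ρ ρ' (a • φ) (a • u) := by
  obtain ⟨u0, u1, h0, h1, h2⟩ := h
  exact ⟨a • u0, a • u1, by simp [h0], by simp [h1], fun c => by simp [h2]⟩

theorem exists_left (hρ : IsARForm π ρ) (hρ' : IsARForm π' ρ') (u : Y ⟶ Y') :
    ∃ φ : T ⟶ T', ARRel ρ ρ' φ u := by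
  obtain ⟨u0, u1, h0, h1⟩ := π.exists_lifts π' u
  obtain ⟨φ, hφ⟩ := hρ'.exists_repr T (ρ.comp (Linear.leftComp k T u1)) fun d => by
    simp only [LinearMap.comp_apply, Linear.leftComp_apply]
    rw [← Category.assoc, h1, Category.assoc, hρ.comp_eq_zero]
  exact ⟨φ, u0, u1, h0, h1, hφ⟩

/-- The map `u1` represents the functional `c ↦ ρ' (c φ)`. Its composite with `π'.i` extends to
`π.P0` because `ρ'` vanishes on the maps through `π'.i`, and so it induces a map of cokernels. -/
theorem exists_right (hρ : IsARForm π ρ) (hρ' : IsARForm π' ρ') [Module.Finite k (π'.P1 ⟶ T)]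
    (φ : T ⟶ T') : ∃ u : Y ⟶ Y', ARRel ρ ρ' φ u := by
  obtain ⟨u1, hu1⟩ := hρ.exists_of_dual (ρ'.comp (Linear.rightComp k π'.P1 φ))
  obtain ⟨u0, hu0⟩ := hρ.extends_of_forall (u1 ≫ π'.i) fun χ => by
    rw [Category.assoc, ← hu1]
    simp [hρ'.comp_eq_zero]
  obtain ⟨u, hu⟩ := π.desc (u0 ≫ π'.p) (by
    rw [← Category.assoc, hu0, Category.assoc, π'.w, Limits.comp_zero])
  exact ⟨u, u0, u1, hu.symm, hu0.symm, fun c => (hu1 c).symm⟩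

theorem eq_zero_left (hρ : IsARForm π ρ) (hρ' : IsARForm π' ρ') {φ : T ⟶ T'}
    (h : ARRel ρ ρ' φ (0 : Y ⟶ Y')) : φ = 0 := by
  obtain ⟨u0, u1, h0, h1, h2⟩ := h
  apply hρ'.eq_zero
  intro c
  obtain ⟨s, hs⟩ := π'.lift u0 (by rw [h0, Limits.comp_zero])
  have : u1 = π.i ≫ s := by
    have := π'.shortExact.mono_f
    rw [← cancel_mono π'.i, h1, Category.assoc, hs]
  rw [← h2, this, Category.assoc, hρ.comp_eq_zero]

/-- If `φ = 0`, then `u` lifts to `π'.P0` by duality, and all morphisms from `Y` to this projective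
are zero. -/
theorem eq_zero_right (hρ : IsARForm π ρ) (hY : ∀ r : Y ⟶ π'.P0, r = 0) {u : Y ⟶ Y'}
    (h : ARRel ρ ρ' 0 u) : u = 0 := by
  obtain ⟨u0, u1, h0, h1, h2⟩ := h
  obtain ⟨s, hs⟩ := hρ.extends_of_forall u1 fun φ => by rw [h2]; simp
  obtain ⟨r, hr⟩ := π.desc (u0 - s ≫ π'.i) (by
    rw [Preadditive.comp_sub, ← h1, ← Category.assoc, hs, sub_self])
  rw [hY r, Limits.comp_zero] at hr
  have : Epi π.p := π.shortExact.epi_g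
  rw [← cancel_epi π.p, ← h0, sub_eq_zero.1 hr.symm, Category.assoc, π'.w]
  simp

theorem unique_left (hρ : IsARForm π ρ) (hρ' : IsARForm π' ρ') {φ φ' : T ⟶ T'} {u : Y ⟶ Y'}
    (h : ARRel ρ ρ' φ u) (h' : ARRel ρ ρ' φ' u) : φ = φ' := by
  have := h.sub h'
  rw [sub_self] at this
  exact sub_eq_zero.1 (eq_zero_left hρ hρ' this)

theorem unique_right (hρ : IsARForm π ρ) (hY : ∀ r : Y ⟶ π'.P0, r = 0) {φ : T ⟶ T'}
    {u u' : Y ⟶ Y'} (h : ARRel ρ ρ' φ u) (h' : ARRel ρ ρ' φ u') : u = u' := by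
  have := h.sub h'
  rw [sub_self] at this
  exact sub_eq_zero.1 (eq_zero_right hρ hY this)

end ARRel

namespace IsARForm

/-- The relation `ARRel` is compatible with composition and is single-valued in both directions when
`Y` has no morphisms to its projective; so it carries isomorphisms to isomorphisms. -/
theorem nonempty_iso_right (hρ : IsARForm π ρ) (hρ' : IsARForm π' ρ')
    [Module.Finite k (π'.P1 ⟶ T)] [Module.Finite k (π.P1 ⟶ T')]
    (hY : ∀ r : Y ⟶ π.P0, r = 0) (hY' : ∀ r : Y' ⟶ π'.P0, r = 0) (e : T ≅ T') :
    Nonempty (Y ≅ Y') := by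
  obtain ⟨φ, hφ⟩ := ARRel.exists_right hρ hρ' e.hom
  obtain ⟨ψ, hψ⟩ := ARRel.exists_right hρ' hρ e.inv
  have h1 := hφ.comp hψ
  have h2 := hψ.comp hφ
  rw [e.hom_inv_id] at h1
  rw [e.inv_hom_id] at h2
  exact ⟨⟨φ, ψ, ARRel.unique_right hρ hY h1 (ARRel.id ρ), ARRel.unique_right hρ' hY' h2 (ARRel.id ρ')⟩⟩

theorem isZero_left_iff (hρ : IsARForm π ρ) (hY : ∀ r : Y ⟶ π.P0, r = 0) :
    Limits.IsZero T ↔ Limits.IsZero Y := by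
  rw [Limits.IsZero.iff_id_eq_zero, Limits.IsZero.iff_id_eq_zero]
  constructor
  · intro h
    have := ARRel.id (Y := Y) ρ
    rw [h] at this
    exact ARRel.eq_zero_right hρ hY this
  · intro h
    have := ARRel.id (Y := Y) ρ
    rw [h] at this
    exact ARRel.eq_zero_left hρ hρ this

theorem isLoc_left (hρ : IsARForm π ρ) [Module.Finite k (π.P1 ⟶ T)]
    (hY : ∀ r : Y ⟶ π.P0, r = 0) (h : IsLoc Y) : IsLoc T := by
  refine ⟨fun h0 => h.1 ((hρ.isZero_left_iff hY).1 h0), fun φ => ?_⟩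
  have key : ∀ (φ : T ⟶ T) (u : Y ⟶ Y), ARRel ρ ρ φ u → IsIso u → IsIso φ := by
    intro φ u hφ hu
    obtain ⟨ψ, hψ⟩ := ARRel.exists_left hρ hρ (inv u)
    have h1 := hφ.comp hψ
    have h2 := hψ.comp hφ
    rw [IsIso.hom_inv_id] at h1
    rw [IsIso.inv_hom_id] at h2
    exact ⟨ψ, ARRel.unique_left hρ hρ h1 (ARRel.id ρ), ARRel.unique_left hρ hρ h2 (ARRel.id ρ)⟩
  obtain ⟨u, hu⟩ := ARRel.exists_right hρ hρ φ
  rcases h.2 u with h1 | h1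
  · exact Or.inl (key φ u hu h1)
  · exact Or.inr (key _ _ ((ARRel.id ρ).sub hu) h1)

theorem isBrick_right (hρ : IsARForm π ρ) (hY : ∀ r : Y ⟶ π.P0, r = 0) (h : IsBrick k T) :
    IsBrick k Y := by
  refine ⟨fun h0 => h.1 ((hρ.isZero_left_iff hY).2 h0), fun u => ?_⟩
  obtain ⟨φ, hφ⟩ := ARRel.exists_left hρ hρ u
  obtain ⟨c, rfl⟩ := h.2 φ
  exact ⟨c, ARRel.unique_right hρ hY hφ ((ARRel.id ρ).smul c)⟩

end IsARForm

end Form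

end AlmostSplit

/-! ### Representations vertex by vertex, and free representations -/

section RepBasics

variable {k : Type w} [Field k] {Q : Type u} [Quiver.{v} Q]

/-- The space of a representation at a vertex. -/
def sp (M : Rep.{u, v, w} k Q) (x : Q) : Type (max u v w) := M.obj (show Paths Q from x)

noncomputable instance (M : Rep.{u, v, w} k Q) (x : Q) : AddCommGroup (sp M x) :=
  inferInstanceAs (AddCommGroup (M.obj (show Paths Q from x)))

noncomputable instance (M : Rep.{u, v, w} k Q) (x : Q) : Module k (sp M x) :=
  inferInstanceAs (Module k (M.obj (show Paths Q from x)))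

/-- The linear map given by a path. -/
def pm (M : Rep.{u, v, w} k Q) {x y : Q} (p : Quiver.Path x y) : sp M x →ₗ[k] sp M y :=
  (M.map (X := x) (Y := y) p).hom

/-- The linear map given by an arrow. -/
def ar (M : Rep.{u, v, w} k Q) {x y : Q} (α : x ⟶ y) : sp M x →ₗ[k] sp M y :=
  pm M α.toPath

/-- The linear map at a vertex given by a morphism of representations. -/
def ev {M N : Rep.{u, v, w} k Q} (f : M ⟶ N) (x : Q) : sp M x →ₗ[k] sp N x :=
  (f.app (show Paths Q from x)).hom

variable {M N L : Rep.{u, v, w} k Q}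

@[simp]
theorem pm_nil {x : Q} (v : sp M x) : pm M Quiver.Path.nil v = v :=
  congrArg (fun t => t.hom v) (M.map_id (show Paths Q from x))

theorem pm_comp {x y z : Q} (p : Quiver.Path x y) (q : Quiver.Path y z) (v : sp M x) :
    pm M (p.comp q) v = pm M q (pm M p v) :=
  congrArg (fun t => t.hom v) (M.map_comp (X := show Paths Q from x) (Y := show Paths Q from y)
    (Z := show Paths Q from z) p q)

@[simp]
theorem pm_cons {x y z : Q} (p : Quiver.Path x y) (α : y ⟶ z) (v : sp M x) :
    pm M (p.cons α) v = ar M α (pm M p v) :=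
  pm_comp p α.toPath v

@[simp]
theorem ev_pm (f : M ⟶ N) {x y : Q} (p : Quiver.Path x y) (v : sp M x) :
    ev f y (pm M p v) = pm N p (ev f x v) :=
  congrArg (fun t => t.hom v) (f.naturality (X := x) (Y := y) p)

@[simp]
theorem ev_ar (f : M ⟶ N) {x y : Q} (α : x ⟶ y) (v : sp M x) :
    ev f y (ar M α v) = ar N α (ev f x v) := ev_pm f _ v

@[simp]
theorem ev_id (x : Q) (v : sp M x) : ev (𝟙 M) x v = v := rfl

@[simp]
theorem ev_comp (f : M ⟶ N) (g : N ⟶ L) (x : Q) (v : sp M x) :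
    ev (f ≫ g) x v = ev g x (ev f x v) := rfl

@[simp]
theorem ev_zero (x : Q) (v : sp M x) : ev (0 : M ⟶ N) x v = 0 := rfl

@[simp]
theorem ev_add (f g : M ⟶ N) (x : Q) (v : sp M x) : ev (f + g) x v = ev f x v + ev g x v := rfl

@[simp]
theorem ev_sub (f g : M ⟶ N) (x : Q) (v : sp M x) : ev (f - g) x v = ev f x v - ev g x v := rfl

@[simp]
theorem ev_smul (c : k) (f : M ⟶ N) (x : Q) (v : sp M x) : ev (c • f) x v = c • ev f x v := rfl

theorem rep_hom_ext {f g : M ⟶ N} (h : ∀ x v, ev f x v = ev g x v) : f = g := by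
  ext x v
  exact h x v

/-- A representation given by spaces and linear maps. -/
noncomputable def mkRep (V : Q → Type (max u v w)) [∀ x, AddCommGroup (V x)] [∀ x, Module k (V x)]
    (a : ∀ {x y : Q}, (x ⟶ y) → (V x →ₗ[k] V y)) : Rep.{u, v, w} k Q :=
  Paths.lift { obj := fun x => ModuleCat.of k (V x), map := fun α => ModuleCat.ofHom (a α) }

/-- The spaces of `mkRep`. -/
noncomputable def mkRepEquiv (V : Q → Type (max u v w)) [∀ x, AddCommGroup (V x)]
    [∀ x, Module k (V x)] (a : ∀ {x y : Q}, (x ⟶ y) → (V x →ₗ[k] V y)) (x : Q) :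
    sp (mkRep V a) x ≃ₗ[k] V x :=
  { toFun := fun v => v, invFun := fun v => v, map_add' := fun _ _ => rfl,
    map_smul' := fun _ _ => rfl, left_inv := fun _ => rfl, right_inv := fun _ => rfl }

theorem mkRepEquiv_ar (V : Q → Type (max u v w)) [∀ x, AddCommGroup (V x)] [∀ x, Module k (V x)]
    (a : ∀ {x y : Q}, (x ⟶ y) → (V x →ₗ[k] V y)) {x y : Q} (α : x ⟶ y) (v : sp (mkRep V a) x) :
    mkRepEquiv V a y (ar (mkRep V a) α v) = a α (mkRepEquiv V a x v) := by
  have := Paths.lift_toPath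
    ({ obj := fun x => ModuleCat.of k (V x), map := fun α => ModuleCat.ofHom (a α) } :
      Q ⥤q ModuleCat.{max u v w} k) α
  exact congrArg (fun t => t.hom v) this

theorem naturality_pm (f : ∀ x : Q, sp M x →ₗ[k] sp N x)
    (h : ∀ {x y : Q} (α : x ⟶ y) (v : sp M x), f y (ar M α v) = ar N α (f x v)) {x y : Q}
    (p : Quiver.Path x y) (v : sp M x) : f y (pm M p v) = pm N p (f x v) := by
  induction p with
  | nil => rw [pm_nil, pm_nil]
  | cons p α ih => rw [pm_cons, pm_cons, h, ih]

/-- A morphism of representations given by linear maps. -/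
def mkHom (f : ∀ x : Q, sp M x →ₗ[k] sp N x)
    (h : ∀ {x y : Q} (α : x ⟶ y) (v : sp M x), f y (ar M α v) = ar N α (f x v)) : M ⟶ N where
  app x := ModuleCat.ofHom (f x)
  naturality _ _ p := ModuleCat.hom_ext (LinearMap.ext fun v => naturality_pm f h p v)

@[simp]
theorem ev_mkHom (f : ∀ x : Q, sp M x →ₗ[k] sp N x)
    (h : ∀ {x y : Q} (α : x ⟶ y) (v : sp M x), f y (ar M α v) = ar N α (f x v)) (x : Q)
    (v : sp M x) : ev (mkHom f h) x v = f x v := rfl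

theorem mono_iff_ev (f : M ⟶ N) : Mono f ↔ ∀ x, Function.Injective (ev f x) := by
  rw [NatTrans.mono_iff_mono_app]
  exact forall_congr' fun x => ModuleCat.mono_iff_injective _

theorem epi_iff_ev (f : M ⟶ N) : Epi f ↔ ∀ x, Function.Surjective (ev f x) := by
  rw [NatTrans.epi_iff_epi_app]
  exact forall_congr' fun x => ModuleCat.epi_iff_surjective _

theorem isIso_iff_ev (f : M ⟶ N) : IsIso f ↔ ∀ x, Function.Bijective (ev f x) := by
  rw [NatTrans.isIso_iff_isIso_app]
  exact forall_congr' fun x => ConcreteCategory.isIso_iff_bijective _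

theorem isZero_iff_sp : Limits.IsZero M ↔ ∀ x, Subsingleton (sp M x) := by
  rw [Functor.isZero_iff]
  exact forall_congr' fun x => ModuleCat.isZero_iff_subsingleton

section ShortExact

variable {S : ShortComplex (Rep.{u, v, w} k Q)}

theorem shortExact_injective (hS : S.ShortExact) (x : Q) : Function.Injective (ev S.f x) :=
  (mono_iff_ev S.f).1 hS.mono_f x

theorem shortExact_surjective (hS : S.ShortExact) (x : Q) : Function.Surjective (ev S.g x) :=
  (epi_iff_ev S.g).1 hS.epi_g x

end ShortExact

/-! #### Free representations -/

variable {ι : Type (max u v w)}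

/-- The direct sum of the representations `P_{b i}`. -/
noncomputable def Fr (k : Type w) [Field k] (b : ι → Q) : Rep.{u, v, w} k Q :=
  mkRep (fun x => (Σ i, Quiver.Path (b i) x) →₀ k)
    fun α => Finsupp.lmapDomain k k fun s => ⟨s.1, s.2.cons α⟩

variable {b : ι → Q}

/-- The coordinates of a free representation. -/
noncomputable def frC (b : ι → Q) (x : Q) :
    sp (Fr k b) x ≃ₗ[k] ((Σ i, Quiver.Path (b i) x) →₀ k) :=
  mkRepEquiv _ _ x

/-- The basis elements of a free representation. -/
noncomputable def frSingle (k : Type w) [Field k] (b : ι → Q) {x : Q} (i : ι)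
    (q : Quiver.Path (b i) x) : sp (Fr k b) x :=
  (frC b x).symm (Finsupp.single ⟨i, q⟩ 1)

theorem fr_induction {x : Q} {p : sp (Fr k b) x → Prop} (v : sp (Fr k b) x) (zero : p 0)
    (add : ∀ v w, p v → p w → p (v + w)) (smul : ∀ (c : k) i q, p (c • frSingle k b i q)) :
    p v := by
  obtain ⟨v, rfl⟩ := (frC b x).symm.surjective v
  induction v using Finsupp.induction_linear with
  | zero => rwa [map_zero]
  | add a c ha hc => rw [map_add]; exact add _ _ ha hc
  | single s c =>
    have := smul c s.1 s.2
    rwa [frSingle, ← map_smul, Finsupp.smul_single_one] at this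

theorem frC_ar {x y : Q} (α : x ⟶ y) (v : sp (Fr k b) x) :
    frC b y (ar (Fr k b) α v) = Finsupp.mapDomain (fun s => ⟨s.1, s.2.cons α⟩) (frC b x v) :=
  mkRepEquiv_ar _ _ α v

theorem ar_frSingle {x y : Q} (α : x ⟶ y) (i : ι) (q : Quiver.Path (b i) x) :
    ar (Fr k b) α (frSingle k b i q) = frSingle k b i (q.cons α) := by
  apply (frC b y).injective
  rw [frC_ar, frSingle, frSingle, LinearEquiv.apply_symm_apply, LinearEquiv.apply_symm_apply,
    Finsupp.mapDomain_single]

theorem pm_frSingle {x y : Q} (p : Quiver.Path x y) (i : ι) (q : Quiver.Path (b i) x) :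
    pm (Fr k b) p (frSingle k b i q) = frSingle k b i (q.comp p) := by
  induction p with
  | nil => rw [pm_nil]; rfl
  | cons p α ih => rw [pm_cons, ih, ar_frSingle]; rfl

/-- The generators of a free representation. -/
noncomputable def frGen (k : Type w) [Field k] (b : ι → Q) (i : ι) : sp (Fr k b) (b i) :=
  frSingle k b i Quiver.Path.nil

theorem pm_frGen {x : Q} (i : ι) (p : Quiver.Path (b i) x) :
    pm (Fr k b) p (frGen k b i) = frSingle k b i p := by
  rw [frGen, pm_frSingle, Quiver.Path.nil_comp]

/-- The linear maps of `frHom`. -/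
noncomputable def frLin (g : ∀ i, sp M (b i)) (x : Q) : sp (Fr k b) x →ₗ[k] sp M x :=
  (Finsupp.linearCombination k fun s : (Σ i, Quiver.Path (b i) x) => pm M s.2 (g s.1)) ∘ₗ
    (frC b x).toLinearMap

theorem frLin_frSingle (g : ∀ i, sp M (b i)) {x : Q} (i : ι) (p : Quiver.Path (b i) x) :
    frLin g x (frSingle k b i p) = pm M p (g i) := by
  rw [frLin, LinearMap.comp_apply, frSingle]
  simp only [LinearEquiv.coe_coe, LinearEquiv.apply_symm_apply, Finsupp.linearCombination_single,
    one_smul]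

/-- The morphism from a free representation given by the images of the generators. -/
noncomputable def frHom (g : ∀ i, sp M (b i)) : Fr k b ⟶ M :=
  mkHom (frLin g) fun {x y} α v => by
    induction v using fr_induction with
    | zero => simp only [map_zero]
    | add a c ha hc => simp only [map_add, ha, hc]
    | smul c i q => simp only [map_smul, ar_frSingle, frLin_frSingle, pm_cons]

@[simp]
theorem ev_frHom_frSingle (g : ∀ i, sp M (b i)) {x : Q} (i : ι) (p : Quiver.Path (b i) x) :
    ev (frHom g) x (frSingle k b i p) = pm M p (g i) :=
  frLin_frSingle g i p

@[simp]
theorem ev_frHom_gen (g : ∀ i, sp M (b i)) (i : ι) :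
    ev (frHom g) (b i) (frGen k b i) = g i := by
  rw [frGen, ev_frHom_frSingle, pm_nil]

theorem frHom_ext {f g : Fr k b ⟶ M} (h : ∀ i, ev f _ (frGen k b i) = ev g _ (frGen k b i)) :
    f = g := by
  refine rep_hom_ext fun x v => ?_
  induction v using fr_induction with
  | zero => simp only [map_zero]
  | add a c ha hc => simp only [map_add, ha, hc]
  | smul c i q => rw [map_smul, map_smul, ← pm_frGen, ev_pm, ev_pm, h]

/-- Morphisms from a free representation. -/
noncomputable def frEquiv (b : ι → Q) (M : Rep.{u, v, w} k Q) :
    (Fr k b ⟶ M) ≃ₗ[k] (∀ i, sp M (b i)) where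
  toFun f := fun i => ev f (b i) (frGen k b i)
  invFun g := frHom g
  map_add' _ _ := rfl
  map_smul' _ _ := rfl
  left_inv _ := frHom_ext fun i => ev_frHom_gen _ i
  right_inv g := funext fun i => ev_frHom_gen g i

instance projective_Fr : Projective (Fr k b) where
  factors {E X} f e he := by
    have hs := (epi_iff_ev e).1 he
    refine ⟨frHom fun i => (hs _ (ev f (b i) (frGen k b i))).choose, frHom_ext fun i => ?_⟩
    rw [ev_comp, ev_frHom_gen]
    exact (hs _ (ev f (b i) (frGen k b i))).choose_spec

instance moduleFinite_Fr_hom [Finite ι] [∀ x, Module.Finite k (sp M x)] :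
    Module.Finite k (Fr k b ⟶ M) :=
  Module.Finite.equiv (frEquiv b M).symm

theorem moduleFinite_hom_of_epi (p : L ⟶ N) [Epi p] [Module.Finite k (L ⟶ M)] :
    Module.Finite k (N ⟶ M) :=
  Module.Finite.of_injective (Linear.leftComp k M p) fun a b h => by
    rwa [Linear.leftComp_apply, Linear.leftComp_apply, cancel_epi] at h

/-- An element at the vertex `x` is a morphism from the free representation on one generator at `x`;
the kernel property is applied to this morphism. -/
theorem shortExact_exact {S : ShortComplex (Rep.{u, v, w} k Q)} (hS : S.ShortExact) (x : Q)
    (v : sp S.X₂ x) : ev S.g x v = 0 ↔ ∃ u, ev S.f x u = v := by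
  constructor
  · intro h
    obtain ⟨r, hr⟩ := shortExact_lift hS (frHom (b := fun _ : PUnit.{max u v w + 1} => x)
      fun _ => v) (frHom_ext fun i => by rw [ev_comp, ev_frHom_gen, h, ev_zero])
    exact ⟨ev r x (frGen k _ PUnit.unit), by rw [← ev_comp, hr, ev_frHom_gen]⟩
  · rintro ⟨u, rfl⟩
    rw [← ev_comp, S.zero, ev_zero]

/-- The coordinates of `P_a`. -/
noncomputable def pC (a x : Q) : sp (P.{u, v, w} k a) x ≃ₗ[k] (Quiver.Path a x →₀ k) :=
  { toFun := fun v => v, invFun := fun v => v, map_add' := fun _ _ => rfl,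
    map_smul' := fun _ _ => rfl, left_inv := fun _ => rfl, right_inv := fun _ => rfl }

theorem pC_pm (a : Q) {x y : Q} (p : Quiver.Path x y) (v : sp (P.{u, v, w} k a) x) :
    pC a y (pm (P k a) p v) = Finsupp.mapDomain (fun q => q.comp p) (pC a x v) := rfl

/-- `P_a` is free on one generator. -/
theorem nonempty_iso_Fr (a : Q) :
    Nonempty (P.{u, v, w} k a ≅ Fr k (fun _ : PUnit.{max u v w + 1} => a)) := by
  obtain ⟨f, hf⟩ : ∃ f : Fr k (fun _ : PUnit.{max u v w + 1} => a) ⟶ P.{u, v, w} k a,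
      f = frHom fun _ => (pC a a).symm (Finsupp.single Quiver.Path.nil 1) := ⟨_, rfl⟩
  have hf : IsIso f := by
    rw [isIso_iff_ev]
    intro x
    obtain ⟨e, he⟩ : ∃ e : sp (Fr k (fun _ : PUnit.{max u v w + 1} => a)) x ≃ₗ[k]
        sp (P.{u, v, w} k a) x, e = (frC _ x).trans ((Finsupp.domLCongr (R := k) (M := k)
        ((Equiv.uniqueSigma (fun _ : PUnit.{max u v w + 1} => Quiver.Path a x)))).trans
        (pC a x).symm) := ⟨_, rfl⟩
    have : ev f x = e.toLinearMap := by
      ext v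
      induction v using fr_induction with
      | zero => simp only [map_zero]
      | add a c ha hc => simp only [map_add, ha, hc]
      | smul c i q =>
        rw [map_smul, map_smul]
        refine congrArg (c • ·) ?_
        rw [hf, ev_frHom_frSingle]
        apply (pC a x).injective
        rw [pC_pm, LinearEquiv.apply_symm_apply, Finsupp.mapDomain_single,
          Quiver.Path.nil_comp, LinearEquiv.coe_coe, he, LinearEquiv.trans_apply,
          LinearEquiv.trans_apply, LinearEquiv.apply_symm_apply, frSingle,
          LinearEquiv.apply_symm_apply, Finsupp.domLCongr_single]
        rfl
    rw [this]
    exact e.bijective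
  exact ⟨(asIso f).symm⟩

end RepBasics

/-- Strongly locally finite quivers, as a class. -/
class SLF (Q : Type u) [Quiver.{v} Q] : Prop where
  out : StronglyLocallyFinite Q

/-! ### Strongly locally finite quivers: no oriented cycles, and induction along arrows -/

section Quiver

variable {Q : Type u} [Quiver.{v} Q] [hQ : SLF Q]

instance finite_out (x : Q) : Finite (Σ y : Q, (x ⟶ y)) := hQ.out.finite_out x

instance finite_in (x : Q) : Finite (Σ y : Q, (y ⟶ x)) := hQ.out.finite_in x

instance finite_path (x y : Q) : Finite (Quiver.Path x y) := hQ.out.interval_finite x y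

noncomputable instance fintype_in (x : Q) : Fintype (Σ y : Q, (y ⟶ x)) := Fintype.ofFinite _

instance finite_hom (x y : Q) : Finite (x ⟶ y) :=
  Finite.of_injective (fun α : x ⟶ y => (⟨y, α⟩ : Σ z : Q, (x ⟶ z))) fun a b h => by
    simpa using h

/-- The powers of a closed path of positive length would be infinitely many paths from `x` to `x`.
-/
theorem path_length_eq_zero {x : Q} (p : Quiver.Path x x) : p.length = 0 := by
  by_contra h
  let f : ℕ → Quiver.Path x x := fun n => Nat.rec Quiver.Path.nil (fun _ q => q.comp p) n
  have hf : ∀ n, (f n).length = n * p.length := by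
    intro n
    induction n with
    | zero => simp [f]
    | succ n ih =>
      change ((f n).comp p).length = _
      rw [Quiver.Path.length_comp, ih]; ring
  refine not_injective_infinite_finite f fun a b hab => ?_
  have := congrArg Quiver.Path.length hab
  rw [hf, hf] at this
  exact Nat.eq_of_mul_eq_mul_right (Nat.pos_of_ne_zero h) this

theorem path_eq_nil {x : Q} (p : Quiver.Path x x) : p = Quiver.Path.nil :=
  Quiver.Path.eq_nil_of_length_zero p (path_length_eq_zero p)

theorem isEmpty_hom_of_path {x y : Q} (p : Quiver.Path x y) : IsEmpty (y ⟶ x) :=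
  ⟨fun α => by simpa using path_length_eq_zero (p.cons α)⟩

/-- The vertices which can be reached from a set. -/
def Succ (s : Set Q) : Set Q := {x | ∃ a ∈ s, Nonempty (Quiver.Path a x)}

theorem subset_Succ (s : Set Q) : s ⊆ Succ s := fun a ha => ⟨a, ha, ⟨Quiver.Path.nil⟩⟩

theorem Succ.path {s : Set Q} {x y : Q} (hx : x ∈ Succ s) (p : Quiver.Path x y) : y ∈ Succ s := by
  obtain ⟨a, ha, ⟨q⟩⟩ := hx
  exact ⟨a, ha, ⟨q.comp p⟩⟩

theorem Succ.arrow {s : Set Q} {x y : Q} (hx : x ∈ Succ s) (α : x ⟶ y) : y ∈ Succ s :=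
  Succ.path hx α.toPath

/-- The induction is on the maximal length of a path from `s` to `z`, which is finite because `s` is
finite and `Q` is interval-finite. Membership in `Succ s` is needed because the supremum of the
empty set is `0`, so that nothing decreases from `z` to a vertex not reached from `s`. -/
theorem succ_induction {s : Set Q} (hs : s.Finite) {p : Q → Prop}
    (h : ∀ z, (∀ y, (y ⟶ z) → y ∈ Succ s → p y) → p z) (z : Q) : p z := by
  let L : Q → Set ℕ := fun z => {n | ∃ a ∈ s, ∃ q : Quiver.Path a z, q.length = n}
  have hL : ∀ z, BddAbove (L z) := by
    intro z
    have : Finite s := hs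
    refine (Set.Finite.subset (Set.finite_range
      (fun t : Σ a : s, Quiver.Path a.1 z => t.2.length)) ?_).bddAbove
    rintro n ⟨a, ha, q, rfl⟩
    exact ⟨⟨⟨a, ha⟩, q⟩, rfl⟩
  suffices H : ∀ n z, sSup (L z) = n → p z from H _ z rfl
  intro n
  induction n using Nat.strong_induction_on with
  | _ n ih =>
    intro z hz
    refine h z fun y α hy => ih (sSup (L y)) ?_ y rfl
    have hne : (L y).Nonempty := by
      obtain ⟨a, ha, ⟨q⟩⟩ := hy
      exact ⟨_, a, ha, q, rfl⟩
    obtain ⟨a, ha, q, hq⟩ := Nat.sSup_mem hne (hL y)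
    rw [← hq, ← hz]
    exact Nat.lt_of_succ_le (le_csSup (hL z) ⟨a, ha, q.cons α, rfl⟩)

end Quiver

/-! ### An intrinsic description of finite presentation -/

section FP

variable {k : Type w} [Field k] {Q : Type u} [Quiver.{v} Q] [hQ : SLF Q]

/-- The joint map of all arrows which end in `z`. -/
noncomputable def jm (M : Rep.{u, v, w} k Q) (z : Q) :
    (∀ α : Σ y : Q, (y ⟶ z), sp M α.1) →ₗ[k] sp M z :=
  ∑ α, ar M α.2 ∘ₗ LinearMap.proj α

theorem jm_apply (M : Rep.{u, v, w} k Q) (z : Q) (v : ∀ α : Σ y : Q, (y ⟶ z), sp M α.1) :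
    jm M z v = ∑ α, ar M α.2 (v α) := by
  simp [jm, LinearMap.sum_apply]

open Classical in
theorem jm_single (M : Rep.{u, v, w} k Q) (z : Q) (α : Σ y : Q, (y ⟶ z)) (v : sp M α.1) :
    jm M z (Pi.single α v) = ar M α.2 v := by
  rw [jm_apply, Finset.sum_eq_single α]
  · rw [Pi.single_eq_same]
  · intro β _ hβ
    rw [Pi.single_eq_of_ne hβ, map_zero]
  · simp

theorem ev_jm {M N : Rep.{u, v, w} k Q} (f : M ⟶ N) (z : Q)
    (v : ∀ α : Σ y : Q, (y ⟶ z), sp M α.1) :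
    ev f z (jm M z v) = jm N z fun α => ev f α.1 (v α) := by
  simp [jm_apply, map_sum]

/-- An intrinsic form of being finitely presented. -/
structure IsFP (M : Rep.{u, v, w} k Q) : Prop where
  fin : ∀ x, Module.Finite k (sp M x)
  supp : ∃ s : Set Q, s.Finite ∧ ∀ x, Nontrivial (sp M x) → x ∈ Succ s
  bij : {z | ¬ Function.Bijective (jm M z)}.Finite

/-- The arrows which end in a vertex act jointly injectively. -/
def IsStar (M : Rep.{u, v, w} k Q) : Prop := ∀ z, Function.Injective (jm M z)

variable {M N : Rep.{u, v, w} k Q}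

theorem IsStar.of_mono (hN : IsStar N) (f : M ⟶ N) [hf : Mono f] : IsStar M := by
  rw [mono_iff_ev] at hf
  intro z v w h
  have := hN z (a₁ := fun α => ev f α.1 (v α)) (a₂ := fun α => ev f α.1 (w α))
    (by rw [← ev_jm, ← ev_jm, h])
  funext α
  exact hf _ (congrFun this α)

theorem jm_surjective_of_epi (f : M ⟶ N) [hf : Epi f] {z : Q}
    (h : Function.Surjective (jm M z)) : Function.Surjective (jm N z) := by
  rw [epi_iff_ev] at hf
  intro w
  obtain ⟨w, rfl⟩ := hf z w
  obtain ⟨v, rfl⟩ := h w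
  exact ⟨_, (ev_jm f z v).symm⟩

section Closure

variable {S : ShortComplex (Rep.{u, v, w} k Q)}

theorem exists_family_lift (hS : S.ShortExact) {z : Q} (b : ∀ α : Σ y : Q, (y ⟶ z), sp S.X₂ α.1)
    (h : (fun α => ev S.g α.1 (b α)) = 0) :
    ∃ a : ∀ α : Σ y : Q, (y ⟶ z), sp S.X₁ α.1, (fun α => ev S.f α.1 (a α)) = b := by
  choose a ha using fun α => (shortExact_exact hS _ _).1 (congrFun h α)
  exact ⟨a, funext ha⟩

/-- The maps `jm` form a morphism between two short exact sequences; as in the five lemma,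
bijectivity of two of them gives that of the third. This and its two companions make `IsFP`
inherited in short exact sequences. -/
theorem jm_bijective_X₂ (hS : S.ShortExact) {z : Q} (h1 : Function.Bijective (jm S.X₁ z))
    (h3 : Function.Bijective (jm S.X₃ z)) : Function.Bijective (jm S.X₂ z) := by
  constructor
  · rw [injective_iff_map_eq_zero]
    intro b hb
    have h4 : (fun α => ev S.g α.1 (b α)) = 0 := h3.1 (by rw [← ev_jm, hb, map_zero, map_zero])
    obtain ⟨a, rfl⟩ := exists_family_lift hS b h4
    rw [← ev_jm] at hb
    have : a = 0 := h1.1 (by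
      rw [map_zero]; exact shortExact_injective hS z (by rw [hb, map_zero]))
    subst this
    funext α
    exact map_zero _
  · intro w
    obtain ⟨c, hc⟩ := h3.2 (ev S.g z w)
    choose b hb using fun α : Σ y : Q, (y ⟶ z) => shortExact_surjective hS _ (c α)
    obtain ⟨u, hu⟩ := (shortExact_exact hS z (w - jm S.X₂ z b)).1 (by
      rw [map_sub, ev_jm, funext hb, hc, sub_self])
    obtain ⟨a, rfl⟩ := h1.2 u
    refine ⟨(fun α => ev S.f α.1 (a α)) + b, ?_⟩
    rw [map_add, ← ev_jm, hu, sub_add_cancel]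

theorem jm_bijective_X₃ (hS : S.ShortExact) {z : Q} (h1 : Function.Bijective (jm S.X₁ z))
    (h2 : Function.Bijective (jm S.X₂ z)) : Function.Bijective (jm S.X₃ z) := by
  have := hS.epi_g
  refine ⟨?_, jm_surjective_of_epi S.g h2.2⟩
  rw [injective_iff_map_eq_zero]
  intro c hc
  choose b hb using fun α : Σ y : Q, (y ⟶ z) => shortExact_surjective hS _ (c α)
  obtain ⟨u, hu⟩ := (shortExact_exact hS z (jm S.X₂ z b)).1 (by rw [ev_jm, funext hb, hc])
  obtain ⟨a, rfl⟩ := h1.2 u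
  rw [ev_jm] at hu
  have := h2.1 hu
  subst this
  funext α
  rw [← hb α, ← ev_comp, S.zero]
  rfl

theorem jm_bijective_X₁ (hS : S.ShortExact) {z : Q} (h2 : Function.Bijective (jm S.X₂ z))
    (h3 : Function.Bijective (jm S.X₃ z)) : Function.Bijective (jm S.X₁ z) := by
  constructor
  · rw [injective_iff_map_eq_zero]
    intro a ha
    have h4 : (fun α => ev S.f α.1 (a α)) = 0 := h2.1 (by rw [← ev_jm, ha, map_zero, map_zero])
    funext α
    exact shortExact_injective hS _ ((congrFun h4 α).trans (map_zero _).symm)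
  · intro u
    obtain ⟨b, hb⟩ := h2.2 (ev S.f z u)
    have h4 : (fun α => ev S.g α.1 (b α)) = 0 := h3.1 (by
      rw [← ev_jm, hb, map_zero, ← ev_comp, S.zero, ev_zero])
    obtain ⟨a, rfl⟩ := exists_family_lift hS b h4
    rw [← ev_jm] at hb
    exact ⟨a, shortExact_injective hS z hb⟩

theorem IsFP.X₃ (hS : S.ShortExact) (h1 : IsFP S.X₁) (h2 : IsFP S.X₂) : IsFP S.X₃ where
  fin x := by
    have := h2.fin x
    exact Module.Finite.of_surjective _ (shortExact_surjective hS x)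
  supp := by
    obtain ⟨s, hs, h⟩ := h2.supp
    exact ⟨s, hs, fun x hx => h x (shortExact_surjective hS x).nontrivial⟩
  bij := (h1.bij.union h2.bij).subset fun z hz => by
    by_contra hc
    simp only [Set.mem_union, Set.mem_ofPred_eq, not_or, not_not] at hc
    exact hz (jm_bijective_X₃ hS hc.1 hc.2)

theorem IsFP.X₁ (hS : S.ShortExact) (h2 : IsFP S.X₂) (h3 : IsFP S.X₃) : IsFP S.X₁ where
  fin x := by
    have := h2.fin x
    exact Module.Finite.of_injective _ (shortExact_injective hS x)
  supp := by
    obtain ⟨s, hs, h⟩ := h2.supp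
    exact ⟨s, hs, fun x hx => h x (shortExact_injective hS x).nontrivial⟩
  bij := (h2.bij.union h3.bij).subset fun z hz => by
    by_contra hc
    simp only [Set.mem_union, Set.mem_ofPred_eq, not_or, not_not] at hc
    exact hz (jm_bijective_X₁ hS hc.1 hc.2)

theorem IsFP.X₂ (hS : S.ShortExact) (h1 : IsFP S.X₁) (h3 : IsFP S.X₃) : IsFP S.X₂ where
  fin x := by
    have := h1.fin x
    have := h3.fin x
    have h5 : LinearMap.range (ev S.f x) = LinearMap.ker (ev S.g x) := by
      ext a
      exact (shortExact_exact hS x a).symm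
    have h6 : Module.Finite k (LinearMap.ker (ev S.g x)) := h5 ▸ inferInstance
    have h7 : Module.Finite k (sp S.X₂ x ⧸ LinearMap.ker (ev S.g x)) :=
      Module.Finite.equiv (LinearMap.quotKerEquivOfSurjective _ (shortExact_surjective hS x)).symm
    exact Module.Finite.of_submodule_quotient (LinearMap.ker (ev S.g x))
  supp := by
    obtain ⟨s, hs, h⟩ := h1.supp
    obtain ⟨t, ht, h'⟩ := h3.supp
    refine ⟨s ∪ t, hs.union ht, fun x hx => ?_⟩
    by_cases h1x : Nontrivial (sp S.X₁ x)
    · obtain ⟨a, ha, p⟩ := h x h1x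
      exact ⟨a, Or.inl ha, p⟩
    · have h3x : Nontrivial (sp S.X₃ x) := by
        rw [not_nontrivial_iff_subsingleton] at h1x
        refine Function.Injective.nontrivial (f := ev S.g x) ?_
        rw [injective_iff_map_eq_zero]
        intro a ha
        obtain ⟨u, rfl⟩ := (shortExact_exact hS x a).1 ha
        rw [Subsingleton.elim u 0, map_zero]
      obtain ⟨a, ha, p⟩ := h' x h3x
      exact ⟨a, Or.inr ha, p⟩
  bij := (h1.bij.union h3.bij).subset fun z hz => by
    by_contra hc
    simp only [Set.mem_union, Set.mem_ofPred_eq, not_or, not_not] at hc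
    exact hz (jm_bijective_X₂ hS hc.1 hc.2)

end Closure

theorem IsFP.of_retract (hM : IsFP M) (i : N ⟶ M) (r : M ⟶ N) (h : i ≫ r = 𝟙 N) : IsFP N := by
  have hir : ∀ x v, ev r x (ev i x v) = v := fun x v => by rw [← ev_comp, h, ev_id]
  have hi : ∀ x, Function.Injective (ev i x) := fun x => Function.LeftInverse.injective (hir x)
  have hr : ∀ x, Function.Surjective (ev r x) := fun x => Function.RightInverse.surjective (hir x)
  refine ⟨fun x => ?_, ?_, hM.bij.subset fun z hz hb => hz ⟨?_, ?_⟩⟩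
  · have := hM.fin x
    exact Module.Finite.of_injective _ (hi x)
  · obtain ⟨s, hs, h⟩ := hM.supp
    exact ⟨s, hs, fun x hx => h x (hi x).nontrivial⟩
  · intro v w hvw
    have := hb.1 (a₁ := fun α => ev i α.1 (v α)) (a₂ := fun α => ev i α.1 (w α))
      (by rw [← ev_jm, ← ev_jm, hvw])
    funext α
    exact hi _ (congrFun this α)
  · have := (epi_iff_ev r).2 hr
    exact jm_surjective_of_epi r hb.2

theorem IsFP.of_iso (hM : IsFP M) (e : M ≅ N) : IsFP N :=
  hM.of_retract e.inv e.hom e.inv_hom_id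

/-- Finite dimensional representations are finitely presented. -/
theorem IsFP.of_finite (hf : ∀ x, Module.Finite k (sp M x))
    (hs : {x | Nontrivial (sp M x)}.Finite) : IsFP M := by
  refine ⟨hf, ⟨_, hs, fun x hx => subset_Succ _ hx⟩, ?_⟩
  have h1 : (⋃ x ∈ {x | Nontrivial (sp M x)}, Set.range
      fun α : Σ y : Q, (x ⟶ y) => α.1).Finite :=
    hs.biUnion fun x _ => Set.finite_range _
  refine (hs.union h1).subset fun z hz => ?_
  by_contra hc
  apply hz
  rw [Set.mem_union, not_or] at hc
  have hz0 : Subsingleton (sp M z) := not_nontrivial_iff_subsingleton.1 hc.1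
  have hy : ∀ α : Σ y : Q, (y ⟶ z), Subsingleton (sp M α.1) := fun α => by
    by_contra h
    rw [not_subsingleton_iff_nontrivial] at h
    exact hc.2 (Set.mem_biUnion (x := α.1) h ⟨⟨z, α.2⟩, rfl⟩)
  exact ⟨fun v w _ => funext fun α => Subsingleton.elim _ _,
    fun w => ⟨0, Subsingleton.elim _ _⟩⟩

/-! #### Free representations -/

section Free

variable {ι : Type (max u v w)} {b : ι → Q}

theorem frC_ar_cons {x y z : Q} (α : x ⟶ z) (β : y ⟶ z) (v : sp (Fr k b) x) (i : ι)
    (q : Quiver.Path (b i) y) (h : (⟨x, α⟩ : Σ y : Q, (y ⟶ z)) ≠ ⟨y, β⟩) :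
    frC b z (ar (Fr k b) α v) ⟨i, q.cons β⟩ = 0 := by
  rw [frC_ar]
  refine Finsupp.mapDomain_of_notMem_range _ _ ?_
  rintro ⟨⟨j, p⟩, hp⟩
  apply h
  simp only [Sigma.mk.injEq] at hp
  obtain ⟨rfl, hp⟩ := hp
  have hp := eq_of_heq hp
  cases hp
  rfl

theorem cons_injective {x z : Q} (α : x ⟶ z) : Function.Injective
    (fun s : Σ i, Quiver.Path (b i) x => (⟨s.1, s.2.cons α⟩ : Σ i, Quiver.Path (b i) z)) := by
  rintro ⟨i, p⟩ ⟨j, q⟩ h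
  simp only [Sigma.mk.injEq] at h
  obtain ⟨rfl, h⟩ := h
  have h := eq_of_heq h
  cases h
  rfl

theorem frC_ar_cons_same {x z : Q} (α : x ⟶ z) (v : sp (Fr k b) x) (i : ι)
    (q : Quiver.Path (b i) x) :
    frC b z (ar (Fr k b) α v) ⟨i, q.cons α⟩ = frC b x v ⟨i, q⟩ := by
  rw [frC_ar]
  exact Finsupp.mapDomain_apply (cons_injective α) _ ⟨i, q⟩

theorem frC_jm_cons {y z : Q} (β : y ⟶ z) (v : ∀ α : Σ y : Q, (y ⟶ z), sp (Fr k b) α.1) (i : ι)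
    (q : Quiver.Path (b i) y) :
    frC b z (jm (Fr k b) z v) ⟨i, q.cons β⟩ = frC b y (v ⟨y, β⟩) ⟨i, q⟩ := by
  rw [jm_apply, map_sum, Finsupp.finsetSum_apply, Finset.sum_eq_single ⟨y, β⟩]
  · exact frC_ar_cons_same _ _ _ _
  · rintro ⟨x, α⟩ _ hα
    exact frC_ar_cons _ _ _ _ _ hα
  · simp

/-- A path of positive length has a unique last arrow: the coordinate of `jm v` at `q.cons β` is the
coordinate at `q` of the component of `v` at `β`. -/
theorem isStar_Fr (b : ι → Q) : IsStar (Fr k b) := by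
  intro z v w h
  funext ⟨y, β⟩
  apply (frC b y).injective
  ext ⟨i, q⟩
  rw [← frC_jm_cons, h, frC_jm_cons]

theorem jm_Fr_surjective {z : Q} (h : ∀ i, b i ≠ z) : Function.Surjective (jm (Fr k b) z) := by
  classical
  rw [← LinearMap.range_eq_top, eq_top_iff]
  intro v _
  induction v using fr_induction with
  | zero => exact zero_mem _
  | add v w hv hw => exact add_mem (hv trivial) (hw trivial)
  | smul c i q =>
    refine Submodule.smul_mem _ _ ?_
    cases q with
    | nil => exact absurd rfl (h i)
    | cons q α =>
      refine ⟨Pi.single ⟨_, α⟩ (frSingle k b i q), ?_⟩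
      rw [jm_single, ar_frSingle]

instance moduleFinite_Fr [Finite ι] (x : Q) : Module.Finite k (sp (Fr k b) x) :=
  Module.Finite.equiv (frC b x).symm

theorem exists_path_of_nontrivial {x : Q} (h : Nontrivial (sp (Fr k b) x)) :
    ∃ i, Nonempty (Quiver.Path (b i) x) := by
  by_contra hc
  push Not at hc
  have : IsEmpty (Σ i, Quiver.Path (b i) x) := ⟨fun s => (hc s.1).false s.2⟩
  exact not_subsingleton _ ((frC (k := k) b x).injective.subsingleton)

theorem isFP_Fr [Finite ι] (b : ι → Q) : IsFP (Fr k b) where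
  fin x := inferInstance
  supp := ⟨Set.range b, Set.finite_range b, fun x hx => by
    obtain ⟨i, p⟩ := exists_path_of_nontrivial hx
    exact ⟨b i, ⟨i, rfl⟩, p⟩⟩
  bij := (Set.finite_range b).subset fun z hz => by
    by_contra hc
    exact hz ⟨isStar_Fr b z, jm_Fr_surjective fun i hi => hc ⟨i, hi⟩⟩

end Free

end FP

/-! ### Free covers and free presentations -/

section Cover

variable {k : Type w} [Field k] {Q : Type u} [Quiver.{v} Q] [hQ : SLF Q]
  {M N : Rep.{u, v, w} k Q}

theorem subsingleton_sp_Fr {ι : Type (max u v w)} {b : ι → Q} {x : Q}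
    (h : x ∉ Succ (Set.range b)) : Subsingleton (sp (Fr k b) x) := by
  rw [← not_nontrivial_iff_subsingleton]
  intro hx
  obtain ⟨i, p⟩ := exists_path_of_nontrivial hx
  exact h ⟨b i, ⟨i, rfl⟩, p⟩

open Classical in
/-- A finitely presented representation has a free cover, which is an isomorphism if the arrows
act jointly injectively. -/
theorem IsFP.exists_cover (hM : IsFP M) : ∃ (ι : Type (max u v w)) (_ : Finite ι) (b : ι → Q)
    (p : Fr k b ⟶ M), Epi p ∧ (IsStar M → IsIso p) := by
  have hfin := hM.fin
  -- The generators at `z` are a basis of a complement of the image of `jm M z`. They are finite in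
  -- number because `jm M z` is onto for almost all `z`.
  choose C hC using fun z => (LinearMap.range (jm M z)).exists_isCompl
  let d : Q → ℕ := fun z => Module.finrank k (C z)
  let B : ∀ z, Module.Basis (Fin (d z)) k (C z) := fun z => Module.finBasis k (C z)
  let ι : Type (max u v w) := ULift.{max v w} (Σ z, Fin (d z))
  let b : ι → Q := fun i => i.down.1
  let g : ∀ i : ι, sp M (b i) := fun i => (B i.down.1 i.down.2 : sp M i.down.1)
  have hd : ∀ z, z ∉ {z | ¬ Function.Bijective (jm M z)} → d z = 0 := by
    intro z hz
    simp only [Set.mem_ofPred_eq, not_not] at hz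
    have h1 : LinearMap.range (jm M z) = ⊤ := LinearMap.range_eq_top.2 hz.2
    have h2 : C z = ⊥ := by
      have := (hC z).inf_eq_bot
      rwa [h1, top_inf_eq] at this
    change Module.finrank k (C z) = 0
    rw [h2, finrank_bot]
  have hι : Finite ι := by
    have h3 : Finite (Σ z : {z | ¬ Function.Bijective (jm M z)}, Fin (d z)) := by
      have : Finite {z | ¬ Function.Bijective (jm M z)} := hM.bij
      infer_instance
    refine Finite.of_injective (β := Σ z : {z | ¬ Function.Bijective (jm M z)}, Fin (d z))
      (fun i => ⟨⟨i.down.1, ?_⟩, i.down.2⟩) ?_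
    · by_contra hc
      have := i.down.2.2
      exact Nat.not_lt_zero _ (this.trans_eq (hd _ hc))
    · rintro ⟨⟨z, j⟩⟩ ⟨⟨z', j'⟩⟩ h
      simp only [Sigma.mk.injEq, Subtype.mk.injEq] at h
      obtain ⟨rfl, h⟩ := h
      have h := eq_of_heq h
      exact congrArg (fun j => (⟨⟨z, j⟩⟩ : ι)) h
  have hepi : Epi (frHom g) := by
    rw [epi_iff_ev]
    -- By induction along arrows: what comes from the earlier vertices is covered already, and the
    -- complement is covered by the new generators.
    obtain ⟨s, hs, hsupp⟩ := hM.supp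
    intro z
    induction z using succ_induction hs with
    | h z ih =>
      have ih' : ∀ α : Σ y : Q, (y ⟶ z), Function.Surjective (ev (frHom g) α.1) := by
        intro α
        by_cases hα : α.1 ∈ Succ s
        · exact ih α.1 α.2 hα
        · intro v
          have : Subsingleton (sp M α.1) :=
            not_nontrivial_iff_subsingleton.1 fun h => hα (hsupp _ h)
          exact ⟨0, Subsingleton.elim _ _⟩
      rw [← LinearMap.range_eq_top, eq_top_iff, ← (hC z).sup_eq_top, sup_le_iff]
      constructor
      · rintro _ ⟨v, rfl⟩
        choose u hu using fun α => ih' α (v α)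
        refine ⟨jm _ z u, ?_⟩
        rw [ev_jm, funext hu]
      · intro c hc
        have h5 := (B z).sum_repr ⟨c, hc⟩
        have h6 := congrArg Subtype.val h5
        simp only [Submodule.coe_sum, Submodule.coe_smul] at h6
        rw [← h6]
        refine Submodule.sum_mem _ fun j _ => Submodule.smul_mem _ _ ?_
        exact ⟨frGen k b ⟨⟨z, j⟩⟩, ev_frHom_gen g ⟨⟨z, j⟩⟩⟩
  refine ⟨ι, hι, b, frHom g, hepi, fun hstar => ?_⟩
  · rw [isIso_iff_ev]
    refine fun z => ⟨?_, (epi_iff_ev _).1 hepi z⟩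
    induction z using succ_induction (Set.finite_range b) with
    | h z ih =>
      have ih' : ∀ α : Σ y : Q, (y ⟶ z), Function.Injective (ev (frHom g) α.1) := by
        intro α
        by_cases hα : α.1 ∈ Succ (Set.range b)
        · exact ih α.1 α.2 hα
        · have := subsingleton_sp_Fr (k := k) hα
          exact Function.injective_of_subsingleton _
      -- The space of the free representation splits in the same way, into images under arrows and
      -- new generators. The complement `C z` separates the two parts; `IsStar` and the induction
      -- hypothesis then make the first part zero.
      have hdec : ∀ v : sp (Fr k b) z, ∃ (u : ∀ α : Σ y : Q, (y ⟶ z), sp (Fr k b) α.1)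
          (c : Fin (d z) → k), v = jm (Fr k b) z u + ∑ j, c j • frGen k b ⟨⟨z, j⟩⟩ := by
        intro v
        induction v using fr_induction with
        | zero => exact ⟨0, 0, by simp⟩
        | add v w hv hw =>
          obtain ⟨a, c, rfl⟩ := hv
          obtain ⟨a', c', rfl⟩ := hw
          refine ⟨a + a', c + c', ?_⟩
          simp only [map_add, Pi.add_apply, add_smul, Finset.sum_add_distrib]
          abel
        | smul c i q =>
          cases q with
          | nil =>
            obtain ⟨⟨z, j⟩⟩ := i
            refine ⟨0, Pi.single j c, ?_⟩
            rw [map_zero, zero_add, Finset.sum_eq_single j]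
            · rw [Pi.single_eq_same]; rfl
            · intro j' _ hj
              rw [Pi.single_eq_of_ne hj, zero_smul]
            · simp
          | cons q α =>
            refine ⟨Pi.single ⟨_, α⟩ (c • frSingle k b i q), 0, ?_⟩
            rw [jm_single, map_smul, ar_frSingle]
            simp
      rw [injective_iff_map_eq_zero]
      intro v hv
      obtain ⟨a, c, rfl⟩ := hdec v
      have h7 : ev (frHom g) z (∑ j, c j • frGen k b ⟨⟨z, j⟩⟩) = ((∑ j, c j • B z j : C z) : sp M z) := by
        rw [map_sum, Submodule.coe_sum]
        refine Finset.sum_congr rfl fun j _ => ?_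
        rw [map_smul, Submodule.coe_smul]
        exact congrArg (c j • ·) (ev_frHom_gen g ⟨⟨z, j⟩⟩)
      rw [map_add, h7, ev_jm] at hv
      have h8 := Submodule.disjoint_def.1 (hC z).disjoint _ ⟨_, rfl⟩
        ((eq_neg_of_add_eq_zero_left hv) ▸ (C z).neg_mem (Subtype.property _))
      rw [h8, zero_add] at hv
      have h9 : (fun α => ev (frHom g) α.1 (a α)) = 0 := hstar z (by rw [h8, map_zero])
      have h10 : a = 0 := funext fun α => ih' α ((congrFun h9 α).trans (map_zero _).symm)
      have h11 : c = 0 := by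
        have h12 := (Fintype.linearIndependent_iff.1 (B z).linearIndependent) c
          (Subtype.ext hv)
        exact funext h12
      simp [h10, h11]

/-- A free presentation. -/
theorem IsFP.exists_presentation (hM : IsFP M) : ∃ (ι₁ ι₀ : Type (max u v w)) (_ : Finite ι₁)
    (_ : Finite ι₀) (b₁ : ι₁ → Q) (b₀ : ι₀ → Q) (i : Fr k b₁ ⟶ Fr k b₀) (p : Fr k b₀ ⟶ M)
    (w : i ≫ p = 0), (ShortComplex.mk i p w).ShortExact := by
  obtain ⟨ι₀, h₀, b₀, p, hp, -⟩ := hM.exists_cover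
  have hk : (ShortComplex.mk (Limits.kernel.ι p) p (Limits.kernel.condition p)).ShortExact :=
    shortExact_of_lift _ fun W d hd => ⟨Limits.kernel.lift p d hd, Limits.kernel.lift_ι p d hd⟩
  have hK : IsFP (Limits.kernel p) := IsFP.X₁ hk (isFP_Fr b₀) hM
  -- Heredity: the kernel is a subrepresentation of a free one, so its own free cover is an
  -- isomorphism.
  have hs : IsStar (Limits.kernel p) := (isStar_Fr b₀).of_mono (Limits.kernel.ι p)
  obtain ⟨ι₁, h₁, b₁, q, -, hq⟩ := hK.exists_cover
  have hq := hq hs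
  refine ⟨ι₁, ι₀, h₁, h₀, b₁, b₀, q ≫ Limits.kernel.ι p, p, by simp, ?_⟩
  refine shortExact_of_lift _ fun W d hd => ⟨Limits.kernel.lift p d hd ≫ inv q, by simp⟩

/-- Morphisms between finitely presented representations form finite dimensional spaces. -/
theorem IsFP.moduleFinite_hom (hM : IsFP M) (hN : IsFP N) : Module.Finite k (M ⟶ N) := by
  obtain ⟨ι, _, b, p, _, -⟩ := hM.exists_cover
  have := hN.fin
  exact moduleFinite_hom_of_epi p

end Cover

/-! ### Comparison with finite presentation by the `P_a ⊗ U` -/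

section FinPres

variable {k : Type w} [Field k] {Q : Type u} [Quiver.{v} Q]
  {M N : Rep.{u, v, w} k Q}

/-- The spaces of `P_a ⊗ U`. -/
noncomputable def ptC (a : Q) (U : ModuleCat.{max u v w} k) (x : Q) :
    sp (P.{u, v, w} k a ⋙ tensorWith k U) x ≃ₗ[k] TensorProduct k (Quiver.Path a x →₀ k) U :=
  { toFun := fun v => v, invFun := fun v => v, map_add' := fun _ _ => rfl,
    map_smul' := fun _ _ => rfl, left_inv := fun _ => rfl, right_inv := fun _ => rfl }

theorem ptC_pm (a : Q) (U : ModuleCat.{max u v w} k) {x y : Q} (p : Quiver.Path x y)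
    (v : sp (P.{u, v, w} k a ⋙ tensorWith k U) x) :
    ptC a U y (pm _ p v) =
      LinearMap.rTensor U (Finsupp.lmapDomain k k fun q => q.comp p) (ptC a U x v) := rfl

theorem isIso_of_linearEquiv {ι : Type (max u v w)} {b : ι → Q} (f : Fr k b ⟶ M)
    (e : ∀ x, sp (Fr k b) x ≃ₗ[k] sp M x)
    (h : ∀ x i q, ev f x (frSingle k b i q) = e x (frSingle k b i q)) : IsIso f := by
  rw [isIso_iff_ev]
  intro x
  have : ev f x = (e x).toLinearMap := by
    ext v
    induction v using fr_induction with
    | zero => simp only [map_zero]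
    | add a c ha hc => simp only [map_add, ha, hc]
    | smul c i q =>
      rw [map_smul, map_smul]
      exact congrArg (c • ·) (h x i q)
  rw [this]
  exact (e x).bijective

theorem nonempty_iso_tensor (a : Q) (U : ModuleCat.{max u v w} k) {J : Type (max u v w)}
    (B : Module.Basis J k U) :
    Nonempty (Fr k (fun _ : J => a) ≅ P.{u, v, w} k a ⋙ tensorWith k U) := by
  let f : Fr k (fun _ : J => a) ⟶ P.{u, v, w} k a ⋙ tensorWith k U :=
    frHom fun j => (ptC a U a).symm (TensorProduct.tmul k (Finsupp.single Quiver.Path.nil 1) (B j))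
  let T : ∀ x, Module.Basis (Quiver.Path a x × J) k (TensorProduct k (Quiver.Path a x →₀ k) U) :=
    fun x => Finsupp.basisSingleOne.tensorProduct B
  have hf : IsIso f := by
    refine isIso_of_linearEquiv f (fun x => (frC _ x).trans ((Finsupp.domLCongr (R := k) (M := k)
      ((Equiv.sigmaEquivProd _ _).trans (Equiv.prodComm _ _))).trans
      ((T x).repr.symm.trans (ptC a U x).symm))) fun x i q => ?_
    apply (ptC a U x).injective
    rw [ev_frHom_frSingle, ptC_pm, LinearEquiv.apply_symm_apply, LinearMap.rTensor_tmul,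
      Finsupp.lmapDomain_apply, Finsupp.mapDomain_single, LinearEquiv.trans_apply,
      LinearEquiv.trans_apply, LinearEquiv.trans_apply, LinearEquiv.apply_symm_apply, frSingle,
      LinearEquiv.apply_symm_apply, Finsupp.domLCongr_single, Module.Basis.repr_symm_single_one]
    simp only [T, Quiver.Path.nil_comp]
    simp
  exact ⟨asIso f⟩

theorem nonempty_iso_coproduct {n : ℕ} (a : Fin n → Q) (U : Fin n → ModuleCat.{max u v w} k)
    {J : Fin n → Type (max u v w)} (B : ∀ i, Module.Basis (J i) k (U i)) :
    Nonempty (Fr k (fun s : Σ i, J i => a s.1) ≅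
      ∐ fun i => P.{u, v, w} k (a i) ⋙ tensorWith k (U i)) := by
  have e := fun i => (nonempty_iso_tensor (a i) (U i) (B i)).some
  let c : ∀ i, Fr k (fun _ : J i => a i) ⟶ Fr k (fun s : Σ i, J i => a s.1) := fun i =>
    frHom fun j => frGen k (fun s : Σ i, J i => a s.1) ⟨i, j⟩
  let f : Fr k (fun s : Σ i, J i => a s.1) ⟶ ∐ fun i => P.{u, v, w} k (a i) ⋙ tensorWith k (U i) :=
    frHom fun s => ev ((e s.1).hom ≫ Limits.Sigma.ι
      (fun i => P.{u, v, w} k (a i) ⋙ tensorWith k (U i)) s.1) _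
      (frGen k (fun _ : J s.1 => a s.1) s.2)
  have hcf : ∀ i, c i ≫ f = (e i).hom ≫ Limits.Sigma.ι
      (fun i => P.{u, v, w} k (a i) ⋙ tensorWith k (U i)) i := fun i => by
    refine frHom_ext fun j => ?_
    rw [ev_comp, ev_frHom_gen]
    exact ev_frHom_gen (b := fun s : Σ i, J i => a s.1) _ ⟨i, j⟩
  refine ⟨⟨f, Limits.Sigma.desc fun i => (e i).inv ≫ c i, ?_, ?_⟩⟩
  · refine frHom_ext fun s => ?_
    rw [ev_comp, ev_frHom_gen, ← ev_comp, Category.assoc, Limits.Sigma.ι_desc,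
      Iso.hom_inv_id_assoc, ev_frHom_gen]
    rfl
  · refine Limits.Sigma.hom_ext _ _ fun i => ?_
    rw [Limits.Sigma.ι_desc_assoc, Category.assoc, hcf]
    simp

theorem nonempty_iso_reindex {ι ι' : Type (max u v w)} (b : ι → Q) (e : ι' ≃ ι) :
    Nonempty (Fr k (fun i => b (e i)) ≅ Fr k b) := by
  let f : Fr k (fun i => b (e i)) ⟶ Fr k b := frHom fun i => frGen k b (e i)
  have hf : IsIso f := by
    refine isIso_of_linearEquiv f (fun x => (frC _ x).trans ((Finsupp.domLCongr (R := k) (M := k)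
      (Equiv.sigmaCongrLeft (β := fun i => Quiver.Path (b i) x) e)).trans (frC b x).symm))
      fun x i q => ?_
    apply (frC b x).injective
    rw [ev_frHom_frSingle, pm_frGen, LinearEquiv.trans_apply,
      LinearEquiv.trans_apply, LinearEquiv.apply_symm_apply, frSingle, frSingle,
      LinearEquiv.apply_symm_apply, LinearEquiv.apply_symm_apply, Finsupp.domLCongr_single]
    rfl
  exact ⟨asIso f⟩

theorem inProj_Fr {ι : Type (max u v w)} [Finite ι] (b : ι → Q) : InProj (Fr k b) := by
  obtain ⟨n, ⟨e⟩⟩ := Finite.exists_equiv_fin ι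
  let U : ModuleCat.{max u v w} k := ModuleCat.of k (PUnit.{max u v w + 1} →₀ k)
  let B : Module.Basis PUnit.{max u v w + 1} k U := Finsupp.basisSingleOne
  obtain ⟨t⟩ := nonempty_iso_coproduct (fun i => b (e.symm i)) (fun _ => U) (fun _ => B)
  obtain ⟨t'⟩ := nonempty_iso_reindex (k := k) b
    ((Equiv.sigmaPUnit (Fin n)).trans e.symm : (Σ _ : Fin n, PUnit.{max u v w + 1}) ≃ ι)
  exact ⟨n, _, _, ⟨t'.symm ≪≫ t⟩⟩

/-- Choosing bases of the `U i` turns `M` into a free representation. Each basis is finite, because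
together with the trivial path its elements give independent elements of the finite dimensional
space `M(a i)`. -/
theorem InProj.isFP [hQ : SLF Q] (hM : InProj M) (h : IsLocallyFinite M) : IsFP M := by
  obtain ⟨n, a, U, ⟨e⟩⟩ := hM
  obtain ⟨t⟩ := nonempty_iso_coproduct a U fun i => Module.Basis.ofVectorSpace k (U i)
  obtain ⟨b, hb⟩ : ∃ b : (Σ i, Module.Basis.ofVectorSpaceIndex k (U i)) → Q,
    b = fun s => a s.1 := ⟨_, rfl⟩
  rw [← hb] at t
  have hfin : ∀ i, Finite (Module.Basis.ofVectorSpaceIndex k (U i)) := fun i => by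
    have h1 : Module.Finite k (sp M (a i)) := h (a i)
    have h2 : Module.Finite k (sp (Fr k b) (a i)) := by
      have h3 := (isIso_iff_ev (e ≪≫ t.symm).hom).1 inferInstance (a i)
      exact Module.Finite.of_surjective _ h3.2
    have h3 : Module.Finite k ((Σ j, Quiver.Path (b j) (a i)) →₀ k) :=
      Module.Finite.equiv (frC b (a i))
    have h4 : Finite (Σ j, Quiver.Path (b j) (a i)) :=
      Module.Finite.finite_basis (Finsupp.basisSingleOne (R := k))
    subst hb
    refine Finite.of_injective (fun j => (⟨⟨i, j⟩, Quiver.Path.nil⟩ :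
      (Σ j : (Σ i, Module.Basis.ofVectorSpaceIndex k (U i)), Quiver.Path (a j.1) (a i))))
      fun j j' hj => ?_
    have := congrArg Sigma.fst hj
    simpa using this
  exact (isFP_Fr b).of_iso (t ≪≫ e.symm)

theorem isFinPres_iff [hQ : SLF Q] : IsFinPres M ↔ IsFP M := by
  constructor
  · rintro ⟨S, hS, rfl, h1, h2⟩
    exact IsFP.X₃ hS (h1.1.isFP h1.2) (h2.1.isFP h2.2)
  · intro h
    obtain ⟨ι₁, ι₀, _, _, b₁, b₀, i, p, w, hS⟩ := h.exists_presentation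
    exact ⟨_, hS, rfl, ⟨inProj_Fr b₁, fun x => moduleFinite_Fr (k := k) (b := b₁) x⟩,
      ⟨inProj_Fr b₀, fun x => moduleFinite_Fr (k := k) (b := b₀) x⟩⟩

end FinPres

/-! ### The full subcategory `rep⁺(Q)`: local endomorphism algebras and direct summands -/

section RepPlus

variable {k : Type w} [Field k] {Q : Type u} [Quiver.{v} Q]

section

variable {X Y Z : RepPlus.{u, v, w} k Q}

theorem isIso_hom_iff (f : X ⟶ Y) : IsIso f.hom ↔ IsIso f := ObjectProperty.isIso_hom_iff f

theorem isZero_obj_iff : Limits.IsZero X.obj ↔ Limits.IsZero X := by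
  rw [Limits.IsZero.iff_id_eq_zero, Limits.IsZero.iff_id_eq_zero]
  exact ⟨fun h => ObjectProperty.hom_ext _ h, fun h => congrArg (fun f => f.hom) h⟩

theorem nonempty_iso_obj_iff : Nonempty (X.obj ≅ Y.obj) ↔ Nonempty (X ≅ Y) :=
  ⟨fun ⟨e⟩ => ⟨ObjectProperty.isoMk _ e⟩, fun ⟨e⟩ => ⟨(ObjectProperty.ι _).mapIso e⟩⟩

theorem inRad_hom_iff (f : X ⟶ Y) : InRad f.hom ↔ InRad f :=
  ⟨fun h g => (isIso_hom_iff _).1 (h g.hom),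
    fun h g => (isIso_hom_iff _).2 (h (ObjectProperty.homMk g))⟩

theorem isLoc_obj_iff : IsLoc X.obj ↔ IsLoc X := by
  refine and_congr (not_congr isZero_obj_iff) ⟨fun h u => ?_, fun h u => ?_⟩
  · rw [← isIso_hom_iff, ← isIso_hom_iff]
    exact h u.hom
  · have := h (ObjectProperty.homMk u)
    rwa [← isIso_hom_iff, ← isIso_hom_iff] at this

theorem isBrick_obj_iff : IsBrick k X.obj ↔ IsBrick k X := by
  refine and_congr (not_congr isZero_obj_iff) ⟨fun h u => ?_, fun h u => ?_⟩
  · obtain ⟨c, hc⟩ := h u.hom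
    exact ⟨c, ObjectProperty.hom_ext _ hc⟩
  · obtain ⟨c, hc⟩ := h (ObjectProperty.homMk u)
    exact ⟨c, congrArg (fun f => f.hom) hc⟩

theorem isSplitMono_hom_iff (f : X ⟶ Y) : IsSplitMono f.hom ↔ IsSplitMono f :=
  ⟨fun _ => IsSplitMono.mk' ⟨ObjectProperty.homMk (retraction f.hom),
    ObjectProperty.hom_ext _ (IsSplitMono.id f.hom)⟩,
    fun _ => IsSplitMono.mk' ⟨(retraction f).hom, congrArg (fun f => f.hom) (IsSplitMono.id f)⟩⟩

theorem isSplitEpi_hom_iff (f : X ⟶ Y) : IsSplitEpi f.hom ↔ IsSplitEpi f :=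
  ⟨fun _ => IsSplitEpi.mk' ⟨ObjectProperty.homMk (section_ f.hom),
    ObjectProperty.hom_ext _ (IsSplitEpi.id f.hom)⟩,
    fun _ => IsSplitEpi.mk' ⟨(section_ f).hom, congrArg (fun f => f.hom) (IsSplitEpi.id f)⟩⟩

theorem IsAlmostSplitSeq.of_hom {f : X ⟶ Y} {g : Y ⟶ Z} (h : IsAlmostSplitSeq f.hom g.hom) :
    IsAlmostSplitSeq f g where
  mid_ne_zero h0 := h.mid_ne_zero (isZero_obj_iff.2 h0)
  left_minimal a ha := (isIso_hom_iff _).1 (h.left_minimal a.hom (congrArg (fun f => f.hom) ha))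
  left_almostSplit := by
    refine ⟨fun hs => h.left_almostSplit.1 ((isSplitMono_hom_iff _).2 hs), fun W a ha => ?_⟩
    obtain ⟨b, hb⟩ := h.left_almostSplit.2 _ a.hom fun hs => ha ((isSplitMono_hom_iff _).1 hs)
    exact ⟨ObjectProperty.homMk b, ObjectProperty.hom_ext _ hb⟩
  pseudoKernel := by
    refine ⟨ObjectProperty.hom_ext _ h.pseudoKernel.1, fun W a ha => ?_⟩
    obtain ⟨b, hb⟩ := h.pseudoKernel.2 _ a.hom (congrArg (fun f => f.hom) ha)
    exact ⟨ObjectProperty.homMk b, ObjectProperty.hom_ext _ hb⟩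
  right_minimal a ha := (isIso_hom_iff _).1 (h.right_minimal a.hom (congrArg (fun f => f.hom) ha))
  right_almostSplit := by
    refine ⟨fun hs => h.right_almostSplit.1 ((isSplitEpi_hom_iff _).2 hs), fun W a ha => ?_⟩
    obtain ⟨b, hb⟩ := h.right_almostSplit.2 _ a.hom fun hs => ha ((isSplitEpi_hom_iff _).1 hs)
    exact ⟨ObjectProperty.homMk b, ObjectProperty.hom_ext _ hb⟩
  pseudoCokernel := by
    refine ⟨ObjectProperty.hom_ext _ h.pseudoCokernel.1, fun W a ha => ?_⟩
    obtain ⟨b, hb⟩ := h.pseudoCokernel.2 _ a.hom (congrArg (fun f => f.hom) ha)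
    exact ⟨ObjectProperty.homMk b, ObjectProperty.hom_ext _ hb⟩

end

variable [hQ : SLF Q]

/-- Finitely presented representations as objects of `rep⁺(Q)`. -/
def fpObj {M : Rep.{u, v, w} k Q} (h : IsFP M) : RepPlus.{u, v, w} k Q := ⟨M, isFinPres_iff.2 h⟩

theorem isFP_obj (X : RepPlus.{u, v, w} k Q) : IsFP X.obj := isFinPres_iff.1 X.property

instance moduleFinite_repPlus (X Y : RepPlus.{u, v, w} k Q) : Module.Finite k (X ⟶ Y) := by
  have := IsFP.moduleFinite_hom (isFP_obj X) (isFP_obj Y)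
  let f : (X.obj ⟶ Y.obj) →ₗ[k] (X ⟶ Y) :=
    { toFun := fun f => ObjectProperty.homMk f, map_add' := fun _ _ => rfl,
      map_smul' := fun _ _ => rfl }
  exact Module.Finite.of_surjective f fun g => ⟨g.hom, rfl⟩

/-- In an idempotent complete category, the splitting of an idempotent and its complement. -/
theorem exists_split_idempotent {M : Rep.{u, v, w} k Q} (e : M ⟶ M) (he : e ≫ e = e) :
    ∃ (N N' : Rep.{u, v, w} k Q) (i : N ⟶ M) (r : M ⟶ N) (i' : N' ⟶ M) (r' : M ⟶ N'),
      i ≫ r = 𝟙 N ∧ i' ≫ r' = 𝟙 N' ∧ r ≫ i = e ∧ r' ≫ i' = 𝟙 M - e := by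
  obtain ⟨N, i, r, h, h'⟩ := IsIdempotentComplete.idempotents_split M e he
  obtain ⟨N', i', r', h1, h1'⟩ := IsIdempotentComplete.idempotents_split M (𝟙 M - e)
    (by simp [he])
  exact ⟨N, N', i, r, i', r', h, h1, h', h1'⟩

/-- Indecomposable objects of `rep⁺(Q)` have local endomorphism algebras. -/
theorem IsIndec.isLoc {X : RepPlus.{u, v, w} k Q} (hX : IsIndec X) : IsLoc X := by
  refine isLoc_of_forall_idempotent (k := k) hX.1 fun e he => ?_
  obtain ⟨N, N', i, r, i', r', h, h', hr, hr'⟩ := exists_split_idempotent e.hom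
    (congrArg (fun f => f.hom) he)
  have hN := (isFP_obj X).of_retract i r h
  have hN' := (isFP_obj X).of_retract i' r' h'
  have hee : e.hom ≫ e.hom = e.hom := congrArg (fun f => f.hom) he
  have h0 : i ≫ r' = 0 := by
    have h1 : i ≫ r' = i ≫ (r ≫ i) ≫ (r' ≫ i') ≫ r' := by
      rw [Category.assoc, reassoc_of% h, Category.assoc, h', Category.comp_id]
    rw [h1, hr, hr']
    simp [reassoc_of% hee]
  have h0' : i' ≫ r = 0 := by
    have h1 : i' ≫ r = i' ≫ (r' ≫ i') ≫ (r ≫ i) ≫ r := by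
      rw [Category.assoc, reassoc_of% h', Category.assoc, h, Category.comp_id]
    rw [h1, hr, hr']
    simp [reassoc_of% hee]
  let b : Limits.BinaryBicone (fpObj hN) (fpObj hN') :=
    { pt := X
      fst := ObjectProperty.homMk r
      snd := ObjectProperty.homMk r'
      inl := ObjectProperty.homMk i
      inr := ObjectProperty.homMk i'
      inl_fst := ObjectProperty.hom_ext _ h
      inl_snd := ObjectProperty.hom_ext _ h0
      inr_fst := ObjectProperty.hom_ext _ h0'
      inr_snd := ObjectProperty.hom_ext _ h' }
  have hb : b.fst ≫ b.inl + b.snd ≫ b.inr = 𝟙 b.pt := by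
    apply ObjectProperty.hom_ext
    change r ≫ i + r' ≫ i' = 𝟙 X.obj
    rw [hr, hr']; abel
  rcases hX.2 _ _ b ⟨Limits.isBinaryBilimitOfTotal b hb⟩ ⟨Iso.refl _⟩ with h1 | h1
  · left
    apply ObjectProperty.hom_ext
    rw [← hr, (isZero_obj_iff.2 h1).eq_zero_of_tgt (X := X.obj) r]
    exact Limits.zero_comp
  · right
    apply ObjectProperty.hom_ext
    have h2 : 𝟙 X.obj - e.hom = 0 := by
      rw [← hr', (isZero_obj_iff.2 h1).eq_zero_of_tgt (X := X.obj) r']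
      exact Limits.zero_comp
    exact (sub_eq_zero.1 h2).symm

/-- A non-zero composite through a finitely presented representation survives in one of its
local direct summands. -/
theorem IsFP.exists_local_summand {M : Rep.{u, v, w} k Q} (hM : IsFP M) {L N : Rep.{u, v, w} k Q}
    (f : L ⟶ M) (g : M ⟶ N) (hfg : f ≫ g ≠ 0) : ∃ (Y : Rep.{u, v, w} k Q) (i : Y ⟶ M) (r : M ⟶ Y),
      IsLoc Y ∧ i ≫ r = 𝟙 Y ∧ f ≫ r ≫ i ≫ g ≠ 0 := by
  induction hn : Module.finrank k (M ⟶ M) using Nat.strong_induction_on generalizing M with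
  | _ n ih =>
    have hfin := hM.moduleFinite_hom hM
    by_cases hloc : IsLoc M
    · exact ⟨M, 𝟙 M, 𝟙 M, hloc, by simp, by simpa using hfg⟩
    have h0 : ¬ Limits.IsZero M := fun h => hfg (by
      rw [h.eq_zero_of_tgt f, Limits.zero_comp])
    have hex : ∃ e : M ⟶ M, e ≫ e = e ∧ e ≠ 0 ∧ e ≠ 𝟙 M := by
      by_contra hc
      push Not at hc
      exact hloc (isLoc_of_forall_idempotent (k := k) h0 fun e he => by
        by_cases h1 : e = 0
        · exact Or.inl h1
        · exact Or.inr (hc e he h1))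
    obtain ⟨e, he, he0, he1⟩ := hex
    have key : ∀ (N' : Rep.{u, v, w} k Q) (i : N' ⟶ M) (r : M ⟶ N'), i ≫ r = 𝟙 N' →
        r ≫ i ≠ 𝟙 M → f ≫ r ≫ i ≫ g ≠ 0 → ∃ (Y : Rep.{u, v, w} k Q) (i : Y ⟶ M) (r : M ⟶ Y),
      IsLoc Y ∧ i ≫ r = 𝟙 Y ∧ f ≫ r ≫ i ≫ g ≠ 0 := by
      intro N' i r hir hri hne
      -- The endomorphisms of a proper summand embed by `a ↦ r a i` in those of `M`, and the
      -- identity of `M` is not reached.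
      have hlt : Module.finrank k (N' ⟶ N') < n := by
        let T : (N' ⟶ N') →ₗ[k] (M ⟶ M) := (Linear.leftComp k M r) ∘ₗ (Linear.rightComp k N' i)
        have hT : ∀ a, T a = r ≫ a ≫ i := fun a => rfl
        have hinj : Function.Injective T := by
          intro a b hab
          have := congrArg (fun t => i ≫ t ≫ r) hab
          simpa [hT, hir, reassoc_of% hir] using this
        have hlt : LinearMap.range T < ⊤ := by
          rw [lt_top_iff_ne_top]
          intro htop
          obtain ⟨a, ha⟩ := LinearMap.range_eq_top.1 htop (𝟙 M)
          rw [hT] at ha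
          have h2 : a = 𝟙 N' := by
            have := congrArg (fun t => i ≫ t ≫ r) ha
            simpa [hir, reassoc_of% hir] using this
          rw [h2, Category.id_comp] at ha
          exact hri ha
        rw [← hn, ← LinearMap.finrank_range_of_inj hinj]
        exact Submodule.finrank_lt hlt.ne
      obtain ⟨Y, i', r', hY, hir', hne'⟩ := ih _ hlt (hM.of_retract i r hir) (f ≫ r) (i ≫ g)
        (by simpa using hne) rfl
      refine ⟨Y, i' ≫ i, r ≫ r', hY, ?_, by simpa using hne'⟩
      rw [Category.assoc, reassoc_of% hir, hir']
    obtain ⟨N₁, N₂, i, r, i', r', h, h', hr, hr'⟩ := exists_split_idempotent e he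
    -- The composite is the sum of its parts through `e` and through `1 - e`, and one of them is
    -- non-zero.
    by_cases h1 : f ≫ e ≫ g = 0
    · refine key N₂ i' r' h' ?_ ?_
      · rw [hr']
        intro h2
        exact he0 (by simpa using h2)
      · rw [reassoc_of% hr']
        simpa [h1] using hfg
    · refine key N₁ i r h ?_ ?_
      · rwa [hr]
      · rwa [reassoc_of% hr]

end RepPlus

/-! ### The indecomposable projectives and their radicals -/

section Projectives

variable {k : Type w} [Field k] {Q : Type u} [Quiver.{v} Q] {M N : Rep.{u, v, w} k Q}

/-- A morphism factors through a monomorphism if this is the case for all elements. -/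
theorem exists_lift_of_mono (f : M ⟶ N) [Mono f] {L : Rep.{u, v, w} k Q} (d : L ⟶ N)
    (h : ∀ x v, ∃ m, ev f x m = ev d x v) : ∃ r : L ⟶ M, r ≫ f = d := by
  refine ⟨Abelian.monoLift f d (rep_hom_ext fun x v => ?_), Abelian.monoLift_comp _ _ _⟩
  obtain ⟨m, hm⟩ := h x v
  rw [ev_comp, ← hm, ← ev_comp, Limits.cokernel.condition]
  rfl

/-- The representation `P_x`, as a free representation with one generator. -/
noncomputable abbrev Pr (k : Type w) [Field k] (x : Q) : Rep.{u, v, w} k Q :=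
  Fr k (fun _ : PUnit.{max u v w + 1} => x)

/-- The generator of `P_x`. -/
noncomputable def prGen (k : Type w) [Field k] (x : Q) : sp (Pr.{u, v, w} k x) x :=
  frGen k (fun _ : PUnit.{max u v w + 1} => x) PUnit.unit

/-- The morphism from `P_x` given by the image of the generator. -/
noncomputable def prHom {x : Q} (m : sp M x) : Pr k x ⟶ M := frHom fun _ => m

@[simp]
theorem ev_prHom_gen {x : Q} (m : sp M x) : ev (prHom m) x (prGen k x) = m :=
  ev_frHom_gen (b := fun _ : PUnit.{max u v w + 1} => x) (fun _ => m) PUnit.unit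

theorem prHom_ext {x : Q} {f g : Pr k x ⟶ M} (h : ev f x (prGen k x) = ev g x (prGen k x)) :
    f = g := frHom_ext fun _ => h

theorem ev_prHom_pm {x y : Q} (m : sp M x) (p : Quiver.Path x y) :
    ev (prHom m) y (pm _ p (prGen k x)) = pm M p m := by
  rw [ev_pm, ev_prHom_gen]

/-- The inclusion of a summand of a free representation. -/
noncomputable def frι {ι : Type (max u v w)} (b : ι → Q) (i : ι) : Pr k (b i) ⟶ Fr k b :=
  prHom (frGen k b i)

open Classical in
/-- The projection to a summand of a free representation. -/
noncomputable def frπ {ι : Type (max u v w)} (b : ι → Q) (i : ι) : Fr k b ⟶ Pr k (b i) :=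
  frHom fun j => if h : i = j then h ▸ prGen k (b i) else 0

theorem frι_frπ {ι : Type (max u v w)} (b : ι → Q) (i : ι) :
    frι (k := k) b i ≫ frπ b i = 𝟙 _ := by
  refine prHom_ext ?_
  rw [ev_comp, frι, ev_prHom_gen, frπ, ev_frHom_gen]
  simp

theorem ev_sum {ι : Type*} (s : Finset ι) (f : ι → (M ⟶ N)) (x : Q) (v : sp M x) :
    ev (∑ i ∈ s, f i) x v = ∑ i ∈ s, ev (f i) x v :=
  map_sum (⟨⟨fun f => ev f x v, fun _ _ => rfl⟩, fun _ _ => rfl⟩ : (M ⟶ N) →ₗ[k] sp N x) f s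

theorem sum_frπ_frι {ι : Type (max u v w)} [Fintype ι] (b : ι → Q) :
    ∑ i, frπ (k := k) b i ≫ frι b i = 𝟙 _ := by
  classical
  refine frHom_ext fun j => ?_
  rw [ev_sum, Finset.sum_eq_single j]
  · rw [ev_comp, frπ, ev_frHom_gen]
    simp [frι]
  · intro i _ hij
    rw [ev_comp, frπ, ev_frHom_gen]
    simp [hij]
  · simp

theorem InRad.sum {C : Type u} [Category.{v} C] [Preadditive C] {X Y : C} {ι : Type w}
    {s : Finset ι} {e : ι → (X ⟶ Y)} (h : ∀ i ∈ s, InRad (e i)) : InRad (∑ i ∈ s, e i) :=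
  (radR X Y).sum_mem h

/-- For the idempotent `s t` of the local object `Z`, either `s t` or `1 - s t` is invertible. In
the second case `t (1 - s t) = 0` gives `t = 0`, which is excluded by `Y ≠ 0`. -/
theorem IsLoc.isIso_of_isSplitMono {C : Type u} [Category.{v} C] [Preadditive C] {Y Z : C}
    (hZ : IsLoc Z) (hY : ¬ Limits.IsZero Y) (t : Y ⟶ Z) (s : Z ⟶ Y) (h : t ≫ s = 𝟙 Y) :
    IsIso t := by
  rcases hZ.2 (s ≫ t) with h1 | h1
  · exact isIso_of_isSplitMono_of_isSplitEpi t (IsSplitMono.mk' ⟨s, h⟩)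
      (IsSplitEpi.mk' ⟨inv (s ≫ t) ≫ s, by rw [Category.assoc, IsIso.inv_hom_id]⟩)
  · have h2 : t ≫ (𝟙 Z - s ≫ t) = 0 := by simp [reassoc_of% h]
    have h3 : t = 0 := by
      rw [← cancel_mono (𝟙 Z - s ≫ t), h2, Limits.zero_comp]
    exact absurd (by rw [Limits.IsZero.iff_id_eq_zero, ← h, h3, Limits.zero_comp]) hY

/-- A local direct summand of a free representation is a direct summand of one of its terms. -/
theorem exists_retract_of_free {Y : Rep.{u, v, w} k Q} (hY : IsLoc Y) {ι : Type (max u v w)}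
    [Finite ι] {b : ι → Q} (t : Y ⟶ Fr k b) (s : Fr k b ⟶ Y) (h : IsIso (t ≫ s)) :
    ∃ i, ∃ s' : Pr k (b i) ⟶ Y, (t ≫ frπ b i) ≫ s' = 𝟙 Y := by
  have := Fintype.ofFinite ι
  by_contra hc
  push Not at hc
  -- If `Y` were a summand of no term, all the composites through the terms would be radical, and so
  -- would be their sum, the isomorphism `t s`.
  have h1 : InRad (∑ i, t ≫ frπ b i ≫ frι b i ≫ s) := InRad.sum fun i _ => by
    by_contra hn
    obtain ⟨a, ha⟩ := (not_inRad_iff' hY).1 hn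
    apply hc i (frι b i ≫ s ≫ a ≫ inv ((t ≫ frπ b i ≫ frι b i ≫ s) ≫ a))
    have := IsIso.hom_inv_id ((t ≫ frπ b i ≫ frι b i ≫ s) ≫ a)
    simp only [Category.assoc] at this ⊢
    exact this
  have h2 : ∑ i, t ≫ frπ b i ≫ frι b i ≫ s = t ≫ s := by
    have h3 := congrArg (fun f => t ≫ f ≫ s) (sum_frπ_frι (k := k) b)
    simpa [Preadditive.comp_sum, Preadditive.sum_comp] using h3
  rw [h2] at h1
  exact h1.not_isSplitMono hY.1 inferInstance

variable [hQ : SLF Q]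

theorem prGen_ne_zero (x : Q) : prGen.{u, v, w} k x ≠ 0 := by
  intro h
  have h1 := congrArg (frC (fun _ : PUnit.{max u v w + 1} => x) x) h
  rw [prGen, frGen, frSingle, LinearEquiv.apply_symm_apply, map_zero] at h1
  exact one_ne_zero (Finsupp.single_eq_zero.1 h1)

theorem exists_eq_smul_prGen {x : Q} (m : sp (Pr.{u, v, w} k x) x) : ∃ c : k, m = c • prGen k x := by
  induction m using fr_induction with
  | zero => exact ⟨0, by simp⟩
  | add a c ha hc =>
    obtain ⟨a, rfl⟩ := ha
    obtain ⟨c, rfl⟩ := hc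
    exact ⟨a + c, by rw [add_smul]⟩
  | smul c i q =>
    refine ⟨c, ?_⟩
    rw [path_eq_nil q]
    rfl

/-- The only path from `x` to `x` is trivial, so the generator can only be sent to a multiple of
itself. -/
theorem isBrick_Pr (x : Q) : IsBrick k (Pr.{u, v, w} k x) := by
  refine ⟨fun h => ?_, fun u => ?_⟩
  · have := (isZero_iff_sp.1 h) x
    exact prGen_ne_zero (k := k) x (Subsingleton.elim _ _)
  · obtain ⟨c, hc⟩ := exists_eq_smul_prGen (ev u x (prGen k x))
    exact ⟨c, prHom_ext (by rw [hc]; rfl)⟩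

theorem isLoc_Pr (x : Q) : IsLoc (Pr.{u, v, w} k x) := (isBrick_Pr x).isLoc

theorem exists_path_of_hom_Pr {x y : Q} {f : Pr k x ⟶ Pr.{u, v, w} k y} (h : f ≠ 0) :
    Nonempty (Quiver.Path y x) := by
  by_contra hc
  have h1 : ¬ Nontrivial (sp (Pr.{u, v, w} k y) x) := fun h2 => by
    obtain ⟨_, p⟩ := exists_path_of_nontrivial h2
    exact hc p
  rw [not_nontrivial_iff_subsingleton] at h1
  exact h (prHom_ext (Subsingleton.elim _ _))

theorem eq_of_path_of_path {x y : Q} (p : Quiver.Path x y) (q : Quiver.Path y x) : x = y := by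
  have h := path_length_eq_zero (p.comp q)
  rw [Quiver.Path.length_comp] at h
  exact Quiver.Path.eq_of_length_zero p (by omega)

theorem eq_of_iso_Pr {x y : Q} (e : Pr.{u, v, w} k x ≅ Pr.{u, v, w} k y) : x = y := by
  have h1 : e.hom ≠ 0 := fun h => (isBrick_Pr (k := k) x).1 (by
    rw [Limits.IsZero.iff_id_eq_zero, ← e.hom_inv_id, h, Limits.zero_comp])
  have h2 : e.inv ≠ 0 := fun h => (isBrick_Pr (k := k) y).1 (by
    rw [Limits.IsZero.iff_id_eq_zero, ← e.inv_hom_id, h, Limits.zero_comp])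
  obtain ⟨p⟩ := exists_path_of_hom_Pr h1
  obtain ⟨q⟩ := exists_path_of_hom_Pr h2
  exact eq_of_path_of_path q p

/-- A local direct summand of a free representation is some `P_x`. -/
theorem exists_iso_of_retract_free {Y : Rep.{u, v, w} k Q} (hY : IsLoc Y) {ι : Type (max u v w)}
    [Finite ι] {b : ι → Q} (t : Y ⟶ Fr k b) (s : Fr k b ⟶ Y) (h : IsIso (t ≫ s)) :
    ∃ i, Nonempty (Y ≅ Pr k (b i)) := by
  obtain ⟨i, s', h1⟩ := exists_retract_of_free hY t s h
  have := (isLoc_Pr (k := k) (b i)).isIso_of_isSplitMono hY.1 _ s' h1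
  exact ⟨i, ⟨asIso (t ≫ frπ b i)⟩⟩

/-- A local finitely presented representation with a non-zero morphism to a representation whose
arrows act jointly injectively is some `P_x`. -/
theorem exists_iso_Pr_of_hom {Y N : Rep.{u, v, w} k Q} (hY : IsLoc Y) (hf : IsFP Y)
    (hN : IsStar N) {f : Y ⟶ N} (h : f ≠ 0) : ∃ x, Nonempty (Y ≅ Pr k x) := by
  let p := Abelian.factorThruImage f
  let i := Abelian.image.ι f
  have hpi : p ≫ i = f := Abelian.image.fac f
  have hp : Epi p := inferInstance
  have hI : IsStar (Abelian.image f) := hN.of_mono i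
  have hp' := (epi_iff_ev p).1 hp
  -- The joint maps of the image are injective since it is a subrepresentation of `N`, and onto
  -- wherever those of `Y` are. So the image is free, `Y` maps onto it by a retraction, and `Y`,
  -- being local, is isomorphic to it.
  have hI' : IsFP (Abelian.image f) := by
    refine ⟨fun x => ?_, ?_, hf.bij.subset fun z hz hb => hz ⟨hI z, ?_⟩⟩
    · have := hf.fin x
      exact Module.Finite.of_surjective _ (hp' x)
    · obtain ⟨s, hs, h⟩ := hf.supp
      exact ⟨s, hs, fun x hx => h x (hp' x).nontrivial⟩
    · exact jm_surjective_of_epi p hb.2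
  obtain ⟨ι, _, b, q, -, hq⟩ := hI'.exists_cover
  have hq := hq hI
  let j : Abelian.image f ⟶ Y := inv q ≫ Projective.factorThru q p
  have hj : j ≫ p = 𝟙 _ := by
    simp only [j, Category.assoc, Projective.factorThru_comp, IsIso.inv_hom_id]
  have h0 : ¬ Limits.IsZero (Abelian.image f) := fun h0 => h (by
    rw [← hpi, h0.eq_zero_of_tgt p, Limits.zero_comp])
  have hj' : IsIso j := hY.isIso_of_isSplitMono h0 j p hj
  obtain ⟨i, e⟩ := exists_iso_of_retract_free hY (inv j ≫ inv q) (q ≫ j) (by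
    simp only [Category.assoc, IsIso.inv_hom_id_assoc, IsIso.inv_hom_id]; infer_instance)
  exact ⟨_, e⟩

/-! #### The radical of `P_x` -/

/-- The starting vertices of the summands of the radical of `P_x`. -/
def outEnd (x : Q) (α : ULift.{max u v w} (Σ y : Q, (x ⟶ y))) : Q := α.down.1

/-- The inclusion of the radical of `P_x`. -/
noncomputable def radIncl (k : Type w) [Field k] (x : Q) :
    Fr.{u, v, w} k (outEnd.{u, v, w} x) ⟶ Pr k x :=
  frHom fun α => pm _ α.down.2.toPath (prGen k x)

theorem ev_radIncl {x z : Q} (i : ULift.{max u v w} (Σ y : Q, (x ⟶ y)))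
    (q : Quiver.Path (outEnd.{u, v, w} x i) z) : ev (radIncl k x) z (frSingle k (outEnd x) i q) =
      frSingle k (fun _ : PUnit.{max u v w + 1} => x) PUnit.unit (i.down.2.toPath.comp q) := by
  refine (ev_frHom_frSingle (b := outEnd x) _ i q).trans ?_
  rw [← pm_frGen]
  exact (pm_comp _ _ _).symm

theorem toPath_comp_inj {x y y' z : Q} (α : x ⟶ y) (α' : x ⟶ y') (p : Quiver.Path y z)
    (p' : Quiver.Path y' z) (h : α.toPath.comp p = α'.toPath.comp p') :
    (⟨⟨y, α⟩, p⟩ : Σ β : Σ y : Q, (x ⟶ y), Quiver.Path β.1 z) = ⟨⟨y', α'⟩, p'⟩ := by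
  induction p with
  | nil =>
    cases p' with
    | nil => cases h; rfl
    | cons p' β =>
      have := congrArg Quiver.Path.length h
      simp at this
  | cons p β ih =>
    cases p' with
    | nil =>
      have := congrArg Quiver.Path.length h
      simp at this
    | cons p' β' =>
      rw [Quiver.Path.comp_cons, Quiver.Path.comp_cons, Quiver.Path.cons.injEq] at h
      obtain ⟨rfl, h3, h4⟩ := h
      have h5 := ih p' (eq_of_heq h3)
      cases eq_of_heq h4
      cases h5
      rfl

/-- On the bases of paths the inclusion sends the pair of an arrow `α` and a path `p` to `α p`, and
a path of positive length determines its first arrow. -/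
instance mono_radIncl (x : Q) : Mono (radIncl.{u, v, w} k x) := by
  rw [mono_iff_ev]
  intro z
  let t : (Σ i, Quiver.Path (outEnd.{u, v, w} x i) z) →
      (Σ _ : PUnit.{max u v w + 1}, Quiver.Path x z) :=
    fun s => ⟨PUnit.unit, s.1.down.2.toPath.comp s.2⟩
  have ht : Function.Injective t := by
    rintro ⟨⟨⟨y, α⟩⟩, p⟩ ⟨⟨⟨y', α'⟩⟩, p'⟩ h
    simp only [t, Sigma.mk.injEq, heq_eq_eq, true_and] at h
    cases toPath_comp_inj α α' p p' h
    rfl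
  have h : ∀ v, frC _ z (ev (radIncl k x) z v) = Finsupp.mapDomain t (frC _ z v) := by
    intro v
    induction v using fr_induction with
    | zero => simp
    | add a c ha hc => simp only [map_add, ha, hc, Finsupp.mapDomain_add]
    | smul c i q =>
      rw [map_smul, map_smul, map_smul, Finsupp.mapDomain_smul, ev_radIncl,
        frSingle, frSingle, LinearEquiv.apply_symm_apply, LinearEquiv.apply_symm_apply,
        Finsupp.mapDomain_single]
  intro v w hvw
  apply (frC _ z).injective
  apply Finsupp.mapDomain_injective ht
  rw [← h, ← h, hvw]

theorem exists_toPath_comp {x z : Q} (q : Quiver.Path x z) (h : x ≠ z) :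
    ∃ (y : Q) (α : x ⟶ y) (p : Quiver.Path y z), q = α.toPath.comp p := by
  induction q with
  | nil => exact absurd rfl h
  | cons q β ih =>
    rename_i y z
    by_cases hy : x = y
    · subst hy
      rw [path_eq_nil q]
      exact ⟨z, β, Quiver.Path.nil, rfl⟩
    · obtain ⟨y', α, p, rfl⟩ := ih hy
      exact ⟨y', α, p.cons β, rfl⟩

theorem surjective_radIncl {x z : Q} (h : x ≠ z) :
    Function.Surjective (ev (radIncl.{u, v, w} k x) z) := by
  rw [← LinearMap.range_eq_top, eq_top_iff]
  intro v _
  induction v using fr_induction with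
  | zero => exact zero_mem _
  | add a c ha hc => exact add_mem (ha trivial) (hc trivial)
  | smul c i q =>
    refine Submodule.smul_mem _ _ ?_
    obtain ⟨y, α, p, rfl⟩ := exists_toPath_comp q h
    exact ⟨frSingle k (outEnd x) ⟨⟨y, α⟩⟩ p, ev_radIncl _ _⟩

theorem subsingleton_radIncl (x : Q) :
    Subsingleton (sp (Fr.{u, v, w} k (outEnd.{u, v, w} x)) x) := by
  rw [← not_nontrivial_iff_subsingleton]
  intro h
  obtain ⟨⟨⟨y, α⟩⟩, ⟨p⟩⟩ := exists_path_of_nontrivial h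
  exact (isEmpty_hom_of_path p).false α

/-- A morphism to `P_x` which hits the generator up to a scalar splits. Any other one is zero at
`x`, the only vertex where the radical differs from `P_x`. -/
theorem isRightAlmostSplit_radIncl (x : Q) : IsRightAlmostSplit (radIncl.{u, v, w} k x) := by
  have hs := subsingleton_radIncl.{u, v, w} (k := k) x
  constructor
  · intro h
    obtain ⟨v, hv⟩ := (epi_iff_ev _).1 (inferInstance : Epi (radIncl.{u, v, w} k x)) x (prGen k x)
    rw [Subsingleton.elim v 0, map_zero] at hv
    exact prGen_ne_zero x hv.symm
  · intro Z g hg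
    have h0 : ∀ v, ev g x v = 0 := by
      intro v
      obtain ⟨c, hc⟩ := exists_eq_smul_prGen (ev g x v)
      by_cases h : c = 0
      · rw [hc, h, zero_smul]
      · exfalso
        apply hg
        refine IsSplitEpi.mk' ⟨prHom (c⁻¹ • v), prHom_ext ?_⟩
        rw [ev_comp, ev_prHom_gen, map_smul, hc, smul_smul, inv_mul_cancel₀ h, one_smul]
        rfl
    refine exists_lift_of_mono _ _ fun z v => ?_
    by_cases h : x = z
    · subst h
      exact ⟨0, by rw [h0, map_zero]⟩
    · exact surjective_radIncl h _

instance finite_outIndex (x : Q) : Finite (ULift.{max u v w} (Σ y : Q, (x ⟶ y))) := inferInstance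

theorem frι_frπ_of_ne {ι : Type (max u v w)} (b : ι → Q) {i j : ι} (h : i ≠ j) :
    frι (k := k) b i ≫ frπ b j = 0 := by
  refine prHom_ext ?_
  rw [ev_comp, frι, ev_prHom_gen, frπ, ev_frHom_gen, dif_neg h.symm]
  rfl

/-- The morphisms from `P_y` to the radical of `P_x` modulo radical morphisms. -/
theorem finrank_radIncl (x y : Q) : Module.finrank k ((Pr k y ⟶ Fr.{u, v, w} k (outEnd.{u, v, w} x))
    ⧸ radK k (Pr k y) (Fr.{u, v, w} k (outEnd.{u, v, w} x))) = Nat.card (x ⟶ y) := by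
  classical
  have := Fintype.ofFinite (x ⟶ y)
  let b := outEnd.{u, v, w} x
  let i : (x ⟶ y) → ULift.{max u v w} (Σ y : Q, (x ⟶ y)) := fun α => ⟨⟨y, α⟩⟩
  have hi : Function.Injective i := fun α α' h => by simpa [i] using h
  let ε : (Pr.{u, v, w} k y ⟶ Pr k y) →ₗ[k] k :=
    { toFun := fun f => frC _ y (ev f y (prGen k y)) ⟨PUnit.unit, Quiver.Path.nil⟩
      map_add' := fun t t' => by simp
      map_smul' := fun c t => by simp }
  have hε : ε (𝟙 _) = 1 := by
    change frC _ y (ev (𝟙 (Pr k y)) y (prGen k y)) _ = 1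
    rw [ev_id, prGen, frGen, frSingle, LinearEquiv.apply_symm_apply, Finsupp.single_eq_same]
  have hε0 : ∀ f, ε f = 0 → f = 0 := by
    intro f hf
    obtain ⟨c, rfl⟩ := (isBrick_Pr y).2 f
    rw [map_smul, hε, smul_eq_mul, mul_one] at hf
    rw [hf, zero_smul]
  let ι' : (x ⟶ y) → (Pr k y ⟶ Fr k b) := fun α => frι b (i α)
  let π' : (x ⟶ y) → (Fr k b ⟶ Pr k y) := fun α => frπ b (i α)
  have h1 : ∀ α, ι' α ≫ π' α = 𝟙 _ := fun α => frι_frπ b (i α)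
  have h2 : ∀ α β, α ≠ β → ι' α ≫ π' β = 0 := fun α β h => frι_frπ_of_ne b fun h' => h (hi h')
  -- The coordinates are the scalar components to the summands `P_y`, one for each arrow from `x` to
  -- `y`. A morphism is radical exactly if these vanish, since `P_y` is not isomorphic to the other
  -- summands.
  let Φ : (Pr k y ⟶ Fr k b) →ₗ[k] ((x ⟶ y) → k) :=
    LinearMap.pi fun α => ε ∘ₗ Linear.rightComp k (Pr k y) (π' α)
  have hΦ' : ∀ t α, Φ t α = ε (t ≫ π' α) := fun _ _ => rfl
  have hΦ : Function.Surjective Φ := by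
    intro c
    refine ⟨∑ α, c α • ι' α, ?_⟩
    funext β
    rw [hΦ', Preadditive.sum_comp, map_sum, Finset.sum_eq_single β]
    · rw [Linear.smul_comp, h1, map_smul, hε, smul_eq_mul, mul_one]
    · intro α _ hα
      rw [Linear.smul_comp, h2 α β hα, smul_zero, map_zero]
    · simp
  have hk : LinearMap.ker Φ = radK k (Pr k y) (Fr k b) := by
    ext t
    rw [LinearMap.mem_ker]
    change _ ↔ InRad t
    constructor
    · intro ht
      by_contra hn
      obtain ⟨r, hr⟩ := (not_inRad_iff' (isLoc_Pr y)).1 hn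
      obtain ⟨⟨⟨y', α⟩⟩, s', hs'⟩ := exists_retract_of_free (isLoc_Pr y) t r hr
      have h1 := (isLoc_Pr (k := k) y').isIso_of_isSplitMono (isLoc_Pr y).1 _ s' hs'
      have h2 : y = y' := eq_of_iso_Pr (k := k) (@asIso _ _ _ _ _ h1 : Pr k y ≅ Pr k y')
      subst h2
      have h3 : t ≫ π' α = 0 := hε0 _ (congrFun ht α)
      apply (isLoc_Pr (k := k) y).1
      rw [Limits.IsZero.iff_id_eq_zero, ← hs']
      exact (congrArg (· ≫ s') h3).trans Limits.zero_comp
    · intro ht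
      funext α
      rw [hΦ']
      rw [((isBrick_Pr (k := k) y).inRad_iff _).1 (ht.comp_right (π' α)), map_zero]
      rfl
  change Module.finrank k ((Pr k y ⟶ Fr k b) ⧸ radK k (Pr k y) (Fr k b)) = _
  rw [← hk, (LinearMap.quotKerEquivOfSurjective Φ hΦ).finrank_eq, Module.finrank_pi,
    Nat.card_eq_fintype_card]

/-- `P_x` as an object of `rep⁺(Q)`. -/
noncomputable def prObj (k : Type w) [Field k] (x : Q) : RepPlus.{u, v, w} k Q :=
  fpObj (isFP_Fr (k := k) (fun _ : PUnit.{max u v w + 1} => x))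

/-- The radical of `P_x` as an object of `rep⁺(Q)`. -/
noncomputable def radObj (k : Type w) [Field k] (x : Q) : RepPlus.{u, v, w} k Q :=
  fpObj (isFP_Fr (k := k) (outEnd.{u, v, w} x))

/-- The inclusion of the radical of `P_x` in `rep⁺(Q)`. -/
noncomputable def radInclObj (k : Type w) [Field k] (x : Q) : radObj.{u, v, w} k x ⟶ prObj k x :=
  ObjectProperty.homMk (radIncl k x)

theorem isRightAlmostSplit_radInclObj (x : Q) :
    IsRightAlmostSplit (radInclObj.{u, v, w} k x) := by
  have h := isRightAlmostSplit_radIncl.{u, v, w} (k := k) x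
  refine ⟨fun hs => h.1 ((isSplitEpi_hom_iff _).2 hs), fun Z g hg => ?_⟩
  obtain ⟨r, hr⟩ := h.2 _ g.hom fun hs => hg ((isSplitEpi_hom_iff _).1 hs)
  exact ⟨ObjectProperty.homMk r, ObjectProperty.hom_ext _ hr⟩

theorem isLoc_prObj (x : Q) : IsLoc (prObj.{u, v, w} k x) := isLoc_obj_iff.1 (isLoc_Pr x)

theorem isBrick_prObj (x : Q) : IsBrick k (prObj.{u, v, w} k x) := isBrick_obj_iff.1 (isBrick_Pr x)

/-- The inclusion is a monomorphism, so the zero endomorphism serves as the radical weak kernel that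
is required for computing `irr(Y, P_x)`; no almost split sequence ends in `P_x`. -/
theorem radInclObj_kernel (x : Q) (W : RepPlus.{u, v, w} k Q) (h : W ⟶ radObj k x)
    (hh : h ≫ radInclObj k x = 0) :
    ∃ l, l ≫ (0 : radObj.{u, v, w} k x ⟶ radObj k x) = h := by
  have h1 : h.hom ≫ radIncl k x = 0 := congrArg (fun f => f.hom) hh
  refine ⟨0, ObjectProperty.hom_ext _ ?_⟩
  have h2 : h.hom = (0 : W.obj ⟶ Fr k (outEnd.{u, v, w} x)) :=
    (cancel_mono (radIncl k x)).1 (h1.trans Limits.zero_comp.symm)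
  exact Limits.zero_comp.trans h2.symm

/-- The irreducible morphisms to `P_x` start in the `P_y` with an arrow `x ⟶ y`. -/
theorem IrrNZ.exists_iso_prObj {x : Q} {Y : RepPlus.{u, v, w} k Q} (hY : IsLoc Y)
    (h : IrrNZ Y (prObj k x)) : ∃ y, Nonempty (x ⟶ y) ∧ Nonempty (Y ≅ prObj k y) := by
  obtain ⟨t, ht⟩ := (irrNZ_right_iff (isRightAlmostSplit_radInclObj x) (isLoc_prObj x)
    (InRad.zero _ _) (radInclObj_kernel x)).1 h
  obtain ⟨s, hs⟩ := (not_inRad_iff' hY).1 ht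
  obtain ⟨⟨⟨y, α⟩⟩, e⟩ := exists_iso_of_retract_free (isLoc_obj_iff.2 hY) t.hom s.hom
    ((isIso_hom_iff (t ≫ s)).2 hs)
  exact ⟨y, ⟨α⟩, nonempty_iso_obj_iff.1 e⟩

theorem irrK_prObj (x y : Q) : irrK k (prObj.{u, v, w} k y) (prObj k x) = Nat.card (x ⟶ y) := by
  rw [irrK_eq_right k (isRightAlmostSplit_radInclObj x) (isLoc_prObj x)
    (InRad.zero _ _) (radInclObj_kernel x), ← finrank_radIncl (k := k)]
  let T : (prObj.{u, v, w} k y ⟶ radObj k x) ≃ₗ[k] (Pr k y ⟶ Fr k (outEnd.{u, v, w} x)) :=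
    { toFun := fun f => f.hom, invFun := fun f => ObjectProperty.homMk f, map_add' := fun _ _ => rfl,
      map_smul' := fun _ _ => rfl, left_inv := fun _ => rfl, right_inv := fun _ => rfl }
  refine (Submodule.Quotient.equiv _ _ T ?_).finrank_eq
  ext f
  rw [Submodule.mem_map]
  constructor
  · rintro ⟨g, hg, rfl⟩
    exact (inRad_hom_iff g).2 hg
  · intro hf
    exact ⟨ObjectProperty.homMk f, (inRad_hom_iff _).1 hf, rfl⟩

end Projectives

/-! ### The inverse translate of a finite dimensional representation -/

section Transpose

variable {k : Type w} [Field k] {Q : Type u} [Quiver.{v} Q]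

/-- Finite dimensional representations. -/
class IsFD (M : Rep.{u, v, w} k Q) : Prop where
  fin : ∀ x, Module.Finite k (sp M x)
  supp : {x | Nontrivial (sp M x)}.Finite

instance moduleFinite_sp (M : Rep.{u, v, w} k Q) [h : IsFD M] (x : Q) : Module.Finite k (sp M x) :=
  h.fin x

/-- The indices of a basis of a representation. -/
abbrev BIdx (M : Rep.{u, v, w} k Q) : Type (max u v w) :=
  Σ x, Module.Basis.ofVectorSpaceIndex k (sp M x)

/-- A basis of a space of a representation. -/
noncomputable abbrev bv (M : Rep.{u, v, w} k Q) (x : Q) :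
    Module.Basis (Module.Basis.ofVectorSpaceIndex k (sp M x)) k (sp M x) :=
  Module.Basis.ofVectorSpace k (sp M x)

/-- The coordinates of a representation. -/
noncomputable abbrev cf (M : Rep.{u, v, w} k Q) (p : BIdx M) : sp M p.1 →ₗ[k] k :=
  (bv M p.1).coord p.2

/-- The vertex of a basis element. -/
abbrev bVertex (M : Rep.{u, v, w} k Q) (p : BIdx M) : Q := p.1

variable (M : Rep.{u, v, w} k Q)

theorem cf_apply (p : BIdx M) (m : sp M p.1) : cf M p m = (bv M p.1).repr m p.2 :=
  Module.Basis.coord_apply _ _ _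

instance finite_ofVectorSpaceIndex [IsFD M] (x : Q) :
    Finite (Module.Basis.ofVectorSpaceIndex k (sp M x)) :=
  Module.Finite.finite_basis (bv M x)

noncomputable instance fintype_ofVectorSpaceIndex [IsFD M] (x : Q) :
    Fintype (Module.Basis.ofVectorSpaceIndex k (sp M x)) := Fintype.ofFinite _

instance finite_BIdx [h : IsFD M] : Finite (BIdx M) := by
  have : Finite {x | Nontrivial (sp M x)} := h.supp
  refine Finite.of_injective (β := Σ x : {x | Nontrivial (sp M x)},
    Module.Basis.ofVectorSpaceIndex k (sp M x.1))
    (fun p => ⟨⟨p.1, ⟨bv M p.1 p.2, 0, (bv M p.1).ne_zero p.2⟩⟩, p.2⟩) ?_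
  rintro ⟨x, i⟩ ⟨y, j⟩ hij
  simp only [Sigma.mk.injEq, Subtype.mk.injEq] at hij
  obtain ⟨rfl, hij⟩ := hij
  rw [eq_of_heq hij]

noncomputable instance fintype_BIdx [h : IsFD M] : Fintype (BIdx M) := Fintype.ofFinite _

/-- The indices of the summands of the middle term of the presentation of the inverse translate. -/
abbrev AIdx : Type (max u v w) := Σ q : BIdx M, Σ x : Q, (x ⟶ q.1)

/-- The vertex of an index. -/
abbrev aVertex (s : AIdx M) : Q := s.2.1

variable [hQ : SLF Q]

noncomputable instance fintype_hom (x y : Q) : Fintype (x ⟶ y) := Fintype.ofFinite _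

variable [hM : IsFD M]

/-- The matrix entries of the arrows. -/
noncomputable def ac (p q : BIdx M) (α : p.1 ⟶ q.1) : k := cf M q (ar M α (bv M p.1 p.2))

/-- The images of the generators under `trMap`. -/
noncomputable def trGen (p : BIdx M) : sp (Fr k (aVertex M)) p.1 :=
  (∑ q : BIdx M, ∑ α : p.1 ⟶ q.1, ac M p q α • frGen k (aVertex M) ⟨q, p.1, α⟩) -
    ∑ β : Σ x : Q, (x ⟶ p.1), ar _ β.2 (frGen k (aVertex M) ⟨p, β⟩)

/-- The first map of the presentation of the inverse translate. -/
noncomputable def trMap : Fr k (bVertex M) ⟶ Fr k (aVertex M) := frHom (trGen M)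

variable {M} in
theorem ev_comp_trMap {Z : Rep.{u, v, w} k Q} (d : Fr k (aVertex M) ⟶ Z) (p : BIdx M) :
    ev (trMap M ≫ d) p.1 (frGen k (bVertex M) p) =
      (∑ q : BIdx M, ∑ α : p.1 ⟶ q.1, ac M p q α • ev d p.1 (frGen k (aVertex M) ⟨q, p.1, α⟩)) -
    ∑ β : Σ x : Q, (x ⟶ p.1), ar Z β.2 (ev d β.1 (frGen k (aVertex M) ⟨p, β⟩)) := by
  rw [ev_comp, trMap]
  have : ev (frHom (trGen M)) p.1 (frGen k (bVertex M) p) = trGen M p := ev_frHom_gen _ p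
  rw [this, trGen, map_sub, map_sum, map_sum]
  congr 1
  · refine Finset.sum_congr rfl fun q _ => ?_
    rw [map_sum]
    exact Finset.sum_congr rfl fun α _ => map_smul _ _ _
  · exact Finset.sum_congr rfl fun α _ => ev_ar _ _ _

variable {M} in
/-- Exchanging the order of summation. -/
theorem sum_comp_trMap {Z : Rep.{u, v, w} k Q} (l : ∀ p : BIdx M, sp Z p.1 →ₗ[k] k)
    (d : Fr k (aVertex M) ⟶ Z) :
    ∑ p : BIdx M, l p (ev (trMap M ≫ d) p.1 (frGen k (bVertex M) p)) =
      ∑ q : BIdx M, ∑ β : Σ x : Q, (x ⟶ q.1),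
        ((∑ i, ac M ⟨β.1, i⟩ q β.2 * l ⟨β.1, i⟩ (ev d β.1 (frGen k (aVertex M) ⟨q, β⟩)))
          - l q (ar Z β.2 (ev d β.1 (frGen k (aVertex M) ⟨q, β⟩)))) := by
  simp only [ev_comp_trMap, map_sub, map_sum, Finset.sum_sub_distrib, map_smul]
  congr 1
  rw [Finset.sum_comm]
  refine Finset.sum_congr rfl fun q _ => ?_
  rw [Finset.sum_sigma', Finset.sum_sigma']
  refine Finset.sum_bij' (fun s _ => ⟨⟨s.1.1, s.2⟩, s.1.2⟩) (fun s _ => ⟨⟨s.1.1, s.2⟩, s.1.2⟩)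
    ?_ ?_ ?_ ?_ ?_
  all_goals simp

/-- The inverse translate of a finite dimensional representation. -/
noncomputable def TrD : Rep.{u, v, w} k Q := Limits.cokernel (trMap M)

noncomputable instance fintype_path (x y : Q) : Fintype (Quiver.Path x y) := Fintype.ofFinite _

open Classical in
-- In coordinates, each basis element of the target combines one coefficient from the matrices of
-- `M` with at most one from prolonging a path by `α`. Read for an element of the kernel, this is
-- the compatibility used in `exists_injRep_hom`.
theorem frC_trMap {z : Q} (v : sp (Fr k (bVertex M)) z) (q : BIdx M) {x : Q} (α : x ⟶ q.1)
    (r : Quiver.Path x z) : frC (aVertex M) z (ev (trMap M) z v) ⟨⟨q, x, α⟩, r⟩ =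
      (∑ i, ac M ⟨x, i⟩ q α * frC (bVertex M) z v ⟨⟨x, i⟩, r⟩) -
      ∑ s : Quiver.Path q.1 z, if α.toPath.comp s = r then frC (bVertex M) z v ⟨q, s⟩ else 0 := by
  induction v using fr_induction with
  | zero => simp
  | add a c ha hc =>
    simp only [map_add, Finsupp.add_apply, ha, hc, mul_add, Finset.sum_add_distrib]
    have h : ∀ (s : Quiver.Path q.1 z) (a c : k), (if α.toPath.comp s = r then a + c else 0) =
        (if α.toPath.comp s = r then a else 0) + if α.toPath.comp s = r then c else 0 := by
      intro s a c
      split_ifs <;> simp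
    simp only [h, Finset.sum_add_distrib]
    abel
  | smul c p s' =>
    simp only [map_smul, Finsupp.smul_apply, smul_eq_mul]
    have h1 : frC (bVertex M) z (frSingle k (bVertex M) p s') = Finsupp.single ⟨p, s'⟩ 1 := by
      rw [frSingle, LinearEquiv.apply_symm_apply]
    have h2 : ev (trMap M) z (frSingle k (bVertex M) p s') = pm _ s' (trGen M p) :=
      ev_frHom_frSingle _ p s'
    have h3 : frC (aVertex M) z (pm _ s' (trGen M p)) =
        (∑ q : BIdx M, ∑ α : p.1 ⟶ q.1, ac M p q α • Finsupp.single ⟨⟨q, p.1, α⟩, s'⟩ (1 : k)) -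
        ∑ β : Σ x : Q, (x ⟶ p.1), Finsupp.single ⟨⟨p, β⟩, β.2.toPath.comp s'⟩ (1 : k) := by
      have h4 : ∀ (i : AIdx M) (t : Quiver.Path (aVertex M i) z),
          frC (aVertex M) z (pm _ t (frGen k (aVertex M) i)) = Finsupp.single ⟨i, t⟩ 1 := by
        intro i t
        rw [pm_frGen, frSingle, LinearEquiv.apply_symm_apply]
      rw [trGen, map_sub, map_sub, map_sum, map_sum, map_sum, map_sum]
      congr 1
      · refine Finset.sum_congr rfl fun q _ => ?_
        rw [map_sum, map_sum]
        refine Finset.sum_congr rfl fun α _ => ?_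
        rw [map_smul, map_smul]
        exact congrArg (ac M p q α • ·) (h4 ⟨q, p.1, α⟩ s')
      · refine Finset.sum_congr rfl fun β _ => ?_
        exact (congrArg _ (pm_comp β.2.toPath s' _).symm).trans (h4 ⟨p, β⟩ _)
    have e1 : (∑ q' : BIdx M, ∑ α' : p.1 ⟶ q'.1,
        ac M p q' α' * (Finsupp.single (⟨⟨q', p.1, α'⟩, s'⟩ : Σ i, Quiver.Path (aVertex M i) z)
          (1 : k)) ⟨⟨q, x, α⟩, r⟩) =
        ∑ i, ac M ⟨x, i⟩ q α * (Finsupp.single (⟨p, s'⟩ : Σ i, Quiver.Path (bVertex M i) z)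
          (1 : k)) ⟨⟨x, i⟩, r⟩ := by
      -- Starting vertex and path are compared together, which avoids transporting paths along
      -- equalities of vertices.
      by_cases h : (⟨p.1, s'⟩ : Σ x : Q, Quiver.Path x z) = ⟨x, r⟩
      · obtain ⟨p1, p2⟩ := p
        cases h
        rw [Finset.sum_eq_single q, Finset.sum_eq_single α, Finset.sum_eq_single p2]
        · simp
        · intro i _ hi
          rw [Finsupp.single_eq_of_ne, mul_zero]
          intro h
          apply hi
          simpa using h
        · simp
        · intro α' _ hα
          rw [Finsupp.single_eq_of_ne, mul_zero]
          intro h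
          apply hα
          simpa using h.symm
        · simp
        · intro q' _ hq
          refine Finset.sum_eq_zero fun α' _ => ?_
          rw [Finsupp.single_eq_of_ne, mul_zero]
          intro h
          apply hq
          exact (congrArg (fun t : Σ i, Quiver.Path (aVertex M i) z => t.1.1) h).symm
        · simp
      · rw [Finset.sum_eq_zero, Finset.sum_eq_zero]
        · intro i _
          rw [Finsupp.single_eq_of_ne, mul_zero]
          intro h'
          exact h (congrArg (fun t : Σ i, Quiver.Path (bVertex M i) z =>
            (⟨t.1.1, t.2⟩ : Σ x : Q, Quiver.Path x z)) h').symm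
        · intro q' _
          refine Finset.sum_eq_zero fun α' _ => ?_
          rw [Finsupp.single_eq_of_ne, mul_zero]
          intro h'
          exact h (congrArg (fun t : Σ i, Quiver.Path (aVertex M i) z =>
            (⟨t.1.2.1, t.2⟩ : Σ x : Q, Quiver.Path x z)) h').symm
    have e2 : (∑ β : Σ x : Q, (x ⟶ p.1), (Finsupp.single (⟨⟨p, β⟩, β.2.toPath.comp s'⟩ :
        Σ i, Quiver.Path (aVertex M i) z) (1 : k)) ⟨⟨q, x, α⟩, r⟩) =
        ∑ s : Quiver.Path q.1 z, if α.toPath.comp s = r then (Finsupp.single (⟨p, s'⟩ :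
          Σ i, Quiver.Path (bVertex M i) z) (1 : k)) ⟨q, s⟩ else 0 := by
      by_cases h : p = q
      · subst h
        rw [Finset.sum_eq_single ⟨x, α⟩, Finset.sum_eq_single s']
        · simp [Finsupp.single_apply]
        · intro s _ hs
          rw [Finsupp.single_eq_of_ne, ite_self]
          intro h
          apply hs
          simpa using h
        · simp
        · intro β _ hβ
          rw [Finsupp.single_eq_of_ne]
          intro h
          apply hβ
          have := congrArg (fun t : Σ i, Quiver.Path (aVertex M i) z => t.1) h
          simpa using this.symm
        · simp
      · rw [Finset.sum_eq_zero, Finset.sum_eq_zero]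
        · intro s _
          rw [Finsupp.single_eq_of_ne, ite_self]
          intro h'
          exact h (congrArg Sigma.fst h').symm
        · intro β _
          rw [Finsupp.single_eq_of_ne]
          intro h'
          exact h (congrArg (fun t : Σ i, Quiver.Path (aVertex M i) z => t.1.1) h').symm
    have r1 : ∀ f : Module.Basis.ofVectorSpaceIndex k (sp M x) → k,
        ∑ i, ac M ⟨x, i⟩ q α * (c * f i) = c * ∑ i, ac M ⟨x, i⟩ q α * f i := fun f => by
      rw [Finset.mul_sum]
      exact Finset.sum_congr rfl fun i _ => mul_left_comm _ _ _
    have r2 : ∀ f : Quiver.Path q.1 z → k, (∑ s, if α.toPath.comp s = r then c * f s else 0) =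
        c * ∑ s, if α.toPath.comp s = r then f s else 0 := fun f => by
      rw [Finset.mul_sum]
      exact Finset.sum_congr rfl fun i _ => by split_ifs <;> simp
    rw [r1, r2, h2, h3, h1, ← e1, ← e2, ← mul_sub]
    simp only [Finsupp.sub_apply, Finsupp.finsetSum_apply, Finsupp.smul_apply, smul_eq_mul]

/-- The presentation of the inverse translate. -/
noncomputable def trPres (h : Mono (trMap M)) : Pres (TrD M) where
  P1 := Fr k (bVertex M)
  P0 := Fr k (aVertex M)
  i := trMap M
  p := Limits.cokernel.π (trMap M)
  w := Limits.cokernel.condition _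
  shortExact := by
    have := h
    have : Epi (Limits.cokernel.π (trMap M)) := inferInstance
    have : Epi (show Fr k (aVertex M) ⟶ TrD M from Limits.cokernel.π (trMap M)) := this
    exact shortExact_of_desc _ fun W d hd =>
      ⟨Limits.cokernel.desc _ d hd, Limits.cokernel.π_desc _ _ _⟩
  proj := projective_Fr

/-- The trace form. -/
noncomputable def trForm (h : Mono (trMap M)) : ((trPres M h).P1 ⟶ M) →ₗ[k] k where
  toFun c := ∑ p : BIdx M, cf M p (ev c p.1 (frGen k (bVertex M) p))
  map_add' c d := by
    simp only [← Finset.sum_add_distrib]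
    exact Finset.sum_congr rfl fun p _ => map_add (cf M p) _ _
  map_smul' a c := by
    simp only [RingHom.id_apply, Finset.smul_sum]
    exact Finset.sum_congr rfl fun p _ => map_smul (cf M p) _ _

variable {M} in
theorem sum_ac_cf (q : BIdx M) (β : Σ x : Q, (x ⟶ q.1)) (m : sp M β.1) :
    ∑ i, ac M ⟨β.1, i⟩ q β.2 * cf M ⟨β.1, i⟩ m = cf M q (ar M β.2 m) := by
  conv_rhs => rw [← (bv M β.1).sum_repr m]
  simp only [map_sum, map_smul]
  refine Finset.sum_congr rfl fun i _ => ?_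
  rw [smul_eq_mul, mul_comm]
  exact congrArg (· * _) (cf_apply M ⟨β.1, i⟩ m)

/-- A functional on `Hom(P₁, Z)` is a family of functionals on the spaces of `Z`, one for each basis
element of `M`, hence a family of linear maps from the spaces of `Z` to those of `M`. It vanishes on
the maps through `trMap M` exactly if this family commutes with the arrows: the second sum of
`trGen` gives the action on `Z`, the first one the action on `M`. -/
theorem isARForm_trForm (h : Mono (trMap M)) : IsARForm (trPres M h) (trForm M h) where
  comp_eq_zero d := by
    refine (sum_comp_trMap (cf M) d).trans (Finset.sum_eq_zero fun q _ =>
      Finset.sum_eq_zero fun β _ => ?_)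
    exact sub_eq_zero.2 (sum_ac_cf q β _)
  exists_repr Z l hl := by
    classical
    let L : (∀ p : BIdx M, sp Z p.1) →ₗ[k] k := l ∘ₗ (frEquiv (bVertex M) Z).symm.toLinearMap
    let lp : ∀ p : BIdx M, sp Z p.1 →ₗ[k] k := fun p => L ∘ₗ LinearMap.single k (fun p : BIdx M => sp Z p.1) p
    have hL : ∀ c : Fr k (bVertex M) ⟶ Z,
        l c = ∑ p : BIdx M, lp p (ev c p.1 (frGen k (bVertex M) p)) := by
      intro c
      have h1 : l c = L (frEquiv (bVertex M) Z c) := by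
        change _ = l ((frEquiv (bVertex M) Z).symm _)
        rw [LinearEquiv.symm_apply_apply]
      rw [h1]
      conv_lhs => rw [← Finset.univ_sum_single (frEquiv (bVertex M) Z c)]
      rw [map_sum]
      rfl
    let φ : ∀ x, sp Z x →ₗ[k] sp M x := fun x =>
      ∑ i, (lp ⟨x, i⟩).smulRight (bv M x i)
    have hφ : ∀ x m, φ x m = ∑ i, lp ⟨x, i⟩ m • bv M x i := fun x m =>
      LinearMap.sum_apply _ _ _
    have hcf : ∀ p m, cf M p (φ p.1 m) = lp p m := fun p m => by
      rw [hφ, cf_apply, Module.Basis.repr_sum_self]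
    -- The vanishing condition is tested on the morphism which is `m` on the generator `(q, β)` and
    -- zero on all others.
    have hG : ∀ (q : BIdx M) (β : Σ x : Q, (x ⟶ q.1)) (m : sp Z β.1),
        (∑ i, ac M ⟨β.1, i⟩ q β.2 * lp ⟨β.1, i⟩ m) - lp q (ar Z β.2 m) = 0 := by
      intro q β m
      obtain ⟨δ, hδ⟩ : ∃ δ : ∀ s : AIdx M, sp Z (aVertex M s), δ = Pi.single ⟨q, β⟩ m := ⟨_, rfl⟩
      have hev : ∀ q' β', ev (frHom δ) β'.1 (frGen k (aVertex M) ⟨q', β'⟩) = δ ⟨q', β'⟩ :=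
        fun _ _ => ev_frHom_gen (b := aVertex M) _ _
      have h2 := (sum_comp_trMap lp _).symm.trans ((hL _).symm.trans (hl (frHom δ)))
      simp only [hev] at h2
      rw [Finset.sum_eq_single q, Finset.sum_eq_single β] at h2
      · rw [hδ, Pi.single_eq_same] at h2
        exact h2
      · intro β' _ hβ
        rw [hδ, Pi.single_eq_of_ne (by simpa using hβ)]
        simp
      · simp
      · intro q' _ hq
        refine Finset.sum_eq_zero fun β' _ => ?_
        rw [hδ, Pi.single_eq_of_ne (fun h => hq (congrArg Sigma.fst h))]
        simp
      · simp
    refine ⟨mkHom φ fun {x y} α m => ?_, fun c => ?_⟩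
    · apply (bv M y).ext_elem
      intro j
      have h3 := hG ⟨y, j⟩ ⟨x, α⟩ m
      rw [sub_eq_zero] at h3
      have h4 : (bv M y).repr (φ y (ar Z α m)) j = lp ⟨y, j⟩ (ar Z α m) :=
        (cf_apply M ⟨y, j⟩ _).symm.trans (hcf ⟨y, j⟩ _)
      rw [h4, ← h3, hφ, map_sum, map_sum, Finsupp.finsetSum_apply]
      refine Finset.sum_congr rfl fun i _ => ?_
      rw [map_smul, map_smul, Finsupp.smul_apply, smul_eq_mul, mul_comm]
      rfl
    · exact (hL c).trans (Finset.sum_congr rfl fun p _ => (hcf p _).symm)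
  eq_zero Z φ hφ := by
    classical
    refine rep_hom_ext fun x m => ?_
    apply (bv M x).ext_elem
    intro i
    have h1 := hφ (frHom (Pi.single (M := fun s : BIdx M => sp Z s.1) ⟨x, i⟩ m))
    have h2 : ∑ p : BIdx M, cf M p (ev φ p.1 (Pi.single (M := fun s : BIdx M => sp Z s.1)
        ⟨x, i⟩ m p)) = 0 := by
      refine Eq.trans (Finset.sum_congr rfl fun p _ => ?_) h1
      exact congrArg (fun t => cf M p (ev φ p.1 t)) (ev_frHom_gen (b := bVertex M) _ p).symm
    rw [Finset.sum_eq_single ⟨x, i⟩, Pi.single_eq_same] at h2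
    · rw [ev_zero, map_zero]
      exact h2
    · intro p _ hp
      rw [Pi.single_eq_of_ne hp, map_zero, map_zero]
    · simp

end Transpose

/-! ### The translate `z ↦ D Ext¹(Y, P_z)` -/

section Translate

variable {k : Type w} [Field k] {Q : Type u} [Quiver.{v} Q]

/-- The spaces of the translate. -/
def ddSub {F₁ F₀ : Rep.{u, v, w} k Q} (i : F₁ ⟶ F₀) (z : Q) :
    Submodule k (Module.Dual k (F₁ ⟶ Pr k z)) where
  carrier := {l | ∀ d : F₀ ⟶ Pr k z, l (i ≫ d) = 0}
  add_mem' ha hb d := by rw [LinearMap.add_apply, ha d, hb d, add_zero]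
  zero_mem' d := rfl
  smul_mem' c l hl d := by rw [LinearMap.smul_apply, hl d, smul_zero]

/-- The morphism `P_y ⟶ P_x` given by an arrow `x ⟶ y`. -/
noncomputable def prArrow (k : Type w) [Field k] {x y : Q} (α : x ⟶ y) :
    Pr.{u, v, w} k y ⟶ Pr k x := prHom (ar _ α (prGen k x))

theorem prArrow_prHom {M : Rep.{u, v, w} k Q} {x y : Q} (α : x ⟶ y) (m : sp M x) :
    prArrow k α ≫ prHom m = prHom (ar M α m) := by
  refine prHom_ext ?_
  rw [ev_comp, prArrow, ev_prHom_gen, ev_prHom_gen, ev_ar, ev_prHom_gen]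

/-- The spaces of the translate, as types. -/
def DDSp {F₁ F₀ : Rep.{u, v, w} k Q} (i : F₁ ⟶ F₀) (z : Q) : Type (max u v w) := ddSub i z

noncomputable instance {F₁ F₀ : Rep.{u, v, w} k Q} (i : F₁ ⟶ F₀) (z : Q) :
    AddCommGroup (DDSp i z) := inferInstanceAs (AddCommGroup (ddSub i z))

noncomputable instance {F₁ F₀ : Rep.{u, v, w} k Q} (i : F₁ ⟶ F₀) (z : Q) :
    Module k (DDSp i z) := inferInstanceAs (Module k (ddSub i z))

/-- The maps of the translate. -/
noncomputable def ddArrow {F₁ F₀ : Rep.{u, v, w} k Q} (i : F₁ ⟶ F₀) {x y : Q} (α : x ⟶ y) :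
    DDSp i x →ₗ[k] DDSp i y :=
  (LinearMap.lcomp k k (Linear.rightComp k F₁ (prArrow k α))).restrict fun l hl d => by
    rw [LinearMap.lcomp_apply, Linear.rightComp_apply, Category.assoc]
    exact hl _

/-- The translate associated with a presentation. -/
noncomputable def ddRep {F₁ F₀ : Rep.{u, v, w} k Q} (i : F₁ ⟶ F₀) : Rep.{u, v, w} k Q :=
  mkRep (DDSp i) (ddArrow i)

section

variable {F₁ F₀ : Rep.{u, v, w} k Q} {i : F₁ ⟶ F₀}

/-- The elements of the spaces of the translate as linear forms. -/
noncomputable def ddVal (i : F₁ ⟶ F₀) (z : Q) : DDSp i z →ₗ[k] Module.Dual k (F₁ ⟶ Pr k z) :=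
  (ddSub i z).subtype

/-- The elements of the translate as linear forms. -/
noncomputable def ddV (i : F₁ ⟶ F₀) (z : Q) : sp (ddRep i) z →ₗ[k] Module.Dual k (F₁ ⟶ Pr k z) :=
  ddVal i z ∘ₗ (mkRepEquiv (DDSp i) (ddArrow i) z).toLinearMap

theorem ddV_injective (z : Q) : Function.Injective (ddV i z) :=
  have h : Function.Injective (ddVal i z) := Subtype.val_injective
  h.comp (mkRepEquiv (DDSp i) (ddArrow i) z).injective

theorem ddV_comp {z : Q} (t : sp (ddRep i) z) (d : F₀ ⟶ Pr k z) : ddV i z t (i ≫ d) = 0 :=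
  (mkRepEquiv (DDSp i) (ddArrow i) z t).2 d

theorem exists_ddV {z : Q} (l : Module.Dual k (F₁ ⟶ Pr k z)) (h : l ∈ ddSub i z) :
    ∃ t, ddV i z t = l :=
  ⟨(mkRepEquiv (DDSp i) (ddArrow i) z).symm ⟨l, h⟩, rfl⟩

theorem ddV_ar {x y : Q} (α : x ⟶ y) (t : sp (ddRep i) x) (c : F₁ ⟶ Pr k y) :
    ddV i y (ar _ α t) c = ddV i x t (c ≫ prArrow k α) := by
  have h := mkRepEquiv_ar (DDSp i) (ddArrow i) α t
  exact congrArg (fun s => ddVal i y s c) h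

/-- Yoneda's lemma for the translate. It is linear in `m`, and for a path it follows by induction
from the definition on arrows. -/
theorem ddV_ev_prHom {x z : Q} (t : sp (ddRep i) z) (m : sp (Pr.{u, v, w} k z) x)
    (c : F₁ ⟶ Pr k x) :
    ddV i x (ev (prHom t) x m) c = ddV i z t (c ≫ prHom m) := by
  induction m using fr_induction with
  | zero =>
    have h : prHom (0 : sp (Pr.{u, v, w} k z) x) = 0 := prHom_ext (ev_prHom_gen _)
    rw [h, map_zero, map_zero, Limits.comp_zero, map_zero]
    rfl
  | add a b ha hb =>
    have h : prHom (a + b) = prHom a + prHom b := prHom_ext (by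
      rw [ev_prHom_gen, ev_add, ev_prHom_gen, ev_prHom_gen])
    rw [map_add, map_add, h, Preadditive.comp_add, map_add, ← ha, ← hb]
    rfl
  | smul a j q =>
    have h : prHom (a • frSingle.{u, v, w} k (fun _ : PUnit.{max u v w + 1} => z) j q) =
        a • prHom (frSingle.{u, v, w} k (fun _ : PUnit.{max u v w + 1} => z) j q) := prHom_ext (by
      rw [ev_prHom_gen, ev_smul, ev_prHom_gen])
    rw [map_smul, map_smul, h, Linear.comp_smul, map_smul, LinearMap.smul_apply]
    refine congrArg (fun b : k => a • b) ?_
    have h1 : frSingle.{u, v, w} k (fun _ : PUnit.{max u v w + 1} => z) j q = pm _ q (prGen k z) :=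
      (pm_frGen.{u, v, w} (k := k) (b := fun _ : PUnit.{max u v w + 1} => z) j q).symm
    rw [h1, ev_prHom_pm]
    clear h1 h
    induction q with
    | nil =>
      rw [pm_nil, pm_nil]
      have h2 : prHom (prGen k z) = 𝟙 (Pr.{u, v, w} k z) := prHom_ext (ev_prHom_gen _)
      rw [h2, Category.comp_id]
    | cons q α ih =>
      rw [pm_cons, pm_cons, ddV_ar, ih, Category.assoc, prArrow_prHom]

end

variable {ι₁ ι₀ : Type (max u v w)} [Fintype ι₁] [Fintype ι₀] {b₁ : ι₁ → Q} {b₀ : ι₀ → Q}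
  (i : Fr k b₁ ⟶ Fr k b₀)

/-- The bilinear form of the translate. -/
noncomputable def ddForm : (Fr k b₁ ⟶ ddRep i) →ₗ[k] k where
  toFun c := ∑ j, ddV i (b₁ j) (ev c (b₁ j) (frGen k b₁ j)) (frπ b₁ j)
  map_add' c d := by
    rw [← Finset.sum_add_distrib]
    refine Finset.sum_congr rfl fun j _ => ?_
    rw [ev_add, map_add, LinearMap.add_apply]
  map_smul' a c := by
    rw [RingHom.id_apply, Finset.smul_sum]
    refine Finset.sum_congr rfl fun j _ => ?_
    rw [ev_smul, map_smul, LinearMap.smul_apply]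

theorem sum_frπ_prHom {ι : Type (max u v w)} [Fintype ι] {b : ι → Q} {M : Rep.{u, v, w} k Q}
    (c : Fr k b ⟶ M) : ∑ j, frπ b j ≫ prHom (ev c (b j) (frGen k b j)) = c := by
  have h : ∀ j, prHom (ev c (b j) (frGen k b j)) = frι b j ≫ c := fun j => prHom_ext (by
    rw [ev_prHom_gen, ev_comp, frι, ev_prHom_gen])
  simp only [h]
  have h3 := congrArg (fun f => f ≫ c) (sum_frπ_frι (k := k) b)
  simpa [Preadditive.sum_comp] using h3

theorem ddForm_comp_prHom {z : Q} (t : sp (ddRep i) z) (c : Fr k b₁ ⟶ Pr k z) :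
    ddForm i (c ≫ prHom t) = ddV i z t c := by
  change ∑ j, ddV i (b₁ j) (ev (c ≫ prHom t) (b₁ j) (frGen k b₁ j)) (frπ b₁ j) = _
  conv_rhs => rw [← sum_frπ_prHom c, map_sum]
  refine Finset.sum_congr rfl fun j _ => ?_
  rw [ev_comp, ddV_ev_prHom]

/-- Every morphism from the free representation `F₁` is a sum of morphisms through some `P_z`, by
`sum_frπ_prHom`. So a functional on `Hom(F₁, Z)` is determined by its values on the composites `c ≫
prHom m`, and these values form an element of the translate depending naturally on `m`. -/
theorem isARForm_ddForm {Y : Rep.{u, v, w} k Q} (p : Fr k b₀ ⟶ Y) (w : i ≫ p = 0)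
    (hS : (ShortComplex.mk i p w).ShortExact) :
    IsARForm (T := ddRep i) ⟨Fr k b₁, Fr k b₀, i, p, w, hS, projective_Fr⟩ (ddForm i) where
  comp_eq_zero d := by
    change ddForm i (i ≫ d) = 0
    change Fr k b₀ ⟶ ddRep i at d
    rw [← sum_frπ_prHom d, Preadditive.comp_sum, map_sum]
    refine Finset.sum_eq_zero fun j _ => ?_
    rw [← Category.assoc, ddForm_comp_prHom, ddV_comp]
  exists_repr Z l hl := by
    change (Fr k b₁ ⟶ Z) →ₗ[k] k at l
    change ∀ d : Fr k b₀ ⟶ Z, l (i ≫ d) = 0 at hl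
    have prHom_add : ∀ {x : Q} (a b : sp Z x), prHom (a + b) = prHom a + prHom b :=
      fun a b => prHom_ext (by rw [ev_prHom_gen, ev_add, ev_prHom_gen, ev_prHom_gen])
    have prHom_smul : ∀ {x : Q} (a : k) (b : sp Z x), prHom (a • b) = a • prHom b :=
      fun a b => prHom_ext (by rw [ev_prHom_gen, ev_smul, ev_prHom_gen])
    have hmem : ∀ (x : Q) (m : sp Z x), (l ∘ₗ Linear.rightComp k (Fr k b₁) (prHom m) :
        Module.Dual k (Fr k b₁ ⟶ Pr k x)) ∈ ddSub i x := fun x m d => by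
      rw [LinearMap.comp_apply, Linear.rightComp_apply, Category.assoc]
      exact hl _
    choose t ht using fun (x : Q) (m : sp Z x) => exists_ddV _ (hmem x m)
    have ht' : ∀ x m c, ddV i x (t x m) c = l (c ≫ prHom m) := fun x m c => by
      rw [ht]; rfl
    let φ : ∀ x, sp Z x →ₗ[k] sp (ddRep i) x := fun x =>
      { toFun := t x
        map_add' := fun a b => ddV_injective x (LinearMap.ext fun c => by
          rw [map_add, LinearMap.add_apply, ht', ht', ht', prHom_add, Preadditive.comp_add, map_add])
        map_smul' := fun a b => ddV_injective x (LinearMap.ext fun c => by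
          rw [RingHom.id_apply, map_smul, LinearMap.smul_apply, ht', ht', prHom_smul,
            Linear.comp_smul, map_smul]) }
    refine ⟨mkHom φ fun {x y} α m => ddV_injective y (LinearMap.ext fun c => ?_), fun c => ?_⟩
    · rw [ddV_ar]
      exact (ht' _ _ _).trans (((ht' _ _ _).trans (by
        rw [Category.assoc, prArrow_prHom])).symm)
    · change Fr k b₁ ⟶ Z at c
      change _ = ∑ j, ddV i (b₁ j) (ev (c ≫ mkHom φ _) (b₁ j) (frGen k b₁ j)) (frπ b₁ j)
      conv_lhs => rw [← sum_frπ_prHom c, map_sum]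
      exact Finset.sum_congr rfl fun j _ => (ht' _ _ _).symm
  eq_zero Z φ hφ := by
    refine rep_hom_ext fun z m => ddV_injective z (LinearMap.ext fun c => ?_)
    have h : prHom m ≫ φ = prHom (ev φ z m) := prHom_ext (by
      rw [ev_comp, ev_prHom_gen, ev_prHom_gen])
    rw [← ddForm_comp_prHom, ← h, ev_zero, map_zero]
    exact (congrArg _ (Category.assoc _ _ _)).symm.trans (hφ (c ≫ prHom m))

end Translate

/-! ### Vanishing of extensions by projectives -/

section Ext

variable {k : Type w} [Field k] {Q : Type u} [Quiver.{v} Q]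

/-- All extensions of `Y` by `P_z` split. -/
def ExtVanish (Y : Rep.{u, v, w} k Q) (z : Q) : Prop :=
  ∀ (E : Rep.{u, v, w} k Q) (f : Pr k z ⟶ E) (g : E ⟶ Y) (w : f ≫ g = 0),
    (ShortComplex.mk f g w).ShortExact → IsSplitEpi g

/-- The extensions by almost all `P_z` split. -/
def IsTF (Y : Rep.{u, v, w} k Q) : Prop := {z | ¬ ExtVanish Y z}.Finite

theorem ExtVanish.extends {Y : Rep.{u, v, w} k Q} {z : Q} (h : ExtVanish Y z) (π : Pres Y)
    (c : π.P1 ⟶ Pr k z) : ∃ s, π.i ≫ s = c :=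
  (π.push_split c).1 (h _ _ _ _ (π.push_shortExact c))

/-- Lifting `π.p` to the middle term exhibits the given extension as the pushout along a morphism
`c`, and an extension of `c` to `π.P0` splits it. -/
theorem extVanish_of_extends {Y : Rep.{u, v, w} k Q} {z : Q} (π : Pres Y)
    (h : ∀ c : π.P1 ⟶ Pr k z, ∃ s, π.i ≫ s = c) : ExtVanish Y z := by
  intro E f g w hS
  have := π.proj
  have hg : Epi g := hS.epi_g
  have hf : Mono f := hS.mono_f
  obtain ⟨c, hc⟩ := shortExact_lift hS (π.i ≫ Projective.factorThru π.p g) (by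
    rw [Category.assoc]
    exact (congrArg (π.i ≫ ·) (Projective.factorThru_comp π.p g)).trans π.w)
  obtain ⟨s, hs⟩ := h c
  obtain ⟨r, hr⟩ := π.desc (Projective.factorThru π.p g - s ≫ f) (by
    rw [Preadditive.comp_sub, ← Category.assoc, hs]
    exact sub_eq_zero.2 hc.symm)
  refine IsSplitEpi.mk' ⟨r, ?_⟩
  have : Epi π.p := π.shortExact.epi_g
  rw [← cancel_epi π.p, ← Category.assoc, hr, Preadditive.sub_comp, Projective.factorThru_comp,
    Category.assoc, w]
  simp

theorem isTF_of_projective {Y : Rep.{u, v, w} k Q} [Projective Y] : IsTF Y := by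
  refine Set.Finite.subset Set.finite_empty fun z hz => hz ?_
  intro E f g w hS
  have : Epi g := hS.epi_g
  exact IsSplitEpi.mk' ⟨Projective.factorThru (𝟙 Y) g, Projective.factorThru_comp _ _⟩

/-- By duality `Ext¹(Y, P_z)` is controlled by `Hom(P_z, T) = T(z)`, which is zero outside the
finite support of `T`. -/
theorem IsARForm.isTF {T Y : Rep.{u, v, w} k Q} [hT : IsFD T] {π : Pres Y}
    {ρ : (π.P1 ⟶ T) →ₗ[k] k} (h : IsARForm π ρ) : IsTF Y := by
  refine hT.supp.subset fun z hz => ?_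
  by_contra hc
  refine hz (extVanish_of_extends π fun c => h.extends_of_forall c fun φ => ?_)
  have : Subsingleton (sp T z) := not_nontrivial_iff_subsingleton.1 hc
  have hφ : φ = 0 := prHom_ext (Subsingleton.elim _ _)
  rw [hφ, Limits.comp_zero, map_zero]

variable [hQ : SLF Q]

/-- The vertices between two finite sets. -/
theorem finite_between {s t : Set Q} (hs : s.Finite) (ht : t.Finite) :
    {b | b ∈ Succ s ∧ ∃ z ∈ t, Nonempty (Quiver.Path b z)}.Finite := by
  have := hs.to_subtype
  have := ht.to_subtype
  -- Such a vertex lies on one of the finitely many paths from `s` to `t`, each of which has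
  -- finitely many vertices.
  refine ((Set.finite_range fun r : Σ a : s, Σ z : t, Quiver.Path a.1 z.1 =>
    {b | ∃ (q₁ : Quiver.Path r.1.1 b) (q₂ : Quiver.Path b r.2.1.1), q₁.comp q₂ = r.2.2}).sUnion
      ?_).subset ?_
  · rintro _ ⟨⟨a, z, q⟩, rfl⟩
    refine (q.vertices.finite_toSet).subset ?_
    rintro b ⟨q₁, q₂, h12⟩
    change b ∈ q.vertices
    rw [show q = q₁.comp q₂ from h12.symm, Quiver.Path.vertices_comp, List.mem_append]
    exact Or.inr q₂.start_mem_vertices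
  · rintro b ⟨⟨a, ha, ⟨q₁⟩⟩, z, hz, ⟨q₂⟩⟩
    exact ⟨_, ⟨⟨⟨a, ha⟩, ⟨z, hz⟩, q₁.comp q₂⟩, rfl⟩, q₁, q₂, rfl⟩

/-- A non-zero morphism from the first term of a presentation to `P_z` requires a path from `z` to
one of the finitely many generating vertices. -/
theorem exists_finite_extVanish {Y : Rep.{u, v, w} k Q} (hY : IsFP Y) :
    ∃ t : Set Q, t.Finite ∧ ∀ z, (¬ ∃ y ∈ t, Nonempty (Quiver.Path z y)) → ExtVanish Y z := by
  obtain ⟨ι₁, ι₀, _, _, b₁, b₀, i, p, w, hS⟩ := hY.exists_presentation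
  refine ⟨Set.range b₁, Set.finite_range b₁, fun z hz => ?_⟩
  refine extVanish_of_extends ⟨Fr k b₁, Fr k b₀, i, p, w, hS, projective_Fr⟩ fun c => ⟨0, ?_⟩
  rw [Limits.comp_zero]
  refine (frHom_ext fun j => ?_ : c = 0).symm
  have : Subsingleton (sp (Pr.{u, v, w} k z) (b₁ j)) := by
    rw [← not_nontrivial_iff_subsingleton]
    intro h
    obtain ⟨-, q⟩ := exists_path_of_nontrivial h
    exact hz ⟨b₁ j, ⟨j, rfl⟩, q⟩
  exact Subsingleton.elim _ _

/-- The property `IsTF` is inherited along irreducible morphisms. -/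
theorem IsTF.of_irrNZ {X Y : RepPlus.{u, v, w} k Q} (h : IsTF X.obj)
    (hX : IsLoc X) (hY : IsLoc Y) (hXY : IrrNZ X Y) : IsTF Y.obj := by
  obtain ⟨f, hf, hf2⟩ := hXY
  obtain ⟨s, hs, hsX⟩ := (isFP_obj X).supp
  obtain ⟨t, ht, htY⟩ := exists_finite_extVanish (isFP_obj Y)
  -- Let `z` be outside this finite set with a non-split extension of `Y`. There is a path from `z`
  -- to `t`, so `z` is not in the support of `X`.
  refine (h.union (finite_between hs ht)).subset fun z hz => ?_
  by_contra hc
  simp only [Set.mem_union, Set.mem_ofPred_eq, not_or, not_not] at hc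
  have hXz : ¬ Nontrivial (sp X.obj z) := fun hn => hz (htY z fun hzt => hc.2 ⟨hsX z hn, hzt⟩)
  refine hz fun E a g w hS => ?_
  have hE : IsFP E := IsFP.X₂ hS (isFP_Fr _) (isFP_obj Y)
  have ha : Mono a := hS.mono_f
  have hg : Epi g := hS.epi_g
  let a' : Pr k z ⟶ Limits.pullback g f.hom := Limits.pullback.lift a 0 (by
    rw [w, Limits.zero_comp])
  have ha1 : a' ≫ Limits.pullback.fst g f.hom = a := Limits.pullback.lift_fst _ _ _
  have ha2 : a' ≫ Limits.pullback.snd g f.hom = 0 := Limits.pullback.lift_snd _ _ _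
  have hm : Mono a' := by
    have : Mono (a' ≫ Limits.pullback.fst g f.hom) := by rw [ha1]; exact ha
    exact mono_of_mono a' (Limits.pullback.fst g f.hom)
  have hS' : (ShortComplex.mk a' (Limits.pullback.snd g f.hom) ha2).ShortExact := by
    refine shortExact_of_lift _ fun W d hd => ?_
    obtain ⟨r, hr⟩ := shortExact_lift hS (d ≫ Limits.pullback.fst g f.hom) (by
      change (d ≫ Limits.pullback.fst g f.hom) ≫ g = 0
      rw [Category.assoc, Limits.pullback.condition, ← Category.assoc, hd, Limits.zero_comp])
    refine ⟨r, Limits.pullback.hom_ext ?_ ?_⟩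
    · rw [Category.assoc, ha1]; exact hr
    · rw [Category.assoc, ha2, hd, Limits.comp_zero]
  have hs := hc.1 _ _ _ _ hS'
  -- The extension splits after pulling it back along `f`, so `f` lifts to `E`. By irreducibility
  -- the lift is a section or `g` is a retraction.
  let r : X.obj ⟶ E := section_ (Limits.pullback.snd g f.hom) ≫ Limits.pullback.fst g f.hom
  have hr : r ≫ g = f.hom := by
    rw [Category.assoc, Limits.pullback.condition, ← Category.assoc, IsSplitEpi.id,
      Category.id_comp]
  have hf' : (ObjectProperty.homMk r : X ⟶ fpObj hE) ≫ (ObjectProperty.homMk g : fpObj hE ⟶ Y)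
      = f := ObjectProperty.hom_ext _ hr
  rw [← hf'] at hf2
  rcases isSplitMono_or_isSplitEpi_of_notMem_rad2 hX hY hf2 with h1 | h1
  · exfalso
    have h2 : IsSplitMono r := (isSplitMono_hom_iff (ObjectProperty.homMk r : X ⟶ fpObj hE)).2 h1
    have : Subsingleton (sp X.obj z) := not_nontrivial_iff_subsingleton.1 hXz
    -- The retraction kills `P_z` because `X(z) = 0`; so it factors through `Y` and makes `f` a
    -- section.
    obtain ⟨t, ht⟩ := shortExact_desc hS (retraction r) (prHom_ext (Subsingleton.elim _ _))
    refine hf.not_isSplitMono hX.1 ((isSplitMono_hom_iff f).1 (IsSplitMono.mk' ⟨t, ?_⟩))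
    rw [← hr, Category.assoc]
    exact (congrArg (r ≫ ·) ht).trans (IsSplitMono.id r)
  · exact (isSplitEpi_hom_iff (ObjectProperty.homMk g : fpObj hE ⟶ Y)).2 h1

/-- The translate is finite dimensional under the condition `IsTF`. -/
theorem isFD_ddRep {ι₁ ι₀ : Type (max u v w)} [Finite ι₁] {b₁ : ι₁ → Q} {b₀ : ι₀ → Q}
    (i : Fr k b₁ ⟶ Fr k b₀) {Y : Rep.{u, v, w} k Q} (p : Fr k b₀ ⟶ Y) (w : i ≫ p = 0)
    (hS : (ShortComplex.mk i p w).ShortExact) (h : IsTF Y) : IsFD (ddRep i) where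
  fin x := Module.Finite.of_injective _ (ddV_injective x)
  supp := by
    refine Set.Finite.subset h fun z hz hv => not_subsingleton_iff_nontrivial.2 hz ?_
    refine ⟨fun s t => ddV_injective z (LinearMap.ext fun c => ?_)⟩
    obtain ⟨d, rfl⟩ := hv.extends ⟨Fr k b₁, Fr k b₀, i, p, w, hS, projective_Fr⟩ c
    exact (ddV_comp s d).trans (ddV_comp t d).symm

end Ext

/-! ### Almost split sequences in `rep⁺(Q)` and the translates of its objects -/

section InverseTranslate

variable {k : Type w} [Field k] {Q : Type u} [Quiver.{v} Q] [hQ : SLF Q]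

theorem IsFD.isFP {M : Rep.{u, v, w} k Q} (h : IsFD M) : IsFP M := IsFP.of_finite h.fin h.supp

theorem IsFD.of_retract {M N : Rep.{u, v, w} k Q} (h : IsFD M) (i : N ⟶ M) (r : M ⟶ N)
    (hir : i ≫ r = 𝟙 N) : IsFD N := by
  have hi : ∀ x, Function.Injective (ev i x) := fun x =>
    Function.LeftInverse.injective (g := ev r x) fun v => by rw [← ev_comp, hir, ev_id]
  refine ⟨fun x => ?_, h.supp.subset fun x hx => ?_⟩
  · have := h.fin x
    exact Module.Finite.of_injective _ (hi x)
  · have : Nontrivial (sp N x) := hx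
    exact (hi x).nontrivial

theorem IsFD.of_iso {M N : Rep.{u, v, w} k Q} (h : IsFD M) (e : M ≅ N) : IsFD N :=
  h.of_retract e.inv e.hom e.inv_hom_id

theorem IsFD.X₂ {S : ShortComplex (Rep.{u, v, w} k Q)} (hS : S.ShortExact) (h1 : IsFD S.X₁)
    (h3 : IsFD S.X₃) : IsFD S.X₂ where
  fin x := (IsFP.X₂ hS h1.isFP h3.isFP).fin x
  supp := by
    refine (h1.supp.union h3.supp).subset fun x hx => ?_
    by_contra hc
    simp only [Set.mem_union, Set.mem_ofPred_eq, not_or, not_nontrivial_iff_subsingleton] at hc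
    have h1 := hc.1
    have h3 := hc.2
    refine not_subsingleton_iff_nontrivial.2 hx (subsingleton_of_forall_eq 0 fun a => ?_)
    obtain ⟨b, rfl⟩ := (shortExact_exact hS x a).1 (Subsingleton.elim _ _)
    rw [Subsingleton.elim b 0, map_zero]

/-- In the relation at the basis element `q`, the first sum involves generators attached to targets
of arrows from the vertex of `q`. Descending along paths, these are already sent to zero; the rest
says that `jm` vanishes on the images of the generators attached to `q`, and `jm` is injective. The
form of the result allows the free term of a presentation as well as any `P_y` as target. -/
theorem hom_star_TrD (M : Rep.{u, v, w} k Q) [IsFD M] {N : Rep.{u, v, w} k Q} (hN : IsStar N)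
    (r : TrD M ⟶ N) : r = 0 := by
  let d : Fr k (aVertex M) ⟶ N := Limits.cokernel.π (trMap M) ≫ r
  have hd : trMap M ≫ d = 0 := by
    exact (Limits.cokernel.condition_assoc (trMap M) r).trans Limits.zero_comp
  have key : ∀ q : BIdx M, ∀ β : Σ x : Q, (x ⟶ q.1),
      ev d β.1 (frGen k (aVertex M) ⟨q, β⟩) = 0 := by
    let R : BIdx M → BIdx M → Prop := fun q' q => ∃ p : Quiver.Path q.1 q'.1, p.length ≠ 0
    have htrans : IsTrans (BIdx M) R := ⟨fun a b c ⟨p, hp⟩ ⟨p', hp'⟩ =>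
      ⟨p'.comp p, by rw [Quiver.Path.length_comp]; omega⟩⟩
    have hirr : Std.Irrefl R := ⟨fun a ⟨p, hp⟩ => hp (path_length_eq_zero p)⟩
    have hwf : WellFounded R := Finite.wellFounded_of_trans_of_irrefl R
    intro q
    induction q using hwf.induction with
    | _ q ih =>
      have h1 := ev_comp_trMap d q
      rw [hd, Finset.sum_eq_zero, zero_sub] at h1
      · have h2 : jm N q.1 (fun β => ev d β.1 (frGen k (aVertex M) ⟨q, β⟩)) = 0 := by
          rw [jm_apply, ← neg_eq_zero, ← h1]
          rfl
        have h3 := hN q.1 (h2.trans (map_zero _).symm)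
        exact congrFun h3
      · intro q' _
        refine Finset.sum_eq_zero fun α _ => ?_
        rw [ih q' ⟨α.toPath, by simp⟩ ⟨q.1, α⟩, smul_zero]
  have h0 : d = 0 := frHom_ext fun s => key s.1 s.2
  have : Epi (Limits.cokernel.π (trMap M)) := inferInstance
  exact (cancel_epi (Limits.cokernel.π (trMap M))).1 (h0.trans Limits.comp_zero.symm)

theorem isFP_TrD (M : Rep.{u, v, w} k Q) [IsFD M] (h : Mono (trMap M)) : IsFP (TrD M) :=
  IsFP.X₃ (trPres M h).shortExact (isFP_Fr (bVertex M))
    (@isFP_Fr _ _ _ _ _ _ (inferInstance : Finite (AIdx M)) (aVertex M))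

/-- Almost split sequences from bilinear forms, in `rep⁺(Q)`. -/
theorem IsARForm.exists_isAlmostSplitSeq {T Y : RepPlus.{u, v, w} k Q} {π : Pres Y.obj}
    {ρ : (π.P1 ⟶ T.obj) →ₗ[k] k} (h : IsARForm π ρ) (hT : IsLoc T) (hY : IsLoc Y) :
    ∃ (E : RepPlus.{u, v, w} k Q) (f : T ⟶ E) (g : E ⟶ Y), IsAlmostSplitSeq f g ∧
      (IsFD T.obj → IsFD Y.obj → IsFD E.obj) := by
  have := (isFP_obj T).moduleFinite_hom (isFP_obj T)
  obtain ⟨c, hc⟩ := h.exists_almostSplit (isLoc_obj_iff.2 hT) (isLoc_obj_iff.2 hY)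
  have hE : IsFP (π.pushObj c) := IsFP.X₂ (π.push_shortExact c) (isFP_obj T) (isFP_obj Y)
  exact ⟨fpObj hE, ObjectProperty.homMk (π.pushF c), ObjectProperty.homMk (π.pushG c),
    IsAlmostSplitSeq.of_hom hc, fun h1 h3 => IsFD.X₂ (π.push_shortExact c) h1 h3⟩

open Classical in
/-- The inverse translate as an object of `rep⁺(Q)`, where it is defined. -/
noncomputable def trdObj (M : RepPlus.{u, v, w} k Q) : RepPlus.{u, v, w} k Q :=
  if h : ∃ _ : IsFD M.obj, Mono (trMap M.obj) then
    fpObj (@isFP_TrD _ _ _ _ _ M.obj h.1 h.2) else M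

theorem trdObj_eq (M : RepPlus.{u, v, w} k Q) [h : IsFD M.obj] (h' : Mono (trMap M.obj)) :
    trdObj M = fpObj (isFP_TrD M.obj h') :=
  dif_pos (⟨h, h'⟩ : ∃ _ : IsFD M.obj, Mono (trMap M.obj))

theorem exists_arForm_trdObj (M : RepPlus.{u, v, w} k Q) [h : IsFD M.obj]
    (h' : Mono (trMap M.obj)) : ∃ (π : Pres (trdObj M).obj) (ρ : (π.P1 ⟶ M.obj) →ₗ[k] k),
      IsARForm π ρ ∧ IsFP π.P1 ∧ IsStar π.P0 := by
  rw [trdObj_eq M h']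
  exact ⟨trPres M.obj h', trForm M.obj h', isARForm_trForm M.obj h', isFP_Fr (bVertex M.obj),
    isStar_Fr (aVertex M.obj)⟩

theorem hom_star_trdObj (M : RepPlus.{u, v, w} k Q) [h : IsFD M.obj] (h' : Mono (trMap M.obj))
    {N : Rep.{u, v, w} k Q} (hN : IsStar N) (r : (trdObj M).obj ⟶ N) : r = 0 := by
  revert r
  rw [trdObj_eq M h']
  intro r
  exact hom_star_TrD M.obj hN r

theorem isBrick_trdObj {M : RepPlus.{u, v, w} k Q} [IsFD M.obj] (h' : Mono (trMap M.obj))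
    (hM : IsBrick k M) : IsBrick k (trdObj M) := by
  obtain ⟨π, ρ, h, -, h0⟩ := exists_arForm_trdObj M h'
  exact isBrick_obj_iff.1 (h.isBrick_right (hom_star_trdObj M h' h0) (isBrick_obj_iff.2 hM))

theorem isTF_trdObj {M : RepPlus.{u, v, w} k Q} [IsFD M.obj] (h' : Mono (trMap M.obj)) :
    IsTF (trdObj M).obj := by
  obtain ⟨π, ρ, h, -, -⟩ := exists_arForm_trdObj M h'
  exact h.isTF

theorem exists_isAlmostSplitSeq_trdObj {M : RepPlus.{u, v, w} k Q} [hfd : IsFD M.obj]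
    (h' : Mono (trMap M.obj)) (hM : IsBrick k M) : ∃ (E : RepPlus.{u, v, w} k Q) (f : M ⟶ E)
      (g : E ⟶ trdObj M), IsAlmostSplitSeq f g ∧ (IsFD (trdObj M).obj → IsFD E.obj) := by
  obtain ⟨π, ρ, h, -, -⟩ := exists_arForm_trdObj M h'
  obtain ⟨E, f, g, hfg, hE⟩ := h.exists_isAlmostSplitSeq hM.isLoc (isBrick_trdObj h' hM).isLoc
  exact ⟨E, f, g, hfg, hE hfd⟩

/-- The translate of a non-projective local object. -/
theorem exists_translate {Y : RepPlus.{u, v, w} k Q} (hY : IsLoc Y) (hTF : IsTF Y.obj)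
    (hP : ∀ y, ¬ Nonempty (Y ≅ prObj k y)) : ∃ T : RepPlus.{u, v, w} k Q, IsFD T.obj ∧ IsLoc T ∧
      (∃ (E : RepPlus.{u, v, w} k Q) (f : T ⟶ E) (g : E ⟶ Y), IsAlmostSplitSeq f g) ∧
      ∀ (M : RepPlus.{u, v, w} k Q) (_ : IsFD M.obj), Mono (trMap M.obj) → Nonempty (T ≅ M) →
        Nonempty (Y ≅ trdObj M) := by
  obtain ⟨ι₁, ι₀, _, _, b₁, b₀, i, p, w, hS⟩ := (isFP_obj Y).exists_presentation
  have := Fintype.ofFinite ι₁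
  have := Fintype.ofFinite ι₀
  have hfd : IsFD (ddRep i) := isFD_ddRep i p w hS hTF
  have hρ := isARForm_ddForm i p w hS
  -- A non-zero morphism would make `Y` isomorphic to some `P_x`.
  have hstar : ∀ {N : Rep.{u, v, w} k Q}, IsStar N → ∀ r : Y.obj ⟶ N, r = 0 := by
    intro N hN r
    by_contra hr
    obtain ⟨x, hx⟩ := exists_iso_Pr_of_hom (isLoc_obj_iff.2 hY) (isFP_obj Y) hN hr
    exact hP x (nonempty_iso_obj_iff.1 hx)
  have h0 := hstar (isStar_Fr (k := k) b₀)
  have : Module.Finite k (Fr k b₁ ⟶ ddRep i) := (isFP_Fr b₁).moduleFinite_hom hfd.isFP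
  have hT : IsLoc (fpObj hfd.isFP) := isLoc_obj_iff.1 (hρ.isLoc_left h0 (isLoc_obj_iff.2 hY))
  refine ⟨fpObj hfd.isFP, hfd, hT, ?_, ?_⟩
  · obtain ⟨E, f, g, hfg, -⟩ := IsARForm.exists_isAlmostSplitSeq (T := fpObj hfd.isFP) hρ hT hY
    exact ⟨E, f, g, hfg⟩
  · intro M hM hm he
    obtain ⟨e⟩ := nonempty_iso_obj_iff.2 he
    obtain ⟨π', ρ', h', hfp, h0'⟩ := exists_arForm_trdObj M hm
    have f1 : Module.Finite k (π'.P1 ⟶ ddRep i) := hfp.moduleFinite_hom hfd.isFP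
    have f2 : Module.Finite k (Fr k b₁ ⟶ M.obj) := (isFP_Fr b₁).moduleFinite_hom (isFP_obj M)
    exact nonempty_iso_obj_iff.1
      (hρ.nonempty_iso_right h' h0 (hom_star_trdObj M hm h0') e)

end InverseTranslate

/-! ### Injective representations and the kernel of `trMap` -/

section Injective

variable {k : Type w} [Field k] {Q : Type u} [Quiver.{v} Q]

/-- The functions on the paths from `x` to `z`, restricted to a set of vertices. -/
def injSub (k : Type w) [Field k] (U : Set Q) (z x : Q) : Submodule k (Quiver.Path x z → k) where
  carrier := {f | x ∉ U → f = 0}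
  add_mem' ha hb h := by rw [ha h, hb h, add_zero]
  zero_mem' _ := rfl
  smul_mem' c a ha h := by rw [ha h, smul_zero]

/-- The spaces of `injRep`. -/
def InjSp (k : Type w) [Field k] (U : Set Q) (z x : Q) : Type (max u v w) := injSub.{u, v, w} k U z x

noncomputable instance (U : Set Q) (z x : Q) : AddCommGroup (InjSp.{u, v, w} k U z x) :=
  inferInstanceAs (AddCommGroup (injSub k U z x))

noncomputable instance (U : Set Q) (z x : Q) : Module k (InjSp.{u, v, w} k U z x) :=
  inferInstanceAs (Module k (injSub k U z x))

/-- The values of the elements of `InjSp`. -/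
def injVal (k : Type w) [Field k] (U : Set Q) (z x : Q) :
    InjSp.{u, v, w} k U z x →ₗ[k] (Quiver.Path x z → k) := (injSub k U z x).subtype

variable {U : Set Q}

/-- The arrows of `injRep`. -/
def injArrow (hU : ∀ x y : Q, (x ⟶ y) → x ∈ U → y ∈ U) (z : Q) {x y : Q} (α : x ⟶ y) :
    InjSp.{u, v, w} k U z x →ₗ[k] InjSp.{u, v, w} k U z y :=
  LinearMap.restrict (p := injSub k U z x) (q := injSub k U z y)
    (LinearMap.funLeft k k fun s : Quiver.Path y z => α.toPath.comp s) fun f hf hy => by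
      rw [hf fun h => hy (hU x y α h), map_zero]

/-- The restriction of the injective representation of the vertex `z` to a set which is closed
under successors. -/
noncomputable def injRep (k : Type w) [Field k] (hU : ∀ x y : Q, (x ⟶ y) → x ∈ U → y ∈ U) (z : Q) :
    Rep.{u, v, w} k Q := mkRep (InjSp k U z) (injArrow hU z)

variable {hU : ∀ x y : Q, (x ⟶ y) → x ∈ U → y ∈ U} {z : Q}

/-- The elements of `injRep` as functions. -/
noncomputable def injC (hU : ∀ x y : Q, (x ⟶ y) → x ∈ U → y ∈ U) (z x : Q) :
    sp (injRep.{u, v, w} k hU z) x →ₗ[k] (Quiver.Path x z → k) :=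
  injVal k U z x ∘ₗ (mkRepEquiv (InjSp k U z) (injArrow hU z) x).toLinearMap

theorem injC_injective (x : Q) : Function.Injective (injC (k := k) hU z x) :=
  have h : Function.Injective (injVal k U z x) := Subtype.val_injective
  h.comp (mkRepEquiv (InjSp k U z) (injArrow hU z) x).injective

theorem injC_eq_zero {x : Q} (h : x ∉ U) (m : sp (injRep.{u, v, w} k hU z) x) :
    injC hU z x m = 0 := (mkRepEquiv (InjSp k U z) (injArrow hU z) x m).2 h

theorem exists_injC {x : Q} (h : x ∈ U) (f : Quiver.Path x z → k) :
    ∃ m, injC.{u, v, w} hU z x m = f :=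
  ⟨(mkRepEquiv (InjSp k U z) (injArrow hU z) x).symm ⟨f, fun hx => absurd h hx⟩, rfl⟩

theorem injC_ar {x y : Q} (α : x ⟶ y) (m : sp (injRep.{u, v, w} k hU z) x) (s : Quiver.Path y z) :
    injC hU z y (ar _ α m) s = injC hU z x m (α.toPath.comp s) :=
  congrArg (fun t => injVal k U z y t s) (mkRepEquiv_ar (InjSp k U z) (injArrow hU z) α m)

theorem injC_pm {x y : Q} (p : Quiver.Path x y) (m : sp (injRep.{u, v, w} k hU z) x)
    (s : Quiver.Path y z) : injC hU z y (pm _ p m) s = injC hU z x m (p.comp s) := by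
  induction p with
  | nil => rw [pm_nil, Quiver.Path.nil_comp]
  | cons p α ih =>
    rw [pm_cons, injC_ar, ih, ← Quiver.Path.comp_assoc]
    rfl

theorem nontrivial_injRep {x : Q} (h : x ∈ U) (p : Quiver.Path x z) :
    Nontrivial (sp (injRep.{u, v, w} k hU z) x) := by
  obtain ⟨m, hm⟩ := exists_injC.{u, v, w} (k := k) (hU := hU) h (fun _ : Quiver.Path x z => (1 : k))
  refine ⟨m, 0, fun h0 => one_ne_zero (α := k) ?_⟩
  have := congrFun hm p
  rw [h0, map_zero] at this
  exact this.symm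

theorem univ_closed (x y : Q) (_ : x ⟶ y) (_ : x ∈ (Set.univ : Set Q)) : y ∈ (Set.univ : Set Q) :=
  trivial

/-- Morphisms to injective representations. -/
noncomputable def toInj {Y : Rep.{u, v, w} k Q} (l : sp Y z →ₗ[k] k) :
    Y ⟶ injRep k univ_closed z :=
  mkHom (fun x => (mkRepEquiv (InjSp k Set.univ z)
      (injArrow univ_closed z) x).symm.toLinearMap ∘ₗ
    (LinearMap.codRestrict (injSub k Set.univ z x) (LinearMap.pi fun p => l ∘ₗ pm Y p)
      fun _ h => absurd trivial h : sp Y x →ₗ[k] InjSp k Set.univ z x)) fun {x y} α v => by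
    apply injC_injective
    funext s
    rw [injC_ar]
    change l (pm Y s (ar Y α v)) = l (pm Y (α.toPath.comp s) v)
    rw [pm_comp]
    rfl

theorem toInj_ne_zero {Y : Rep.{u, v, w} k Q} {l : sp Y z →ₗ[k] k} (hl : l ≠ 0) : toInj l ≠ 0 := by
  intro h
  refine hl (LinearMap.ext fun v => ?_)
  have h1 : injC univ_closed z z (ev (toInj l) z v) Quiver.Path.nil =
    l (pm Y Quiver.Path.nil v) := rfl
  rw [h, ev_zero, map_zero, pm_nil] at h1
  exact h1.symm

variable [hQ : SLF Q]

theorem isFD_injRep (h : {x | x ∈ U ∧ Nonempty (Quiver.Path x z)}.Finite) :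
    IsFD (injRep.{u, v, w} k hU z) where
  fin x := Module.Finite.of_injective _ (injC_injective x)
  supp := by
    refine h.subset fun x hx => ?_
    by_contra hc
    refine not_subsingleton_iff_nontrivial.2 hx ⟨fun a b => injC_injective x ?_⟩
    by_cases hxU : x ∈ U
    · funext p
      exact absurd ⟨hxU, ⟨p⟩⟩ hc
    · rw [injC_eq_zero hxU, injC_eq_zero hxU]

/-- The space at `z` is one-dimensional, and every non-zero element is moved to a non-zero element
of it by some path. So an endomorphism which is non-zero at `z` is injective, hence bijective by
finite dimension at each vertex, and one of `e` and `1 - e` is non-zero at `z`. -/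
theorem isLoc_injRep (hz : z ∈ U) : IsLoc (injRep.{u, v, w} k hU z) := by
  have hnil : ∀ s : Quiver.Path z z, s = Quiver.Path.nil := fun s => path_eq_nil s
  obtain ⟨m, hm⟩ := exists_injC.{u, v, w} (k := k) (hU := hU) hz fun _ : Quiver.Path z z => (1 : k)
  have hm0 : injC hU z z m Quiver.Path.nil = 1 := congrFun hm _
  have hsp : ∀ n, n = injC hU z z n Quiver.Path.nil • m := fun n => by
    apply injC_injective
    funext s
    rw [hnil s, map_smul, Pi.smul_apply, hm0, smul_eq_mul, mul_one]
  have key : ∀ e : injRep.{u, v, w} k hU z ⟶ injRep.{u, v, w} k hU z,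
      injC hU z z (ev e z m) Quiver.Path.nil ≠ 0 → IsIso e := by
    intro e he
    rw [isIso_iff_ev]
    intro x
    have : Module.Finite k (sp (injRep.{u, v, w} k hU z) x) :=
      Module.Finite.of_injective _ (injC_injective x)
    suffices hi : Function.Injective (ev e x) from
      ⟨hi, LinearMap.surjective_of_injective hi⟩
    rw [injective_iff_map_eq_zero]
    intro n hn
    apply injC_injective
    funext p
    have h1 : injC hU z z (ev e z (pm _ p n)) Quiver.Path.nil = 0 := by
      rw [ev_pm, hn, map_zero, map_zero]
      rfl
    rw [hsp (pm _ p n), map_smul, map_smul, Pi.smul_apply, smul_eq_mul, mul_eq_zero,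
      or_iff_left he, injC_pm, Quiver.Path.comp_nil] at h1
    rw [h1, map_zero]
    rfl
  refine ⟨fun h0 => ?_, fun e => ?_⟩
  · have := isZero_iff_sp.1 h0 z
    rw [Subsingleton.elim m 0, map_zero] at hm0
    exact zero_ne_one hm0
  · by_cases he : injC hU z z (ev e z m) Quiver.Path.nil = 0
    · right
      apply key
      rw [ev_sub, map_sub, Pi.sub_apply, he, ev_id, hm0, sub_zero]
      exact one_ne_zero
    · exact Or.inl (key e he)

open Classical in
/-- If the first map of the presentation of the inverse translate of `M` is not injective, then
there is a morphism from an injective representation to `M`. -/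
theorem exists_injRep_hom (M : Rep.{u, v, w} k Q) [hM : IsFD M] (h : ¬ Mono (trMap M)) :
    ∃ z x : Q, Nonempty (Quiver.Path x z) ∧ ∀ (U : Set Q) (hU : ∀ x y : Q, (x ⟶ y) → x ∈ U → y ∈ U),
      x ∈ U → ∃ f : injRep.{u, v, w} k hU z ⟶ M, f ≠ 0 := by
  rw [mono_iff_ev] at h
  push Not at h
  obtain ⟨z, hz⟩ := h
  rw [injective_iff_map_eq_zero] at hz
  push Not at hz
  obtain ⟨v, hv, hv0⟩ := hz
  -- The coordinates of an element of the kernel at `z` form vectors `V x p` of `M(x)`, indexed by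
  -- the paths `p` from `x` to `z`.
  let c : ∀ x, Quiver.Path x z → Module.Basis.ofVectorSpaceIndex k (sp M x) → k :=
    fun x p i => frC (bVertex M) z v ⟨⟨x, i⟩, p⟩
  let V : ∀ x, Quiver.Path x z → sp M x := fun x p => ∑ i, c x p i • bv M x i
  have hVr : ∀ x p i, (bv M x).repr (V x p) i = c x p i := fun x p i => by
    rw [Module.Basis.repr_sum_self]
  -- The kernel condition: `α` removes itself from the beginning of `p`, or annihilates `V x p` if
  -- `p` does not begin with `α`.
  have hV : ∀ {x y : Q} (α : x ⟶ y) (p : Quiver.Path x z),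
      ar M α (V x p) = ∑ s : Quiver.Path y z, if α.toPath.comp s = p then V y s else 0 := by
    intro x y α p
    apply (bv M y).ext_elem
    intro j
    have h1 := frC_trMap M v ⟨y, j⟩ α p
    rw [hv, map_zero, Finsupp.zero_apply, eq_comm, sub_eq_zero] at h1
    have h2 : (bv M y).repr (ar M α (V x p)) j = ∑ i, ac M ⟨x, i⟩ ⟨y, j⟩ α * c x p i := by
      rw [map_sum, map_sum, Finsupp.finsetSum_apply]
      refine Finset.sum_congr rfl fun i _ => ?_
      rw [map_smul, map_smul, Finsupp.smul_apply, smul_eq_mul, mul_comm]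
      exact congrArg (· * _) (cf_apply M ⟨y, j⟩ _).symm
    rw [h2, map_sum, Finsupp.finsetSum_apply]
    refine h1.trans (Finset.sum_congr rfl fun s _ => ?_)
    split_ifs
    · exact (hVr y s j).symm
    · simp
  obtain ⟨x, p, hp⟩ : ∃ x p, V x p ≠ 0 := by
    by_contra hc
    push Not at hc
    refine hv0 ((frC (bVertex M) z).injective ?_)
    rw [map_zero]
    ext ⟨⟨x, i⟩, p⟩
    have := hVr x p i
    rw [hc, map_zero] at this
    exact this.symm
  refine ⟨z, x, ⟨p⟩, fun U hU hx => ?_⟩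
  -- A function on paths is sent to the combination of the `V y s` with its values as coefficients.
  -- It is non-zero on the indicator function of the path `p` with `V x p ≠ 0`, which is available
  -- as soon as `x` is in `U`.
  let φ : ∀ y, sp (injRep.{u, v, w} k hU z) y →ₗ[k] sp M y := fun y =>
    (Fintype.linearCombination k (V y)) ∘ₗ injC hU z y
  have hφ : ∀ y n, φ y n = ∑ s, injC hU z y n s • V y s := fun y n =>
    Fintype.linearCombination_apply _ _ _
  have hnat : ∀ {a b : Q} (α : a ⟶ b) (n : sp (injRep.{u, v, w} k hU z) a),
      φ b (ar _ α n) = ar M α (φ a n) := fun {a b} α n => by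
    rw [hφ, hφ, map_sum]
    simp only [injC_ar, map_smul, hV, Finset.smul_sum]
    rw [Finset.sum_comm]
    refine Finset.sum_congr rfl fun s _ => ?_
    rw [Finset.sum_eq_single (α.toPath.comp s)]
    · rw [if_pos rfl]
    · intro t _ ht
      rw [if_neg ht.symm, smul_zero]
    · simp
  refine ⟨mkHom φ hnat, fun h0 => hp ?_⟩
  obtain ⟨n, hn⟩ := exists_injC.{u, v, w} (k := k) (hU := hU) (z := z) hx (Pi.single p 1)
  have h1 := hφ x n
  rw [hn, Finset.sum_eq_single p] at h1
  · rw [Pi.single_eq_same, one_smul] at h1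
    rw [← h1, ← ev_mkHom φ hnat, h0, ev_zero]
  · intro t _ ht
    rw [Pi.single_eq_of_ne ht, zero_smul]
  · simp

end Injective

/-! ### Finite connected sets of vertices -/

section Connected

variable {k : Type w} {Q : Type u} [Quiver.{v} Q] {F : Set Q}

/-- The full subquiver generated by `F` is connected, in terms of locally constant functions. -/
def IsConn (k : Type w) (F : Set Q) (z : Q) : Prop :=
  ∀ c : Q → k, (∀ x ∈ F, ∀ y ∈ F, (x ⟶ y) → c x = c y) → ∀ x ∈ F, c x = c z

theorem IsConn.insert_adj {z y y' : Q} (h : IsConn k F z) (hy : y ∈ F)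
    (hyy : Nonempty (y ⟶ y') ∨ Nonempty (y' ⟶ y)) : IsConn k (insert y' F) z := by
  intro c hc x hx
  have h1 := h c fun a ha b hb α => hc a (Or.inr ha) b (Or.inr hb) α
  rcases hx with rfl | hx
  · rw [← h1 y hy]
    rcases hyy with ⟨⟨α⟩⟩ | ⟨⟨α⟩⟩
    · exact (hc y (Or.inr hy) _ (Or.inl rfl) α).symm
    · exact hc _ (Or.inl rfl) y (Or.inr hy) α
  · exact h1 x hx

theorem exists_isConn (k : Type w) (hconn : Subsingleton (Quiver.WeaklyConnectedComponent Q)) (z y : Q) :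
    ∃ F : Set Q, F.Finite ∧ z ∈ F ∧ y ∈ F ∧ IsConn k F z := by
  obtain ⟨p⟩ := (Quiver.WeaklyConnectedComponent.eq z y).1 (Subsingleton.elim _ _)
  induction p with
  | nil =>
    exact ⟨{z}, Set.finite_singleton _, rfl, rfl, fun c _ x hx => by rw [hx]⟩
  | @cons y y' p α ih =>
    obtain ⟨F, hF, hz, hy, h⟩ := ih
    refine ⟨Set.insert y' F, hF.insert _, Or.inr hz, Or.inl rfl, h.insert_adj hy ?_⟩
    rcases α with α | α
    · exact Or.inl ⟨α⟩
    · exact Or.inr ⟨α⟩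

end Connected

/-! ### Constant representations as bricks -/

section Constant

variable {k : Type w} [Field k] {Q : Type u} [Quiver.{v} Q]

/-- The scalars, or zero outside a set. -/
def constSub (k : Type w) [Field k] (F : Set Q) (x : Q) : Submodule k (ULift.{max u v} k) where
  carrier := {c | x ∉ F → c = 0}
  add_mem' ha hb h := by rw [ha h, hb h, add_zero]
  zero_mem' _ := rfl
  smul_mem' c a ha h := by rw [ha h, smul_zero]

/-- The spaces of `constRep`. -/
def ConstSp (k : Type w) [Field k] (F : Set Q) (x : Q) : Type (max u v w) := constSub.{u, v, w} k F x

noncomputable instance (F : Set Q) (x : Q) : AddCommGroup (ConstSp.{u, v, w} k F x) :=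
  inferInstanceAs (AddCommGroup (constSub k F x))

noncomputable instance (F : Set Q) (x : Q) : Module k (ConstSp.{u, v, w} k F x) :=
  inferInstanceAs (Module k (constSub k F x))

/-- The values of the elements of `ConstSp`. -/
noncomputable def constVal (k : Type w) [Field k] (F : Set Q) (x : Q) : ConstSp.{u, v, w} k F x →ₗ[k] k :=
  ULift.moduleEquiv.toLinearMap ∘ₗ (constSub k F x).subtype

open Classical in
/-- The arrows of `constRep`. -/
noncomputable def constArrow (F : Set Q) {x y : Q} (_ : x ⟶ y) :
    ConstSp.{u, v, w} k F x →ₗ[k] ConstSp.{u, v, w} k F y :=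
  LinearMap.restrict (p := constSub k F x) (q := constSub k F y)
    ((if y ∈ F then (1 : k) else 0) • LinearMap.id) fun f _ hy => by
      rw [if_neg hy, zero_smul, LinearMap.zero_apply]

/-- The constant representation on the full subquiver generated by a set of vertices. -/
noncomputable def constRep (k : Type w) [Field k] (F : Set Q) : Rep.{u, v, w} k Q :=
  mkRep (ConstSp k F) (constArrow F)

variable {F : Set Q}

/-- The elements of `constRep` as scalars. -/
noncomputable def constC (k : Type w) [Field k] (F : Set Q) (x : Q) :
    sp (constRep.{u, v, w} k F) x →ₗ[k] k :=
  constVal k F x ∘ₗ (mkRepEquiv (ConstSp k F) (constArrow F) x).toLinearMap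

theorem constC_injective (x : Q) : Function.Injective (constC.{u, v, w} k F x) :=
  have h : Function.Injective (constVal.{u, v, w} k F x) :=
    (ULift.moduleEquiv (R := k)).injective.comp Subtype.val_injective
  h.comp (mkRepEquiv (ConstSp k F) (constArrow F) x).injective

theorem constC_eq_zero {x : Q} (h : x ∉ F) (m : sp (constRep.{u, v, w} k F) x) :
    constC k F x m = 0 :=
  congrArg ULift.down ((mkRepEquiv (ConstSp k F) (constArrow F) x m).2 h)

theorem exists_constC {x : Q} (h : x ∈ F) (c : k) : ∃ m, constC.{u, v, w} k F x m = c :=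
  ⟨(mkRepEquiv (ConstSp k F) (constArrow F) x).symm ⟨⟨c⟩, fun hx => absurd h hx⟩, rfl⟩

open Classical in
theorem constC_ar {x y : Q} (h : y ∈ F) (α : x ⟶ y) (m : sp (constRep.{u, v, w} k F) x) :
    constC k F y (ar _ α m) = constC k F x m := by
  have h1 := congrArg (constVal k F y) (mkRepEquiv_ar (ConstSp k F) (constArrow F) α m)
  refine h1.trans ?_
  have h2 : constVal k F y (constArrow F α (mkRepEquiv (ConstSp k F) (constArrow F) x m)) =
    (if y ∈ F then (1 : k) else 0) * constC k F x m := rfl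
  rw [h2, if_pos h, one_mul]

open Classical in
-- An endomorphism is a scalar at each vertex of `F`; along the arrows inside `F` the scalars agree,
-- so they are constant by connectedness.
theorem isBrick_constRep {z : Q} (hz : z ∈ F) (h : IsConn k F z) :
    IsBrick k (constRep.{u, v, w} k F) := by
  refine ⟨fun h0 => ?_, fun e => ?_⟩
  · obtain ⟨m, hm⟩ := exists_constC.{u, v, w} hz (1 : k)
    have := isZero_iff_sp.1 h0 z
    rw [Subsingleton.elim m 0, map_zero] at hm
    exact zero_ne_one hm
  · choose m hm using fun x : F => exists_constC.{u, v, w} x.2 (1 : k)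
    let c : Q → k := fun x => if h : x ∈ F then constC k F x (ev e x (m ⟨x, h⟩)) else 0
    have hc : ∀ x (n : sp (constRep.{u, v, w} k F) x),
        constC k F x (ev e x n) = c x * constC k F x n := by
      intro x n
      by_cases hx : x ∈ F
      · have h1 : n = constC k F x n • m ⟨x, hx⟩ := by
          apply constC_injective
          rw [map_smul, hm ⟨x, hx⟩, smul_eq_mul, mul_one]
        conv_lhs => rw [h1]
        rw [map_smul, map_smul, smul_eq_mul, mul_comm]
        have h2 : c x = constC k F x (ev e x (m ⟨x, hx⟩)) := dif_pos hx
        rw [h2]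
      · rw [constC_eq_zero hx, constC_eq_zero hx, mul_zero]
    have h1 := h c fun x hx y hy α => by
      have h2 := hc y (ar _ α (m ⟨x, hx⟩))
      rw [ev_ar, constC_ar hy, constC_ar hy, hm ⟨x, hx⟩, hc, hm ⟨x, hx⟩, mul_one, mul_one] at h2
      exact h2
    refine ⟨c z, rep_hom_ext fun x n => constC_injective x ?_⟩
    rw [hc, ev_smul, map_smul, ev_id, smul_eq_mul]
    by_cases hx : x ∈ F
    · rw [h1 x hx]
    · rw [constC_eq_zero hx, mul_zero, mul_zero]

theorem isFD_constRep (hF : F.Finite) : IsFD (constRep.{u, v, w} k F) where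
  fin x := Module.Finite.of_injective _ (constC_injective x)
  supp := by
    refine hF.subset fun x hx => ?_
    by_contra hc
    refine not_subsingleton_iff_nontrivial.2 hx ⟨fun a b => constC_injective x ?_⟩
    rw [constC_eq_zero hc, constC_eq_zero hc]

end Constant

/-! ### Injectivity of `trMap` from finiteness of predecessors -/

section Mono

variable {k : Type w} [Field k] {Q : Type u} [Quiver.{v} Q] [hQ : SLF Q]

/-- The vertices which support the finite dimensional local representations with non-zero
morphisms to `X`. -/
def homSupp (X : Rep.{u, v, w} k Q) : Set Q :=
  {x | ∃ Y : Rep.{u, v, w} k Q, IsLoc Y ∧ IsFD Y ∧ (∃ f : Y ⟶ X, f ≠ 0) ∧ Nontrivial (sp Y x)}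

/-- A kernel element would give non-zero morphisms to `M` from truncated injectives at some vertex
`z`. The hypothesis on `M` bounds the predecessors of `z`, so the full injective at `z` is finite
dimensional. The hypothesis on this injective then bounds the vertices of `Q`, which is impossible.
-/
theorem mono_trMap (hconn : Subsingleton (Quiver.WeaklyConnectedComponent Q)) (hinf : Infinite Q)
    (M : Rep.{u, v, w} k Q) [hM : IsFD M] (h : (homSupp M).Finite)
    (h' : ∀ Y : Rep.{u, v, w} k Q, IsLoc Y → IsFD Y → (∃ f : Y ⟶ M, f ≠ 0) → (homSupp Y).Finite) :
    Mono (trMap M) := by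
  by_contra hm
  obtain ⟨z, x, ⟨p⟩, hzx⟩ := exists_injRep_hom M hm
  have hpred : {y : Q | Nonempty (Quiver.Path y z)}.Finite := by
    refine h.subset ?_
    rintro y ⟨q⟩
    -- The truncation to the successors of `x` and `y` is finite dimensional by interval-finiteness,
    -- still maps to `M`, and has `y` in its support.
    have hU : ∀ a b : Q, (a ⟶ b) → a ∈ Succ {x, y} → b ∈ Succ {x, y} := fun a b α ha => Succ.arrow ha α
    have hx : x ∈ Succ {x, y} := subset_Succ _ (Or.inl rfl)
    have hy : y ∈ Succ {x, y} := subset_Succ _ (Or.inr rfl)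
    refine ⟨injRep k hU z, isLoc_injRep (Succ.path hx p), isFD_injRep ?_, hzx _ hU hx,
      nontrivial_injRep hy q⟩
    refine (finite_between (Set.toFinite {x, y}) (Set.finite_singleton z)).subset ?_
    rintro b ⟨hb, q₂⟩
    exact ⟨hb, z, rfl, q₂⟩
  have hU : ∀ a b : Q, (a ⟶ b) → a ∈ (Set.univ : Set Q) → b ∈ (Set.univ : Set Q) :=
    fun _ _ _ _ => trivial
  have hfin := h' (injRep k hU z) (isLoc_injRep trivial)
    (isFD_injRep (hpred.subset fun y hy => hy.2)) (hzx _ hU trivial)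
  -- For every vertex `y`, the constant representation on a finite connected set containing `y` and
  -- `z` is a brick with a non-zero morphism to the injective at `z`.
  refine Set.infinite_univ (α := Q) (hfin.subset fun y _ => ?_)
  obtain ⟨F, hF, hz, hy, hc⟩ := exists_isConn k hconn z y
  obtain ⟨m, hm⟩ := exists_constC.{u, v, w} hz (1 : k)
  obtain ⟨n, hn⟩ := exists_constC.{u, v, w} hy (1 : k)
  refine ⟨constRep k F, (isBrick_constRep hz hc).isLoc, isFD_constRep hF,
    ⟨toInj (constC k F z), toInj_ne_zero fun h0 => ?_⟩, n, 0, fun h0 => ?_⟩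
  · rw [h0] at hm
    exact zero_ne_one hm
  · rw [h0, map_zero] at hn
    exact zero_ne_one hn

end Mono

/-! ### The iterated inverse translates of the projectives -/

section Preprojective

variable {k : Type w} [Field k] {Q : Type u} [Quiver.{v} Q] [hQ : SLF Q]

variable (k) in
/-- The iterated inverse translates of the `P_x`. -/
noncomputable def XO : ℕ → Q → RepPlus.{u, v, w} k Q
  | 0, x => prObj k x
  | n + 1, x => trdObj (XO n x)

variable (k) in
/-- The condition for the `n`-th inverse translate of `P_x` to be defined. -/
def Dom (n : ℕ) (x : Q) : Prop := ∀ m < n, IsFD (XO.{u, v, w} k m x).obj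

theorem dom_zero (x : Q) : Dom.{u, v, w} k 0 x := fun _ h => absurd h (Nat.not_lt_zero _)

theorem dom_succ_iff {n : ℕ} {x : Q} :
    Dom.{u, v, w} k (n + 1) x ↔ Dom.{u, v, w} k n x ∧ IsFD (XO.{u, v, w} k n x).obj := by
  constructor
  · exact fun h => ⟨fun m hm => h m (hm.trans n.lt_succ_self), h n n.lt_succ_self⟩
  · rintro ⟨h, h'⟩ m hm
    rcases Nat.lt_succ_iff_lt_or_eq.1 hm with hm | rfl
    · exact h m hm
    · exact h'

theorem Dom.mono {m n : ℕ} {x : Q} (h : Dom.{u, v, w} k n x) (hm : m ≤ n) : Dom.{u, v, w} k m x :=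
  fun l hl => h l (hl.trans_le hm)

/-- The vertices of the component of the projectives around `(n, x)`, in the direction of its
predecessors. -/
def Pred (n : ℕ) (x : Q) (m : ℕ) (y : Q) : Prop :=
  (m = n ∧ Nonempty (x ⟶ y)) ∨ (m + 1 = n ∧ Nonempty (y ⟶ x))

theorem finite_pred (n : ℕ) (x : Q) : {p : ℕ × Q | Pred n x p.1 p.2}.Finite := by
  refine ((Set.finite_range fun s : Σ y : Q, (x ⟶ y) => (n, s.1)).union
    (Set.finite_range fun s : Σ y : Q, (y ⟶ x) => (n - 1, s.1))).subset ?_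
  rintro ⟨m, y⟩ (⟨h, ⟨α⟩⟩ | ⟨h, ⟨α⟩⟩)
  · obtain rfl : m = n := h
    exact Or.inl ⟨⟨y, α⟩, rfl⟩
  · obtain rfl : m + 1 = n := h
    exact Or.inr ⟨⟨y, α⟩, rfl⟩

/-- The properties of the `n`-th inverse translate of `P_x`. -/
structure IsGood (k : Type w) [Field k] (n : ℕ) (x : Q) : Prop where
  brick : IsBrick k (XO.{u, v, w} k n x)
  tf : IsTF (XO.{u, v, w} k n x).obj
  exists_ras : ∃ (A E : RepPlus.{u, v, w} k Q) (f : A ⟶ E) (g : E ⟶ XO k n x),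
    IsRightAlmostSplit g ∧ InRad f ∧ (∀ (W : RepPlus.{u, v, w} k Q) (h : W ⟶ E), h ≫ g = 0 →
      ∃ l, l ≫ f = h) ∧ (IsFD (XO.{u, v, w} k n x).obj → IsFD E.obj)
  exists_iso_left : ∀ Y : RepPlus.{u, v, w} k Q, IsLoc Y → IrrNZ Y (XO k n x) →
    ∃ m y, Dom.{u, v, w} k m y ∧ Nonempty (Y ≅ XO k m y) ∧ Pred n x m y

theorem isFD_radObj (x : Q) (h : IsFD (prObj.{u, v, w} k x).obj) : IsFD (radObj.{u, v, w} k x).obj := by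
  have hi : ∀ y, Function.Injective (ev (radIncl.{u, v, w} k x) y) := (mono_iff_ev _).1 inferInstance
  refine ⟨fun y => ?_, h.supp.subset fun y hy => ?_⟩
  · have := h.fin y
    exact Module.Finite.of_injective _ (hi y)
  · have : Nontrivial (sp (Fr k (outEnd.{u, v, w} x)) y) := hy
    exact (hi y).nontrivial

theorem isGood_zero (x : Q) : IsGood.{u, v, w} k 0 x where
  brick := isBrick_prObj x
  tf := isTF_of_projective (Y := Fr k _)
  exists_ras := ⟨_, _, _, _, isRightAlmostSplit_radInclObj x, InRad.zero _ _, radInclObj_kernel x,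
    isFD_radObj x⟩
  exists_iso_left Y hY h := by
    obtain ⟨y, α, e⟩ := h.exists_iso_prObj hY
    exact ⟨0, y, dom_zero y, e, Or.inl ⟨rfl, α⟩⟩

theorem finite_succ_of_isFD {x : Q} (h : IsFD (prObj.{u, v, w} k x).obj) : (Succ {x}).Finite := by
  refine h.supp.subset ?_
  rintro y ⟨x', hx, ⟨p⟩⟩
  obtain rfl : x' = x := hx
  refine ⟨frSingle.{u, v, w} k (fun _ : PUnit.{max u v w + 1} => x') PUnit.unit p, 0, fun h0 => ?_⟩
  have h1 := congrArg (frC (fun _ : PUnit.{max u v w + 1} => x') y) h0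
  rw [frSingle, LinearEquiv.apply_symm_apply] at h1
  exact Finsupp.single_ne_zero.2 one_ne_zero (h1.trans (map_zero _))

theorem ncard_succ_lt {x y : Q} (h : (Succ {x}).Finite) (α : x ⟶ y) :
    (Succ {y}).ncard < (Succ {x}).ncard := by
  refine Set.ncard_lt_ncard ?_ h
  constructor
  · rintro z ⟨_, rfl, ⟨p⟩⟩
    exact ⟨x, rfl, ⟨α.toPath.comp p⟩⟩
  · intro hs
    obtain ⟨_, rfl, ⟨p⟩⟩ := hs (subset_Succ _ rfl : x ∈ Succ {x})
    exact (isEmpty_hom_of_path p).false α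

variable (k) in
/-- There are only finitely many local objects with non-zero morphisms to `XO n x`. -/
def HasFinPreds (n : ℕ) (x : Q) : Prop := ∃ L : Set (ℕ × Q), L.Finite ∧
  (∀ p ∈ L, p.1 ≤ n ∧ Dom.{u, v, w} k (p.1 + 1) p.2) ∧ ∀ Y : RepPlus.{u, v, w} k Q, IsLoc Y →
    (∃ f : Y ⟶ XO k n x, f ≠ 0) → ∃ p ∈ L, Nonempty (Y ≅ XO k p.1 p.2)

/-- A non-isomorphism factors through the right almost split morphism, and the composite survives in
a local summand of its source. This summand is a known predecessor, finite dimensional because the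
source is. -/
theorem IsGood.exists_factor {n : ℕ} {x : Q} (h : IsGood.{u, v, w} k n x)
    (hfd : IsFD (XO.{u, v, w} k n x).obj) {Y : RepPlus.{u, v, w} k Q} (hY : IsLoc Y)
    (f : Y ⟶ XO k n x) (hf : f ≠ 0) : Nonempty (Y ≅ XO k n x) ∨ ∃ m y, Pred n x m y ∧
      Dom.{u, v, w} k (m + 1) y ∧ ∃ f : Y ⟶ XO k m y, f ≠ 0 := by
  obtain ⟨A, E, a, g, hg, ha, hag, hE⟩ := h.exists_ras
  by_cases hs : IsSplitEpi f
  · left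
    have hi := hY.isIso_of_isSplitMono h.brick.1 (section_ f) f (IsSplitEpi.id f)
    exact ⟨(asIso (section_ f)).symm⟩
  · right
    obtain ⟨f, rfl⟩ := hg.2 _ f hs
    have hf' : f.hom ≫ g.hom ≠ 0 := fun h0 => hf (ObjectProperty.hom_ext _ h0)
    obtain ⟨Z, i, r, hZ, hir, hne⟩ := (isFP_obj E).exists_local_summand f.hom g.hom hf'
    let Z' : RepPlus.{u, v, w} k Q := fpObj ((isFP_obj E).of_retract i r hir)
    have hZ' : IsLoc Z' := isLoc_obj_iff.1 hZ
    let i' : Z' ⟶ E := ObjectProperty.homMk i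
    let r' : E ⟶ Z' := ObjectProperty.homMk r
    have hir' : i' ≫ r' = 𝟙 Z' := ObjectProperty.hom_ext _ hir
    have hirr : IrrNZ Z' (XO k n x) := (irrNZ_right_iff hg h.brick.isLoc ha hag).2
      ⟨i', (not_inRad_iff' hZ').2 ⟨r', by rw [hir']; infer_instance⟩⟩
    obtain ⟨m, y, hD, ⟨e⟩, hp⟩ := h.exists_iso_left Z' hZ' hirr
    have hZfd : IsFD Z := (hE hfd).of_retract i r hir
    refine ⟨m, y, hp, dom_succ_iff.2 ⟨hD, hZfd.of_iso ((ObjectProperty.ι _).mapIso e)⟩,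
      (f ≫ r') ≫ e.hom, fun h0 => hne ?_⟩
    have h1 : f ≫ r' = 0 := by rw [← cancel_mono e.hom, h0, Limits.zero_comp]
    have h2 : f.hom ≫ r = 0 := congrArg (fun t => t.hom) h1
    rw [← Category.assoc, h2, Limits.zero_comp]

/-- The recursion of `IsGood.exists_factor` ends: a predecessor lies on a lower level or is `(n, y)`
for an arrow from `x` to `y`, and then `y` has fewer successors than `x`. The successors of `x` are
finite in number because `P_x`, being in the orbit, is finite dimensional. -/
theorem hasFinPreds_of_isGood {N : ℕ}
    (H : ∀ m ≤ N, ∀ x : Q, Dom.{u, v, w} k m x → IsGood.{u, v, w} k m x) :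
    ∀ n ≤ N, ∀ x : Q, Dom.{u, v, w} k (n + 1) x → HasFinPreds.{u, v, w} k n x := by
  intro n
  induction n using Nat.strong_induction_on with
  | _ n ih =>
    intro hn x
    induction hc : (Succ {x}).ncard using Nat.strong_induction_on generalizing x with
    | _ c ihc =>
      intro hD
      have hfin := finite_succ_of_isFD (hD 0 n.succ_pos)
      have key : ∀ p : ℕ × Q, ∃ L : Set (ℕ × Q), L.Finite ∧
          (∀ q ∈ L, q.1 ≤ n ∧ Dom.{u, v, w} k (q.1 + 1) q.2) ∧ (Pred n x p.1 p.2 →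
            Dom.{u, v, w} k (p.1 + 1) p.2 → ∀ Y : RepPlus.{u, v, w} k Q, IsLoc Y →
              (∃ f : Y ⟶ XO k p.1 p.2, f ≠ 0) → ∃ q ∈ L, Nonempty (Y ≅ XO k q.1 q.2)) := by
        rintro ⟨m, y⟩
        by_cases hp : Pred n x m y ∧ Dom.{u, v, w} k (m + 1) y
        · obtain ⟨hp, hDy⟩ := hp
          have hle : m ≤ n := by rcases hp with hp | hp <;> omega
          have : HasFinPreds.{u, v, w} k m y := by
            rcases hp with ⟨rfl, ⟨α⟩⟩ | ⟨rfl, -⟩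
            · exact ihc _ (hc ▸ ncard_succ_lt hfin α) y rfl hDy
            · exact ih m m.lt_succ_self (by omega) y hDy
          obtain ⟨L, hL, hL1, hL2⟩ := this
          exact ⟨L, hL, fun q hq => ⟨(hL1 q hq).1.trans hle, (hL1 q hq).2⟩, fun _ _ => hL2⟩
        · exact ⟨∅, Set.finite_empty, fun q hq => hq.elim, fun h1 h2 => absurd ⟨h1, h2⟩ hp⟩
      choose L hL hL1 hL2 using key
      refine ⟨insert (n, x) (⋃ p ∈ {p : ℕ × Q | Pred n x p.1 p.2}, L p),
        ((finite_pred n x).biUnion fun p _ => hL p).insert _, ?_, ?_⟩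
      · rintro q (rfl | hq)
        · exact ⟨le_rfl, hD⟩
        · simp only [Set.mem_iUnion] at hq
          obtain ⟨p, -, hq⟩ := hq
          exact hL1 p q hq
      · rintro Y hY ⟨f, hf⟩
        rcases (H n hn x (dom_succ_iff.1 hD).1).exists_factor (dom_succ_iff.1 hD).2 hY f hf with
          he | ⟨m, y, hp, hDy, hf'⟩
        · exact ⟨_, Or.inl rfl, he⟩
        · obtain ⟨q, hq, he⟩ := hL2 (m, y) hp hDy Y hY hf'
          exact ⟨q, Or.inr (Set.mem_biUnion (show (m, y) ∈ {p : ℕ × Q | Pred n x p.1 p.2} from hp) hq), he⟩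

theorem HasFinPreds.finite_homSupp {n : ℕ} {x : Q} (h : HasFinPreds.{u, v, w} k n x) :
    (homSupp (XO.{u, v, w} k n x).obj).Finite := by
  obtain ⟨L, hL, hL1, hL2⟩ := h
  refine (hL.biUnion (t := fun p => {y | Nontrivial (sp (XO.{u, v, w} k p.1 p.2).obj y)})
    fun p hp => ((dom_succ_iff.1 (hL1 p hp).2).2).supp).subset ?_
  rintro y ⟨Y, hY, hfd, ⟨f, hf⟩, hy⟩
  obtain ⟨p, hp, ⟨e⟩⟩ := hL2 (fpObj hfd.isFP) (isLoc_obj_iff.1 hY)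
    ⟨ObjectProperty.homMk f, fun h0 => hf (congrArg (fun t => t.hom) h0)⟩
  refine Set.mem_biUnion hp ?_
  have hi := (isIso_iff_ev e.hom.hom).1 ((isIso_hom_iff _).2 inferInstance) y
  have : Nontrivial (sp (fpObj hfd.isFP).obj y) := hy
  exact hi.1.nontrivial

theorem homSupp_subset {X Y : Rep.{u, v, w} k Q} (e : X ≅ Y) : homSupp X ⊆ homSupp Y := by
  rintro y ⟨Z, hZ, hfd, ⟨f, hf⟩, hy⟩
  refine ⟨Z, hZ, hfd, ⟨f ≫ e.hom, fun h0 => hf ?_⟩, hy⟩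
  rw [← cancel_mono e.hom, h0, Limits.zero_comp]

variable (hconn : Subsingleton (Quiver.WeaklyConnectedComponent Q)) (hinf : Infinite Q)

include hconn hinf in
-- The finiteness of predecessors is used for the object and once more for its predecessors, which
-- belong to the same list.
theorem mono_trMap_XO {N : ℕ} (H : ∀ m ≤ N, ∀ x : Q, Dom.{u, v, w} k m x → IsGood.{u, v, w} k m x)
    (n : ℕ) (hn : n ≤ N) (x : Q) (hD : Dom.{u, v, w} k n x) (hfd : IsFD (XO.{u, v, w} k n x).obj) :
    Mono (trMap (XO.{u, v, w} k n x).obj) := by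
  have h := hasFinPreds_of_isGood H n hn x (dom_succ_iff.2 ⟨hD, hfd⟩)
  refine mono_trMap hconn hinf _ h.finite_homSupp fun Y hY hYfd ⟨f, hf⟩ => ?_
  obtain ⟨L, hL, hL1, hL2⟩ := h
  obtain ⟨p, hp, ⟨e⟩⟩ := hL2 (fpObj hYfd.isFP) (isLoc_obj_iff.1 hY)
    ⟨ObjectProperty.homMk f, fun h0 => hf (congrArg (fun t => t.hom) h0)⟩
  have h1 := hasFinPreds_of_isGood H p.1 ((hL1 p hp).1.trans hn) p.2 (hL1 p hp).2
  exact h1.finite_homSupp.subset (homSupp_subset ((ObjectProperty.ι _).mapIso e))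

include hconn hinf in
-- `IsTF` passes from `XO N x` to `Y`. If `Y` is not projective, it has a finite dimensional
-- translate `T`, which is a predecessor of `XO N x` and so some `XO m y`; translating back
-- identifies `Y`. The coordinates shift by one level, whence `Pred (N + 1) x`.
theorem exists_iso_right {N : ℕ} (H : ∀ m ≤ N, ∀ x : Q, Dom.{u, v, w} k m x → IsGood.{u, v, w} k m x)
    (x : Q) (hD : Dom.{u, v, w} k N x) (Y : RepPlus.{u, v, w} k Q) (hY : IsLoc Y)
    (hXY : IrrNZ (XO k N x) Y) :
    ∃ m y, Dom.{u, v, w} k m y ∧ Nonempty (Y ≅ XO k m y) ∧ Pred (N + 1) x m y := by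
  have hG := H N le_rfl x hD
  have hTF := hG.tf.of_irrNZ hG.brick.isLoc hY hXY
  by_cases hP : ∃ y, Nonempty (Y ≅ prObj k y)
  · obtain ⟨y, ⟨e⟩⟩ := hP
    refine ⟨0, y, dom_zero y, ⟨e⟩, ?_⟩
    obtain ⟨z, ⟨α⟩, ⟨e'⟩⟩ := (hXY.congr (Iso.refl _) e).exists_iso_prObj hG.brick.isLoc
    cases N with
    | zero =>
      have hxz : x = z := eq_of_iso_Pr (k := k) ((ObjectProperty.ι _).mapIso e')
      subst hxz
      exact Or.inr ⟨rfl, ⟨α⟩⟩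
    | succ n =>
      -- A predecessor of `P_y` is projective, while inverse translates have no non-zero morphisms
      -- to projectives.
      exfalso
      obtain ⟨hDn, hfdn⟩ := dom_succ_iff.1 hD
      have hm := mono_trMap_XO hconn hinf H n n.le_succ x hDn hfdn
      have h0 := hom_star_trdObj (XO k n x) hm (isStar_Fr (k := k) fun _ : PUnit => z) e'.hom.hom
      refine hG.brick.1 ?_
      rw [Limits.IsZero.iff_id_eq_zero, ← e'.hom_inv_id]
      have h1 : e'.hom = 0 := ObjectProperty.hom_ext _ h0
      rw [h1, Limits.zero_comp]
  · push Not at hP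
    obtain ⟨T, hTfd, hT, ⟨E, f, g, hfg⟩, hTM⟩ := exists_translate hY hTF
      fun y hy => (hP y).false hy.some
    have hTX := (hfg.irrNZ_iff hT hY hG.brick.isLoc).2 hXY
    obtain ⟨m, y, hDy, ⟨e⟩, hp⟩ := hG.exists_iso_left T hT hTX
    have hle : m ≤ N := by rcases hp with hp | hp <;> omega
    have hfdy : IsFD (XO.{u, v, w} k m y).obj := hTfd.of_iso ((ObjectProperty.ι _).mapIso e)
    have hm := mono_trMap_XO hconn hinf H m hle y hDy hfdy
    refine ⟨m + 1, y, dom_succ_iff.2 ⟨hDy, hfdy⟩, hTM _ hfdy hm ⟨e⟩, ?_⟩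
    rcases hp with ⟨rfl, h⟩ | ⟨rfl, h⟩
    · exact Or.inl ⟨rfl, h⟩
    · exact Or.inr ⟨rfl, h⟩

include hconn hinf in
-- All levels up to `N` are treated together, since injectivity of `trMap` needs the predecessors of
-- all earlier objects. The irreducible morphisms ending in `XO (N + 1) x` are those starting in `XO
-- N x`, which `exists_iso_right` describes.
theorem isGood_XO (n : ℕ) (x : Q) (hD : Dom.{u, v, w} k n x) : IsGood.{u, v, w} k n x := by
  suffices H : ∀ N, ∀ m ≤ N, ∀ x : Q, Dom.{u, v, w} k m x → IsGood.{u, v, w} k m x from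
    H n n le_rfl x hD
  clear hD x n
  intro N
  induction N with
  | zero =>
    intro m hm x _
    obtain rfl : m = 0 := Nat.le_zero.1 hm
    exact isGood_zero x
  | succ N H =>
    intro m hm x hD
    rcases Nat.le_succ_iff.1 hm with hm | rfl
    · exact H m hm x hD
    obtain ⟨hDN, hfd⟩ := dom_succ_iff.1 hD
    have hG := H N le_rfl x hDN
    have hmono := mono_trMap_XO hconn hinf H N le_rfl x hDN hfd
    have hb := isBrick_trdObj hmono hG.brick
    obtain ⟨E, f, g, hfg, hE⟩ := exists_isAlmostSplitSeq_trdObj hmono hG.brick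
    refine ⟨hb, isTF_trdObj hmono, ⟨_, E, f, g, hfg.right_almostSplit,
      hfg.inRad_left hG.brick.isLoc, hfg.pseudoKernel.2, hE⟩, fun Y hY h => ?_⟩
    exact exists_iso_right hconn hinf H x hDN Y hY
      ((hfg.irrNZ_iff hG.brick.isLoc hb.isLoc hY).2 h)

end Preprojective

/-! ### Uniqueness of the starting term, and invariance of `irr` -/

section AlmostSplit

variable {C : Type u} [Category.{v} C] [Preadditive C]

theorem IsAlmostSplitSeq.left_ne_zero {X E Z : C} {f : X ⟶ E} {g : E ⟶ Z}
    (h : IsAlmostSplitSeq f g) : f ≠ 0 := by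
  rintro rfl
  have h1 := h.left_minimal 0 Limits.zero_comp
  exact h.mid_ne_zero ((Limits.IsZero.iff_id_eq_zero E).2 (by
    rw [← IsIso.hom_inv_id (0 : E ⟶ E), Limits.zero_comp]))

theorem IsAlmostSplitSeq.right_ne_zero {X E Z : C} {f : X ⟶ E} {g : E ⟶ Z}
    (h : IsAlmostSplitSeq f g) : g ≠ 0 := by
  rintro rfl
  have h1 := h.right_minimal 0 Limits.comp_zero
  exact h.mid_ne_zero ((Limits.IsZero.iff_id_eq_zero E).2 (by
    rw [← IsIso.hom_inv_id (0 : E ⟶ E), Limits.zero_comp]))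

/-- Right minimality makes `a` invertible. If `m` were not invertible it would factor as `f t`; then
`t f a⁻¹` fixes `f`, so it is invertible by left minimality, but it is annihilated by `g`, and `g ≠
0`. -/
theorem IsAlmostSplitSeq.isIso_of_comp {X E Z : C} {f : X ⟶ E} {g : E ⟶ Z}
    (h : IsAlmostSplitSeq f g) (hX : IsLoc X) {m : X ⟶ X} {a : E ⟶ E} (ha : a ≫ g = g)
    (hm : m ≫ f = f ≫ a) : IsIso m := by
  have := h.right_minimal a ha
  by_contra hc
  have hs : ¬ IsSplitMono m := fun hs =>
    hc (hX.isIso_of_isSplitMono hX.1 m (retraction m) (IsSplitMono.id m))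
  obtain ⟨t, ht⟩ := h.left_almostSplit.2 _ m hs
  have h1 := h.left_minimal (t ≫ f ≫ inv a) (by
    rw [← Category.assoc, ht, ← Category.assoc, hm, Category.assoc, IsIso.hom_inv_id,
      Category.comp_id])
  apply h.right_ne_zero
  rw [← cancel_epi (t ≫ f ≫ inv a), Limits.comp_zero, Category.assoc, Category.assoc]
  have h2 : inv a ≫ g = g := by rw [IsIso.inv_comp_eq, ha]
  rw [h2, h.pseudoKernel.1, Limits.comp_zero]

/-- The starting term of an almost split sequence is determined by the ending term. -/
theorem IsAlmostSplitSeq.nonempty_iso_left {X E Z X' E' Z' : C} {f : X ⟶ E} {g : E ⟶ Z}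
    {f' : X' ⟶ E'} {g' : E' ⟶ Z'} (h : IsAlmostSplitSeq f g) (h' : IsAlmostSplitSeq f' g')
    (hX : IsLoc X) (hX' : IsLoc X') (e : Z ≅ Z') : Nonempty (X ≅ X') := by
  obtain ⟨a, ha⟩ := h'.right_almostSplit.2 _ (g ≫ e.hom) fun hs => h.right_almostSplit.1
    (IsSplitEpi.mk' ⟨e.hom ≫ section_ (g ≫ e.hom), by
      rw [← cancel_mono e.hom, Category.assoc, Category.assoc, IsSplitEpi.id]; simp⟩)
  obtain ⟨b, hb⟩ := h.right_almostSplit.2 _ (g' ≫ e.inv) fun hs => h'.right_almostSplit.1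
    (IsSplitEpi.mk' ⟨e.inv ≫ section_ (g' ≫ e.inv), by
      rw [← cancel_mono e.inv, Category.assoc, Category.assoc, IsSplitEpi.id]; simp⟩)
  obtain ⟨l, hl⟩ := h'.pseudoKernel.2 _ (f ≫ a) (by
    rw [Category.assoc, ha, ← Category.assoc, h.pseudoKernel.1, Limits.zero_comp])
  obtain ⟨l', hl'⟩ := h.pseudoKernel.2 _ (f' ≫ b) (by
    rw [Category.assoc, hb, ← Category.assoc, h'.pseudoKernel.1, Limits.zero_comp])
  have h1 : IsIso (l ≫ l') := h.isIso_of_comp hX (a := a ≫ b)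
    (by rw [Category.assoc, hb, ← Category.assoc, ha]; simp)
    (by rw [Category.assoc, hl', ← Category.assoc, hl, Category.assoc])
  have h2 := hX'.isIso_of_isSplitMono hX.1 l (l' ≫ inv (l ≫ l')) (by
    rw [← Category.assoc, IsIso.hom_inv_id])
  exact ⟨asIso l⟩

variable (k : Type w) [Field k] [Linear k C]

theorem irrK_congr {X Y X' Y' : C} (e : X ≅ X') (e' : Y ≅ Y') : irrK k X Y = irrK k X' Y' := by
  let T : (X ⟶ Y) ≃ₗ[k] (X' ⟶ Y') := Linear.homCongr k e e'
  have hT : ∀ f, T f = e.inv ≫ f ≫ e'.hom := fun f => by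
    simp [T, Linear.homCongr_apply]
  have hT' : ∀ f, e.hom ≫ T f ≫ e'.inv = f := fun f => by
    rw [hT]; simp
  have h1 : (radK k X Y).map T.toLinearMap = radK k X' Y' := by
    ext f
    rw [Submodule.mem_map]
    constructor
    · rintro ⟨g, hg, rfl⟩
      have hg' : InRad g := hg
      have := (hg'.comp_right e'.hom).comp_left e.inv
      rw [← hT] at this
      exact this
    · intro hf
      obtain ⟨g, rfl⟩ := T.surjective f
      have hf' : InRad (T g) := hf
      have := (hf'.comp_right e'.inv).comp_left e.hom
      rw [hT'] at this
      exact ⟨g, this, rfl⟩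
  refine (Submodule.Quotient.equiv _ _ (T.submoduleMap (radK k X Y) ≪≫ₗ
    LinearEquiv.ofEq _ _ h1) ?_).finrank_eq
  ext ⟨f, hf⟩
  rw [Submodule.mem_map]
  constructor
  · rintro ⟨⟨g, hg⟩, hg2, hgf⟩
    have h2 : T g = f := congrArg Subtype.val hgf
    have hg3 : g ∈ rad2 X Y := hg2
    have := rad2_comp_left (rad2_comp_right hg3 e'.hom) e.inv
    rw [← hT, h2] at this
    exact this
  · intro hf2
    have hf3 : f ∈ rad2 X' Y' := hf2
    obtain ⟨g, rfl⟩ := T.surjective f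
    have hg := rad2_comp_left (rad2_comp_right hf3 e'.inv) e.hom
    rw [hT'] at hg
    have hr : InRad (T g) := hf
    have hr2 := (hr.comp_right e'.inv).comp_left e.hom
    rw [hT'] at hr2
    exact ⟨⟨g, hr2⟩, hg, Subtype.ext rfl⟩

end AlmostSplit

/-! ### Coordinates, translation and numbers of arrows -/

section Preprojective

variable {k : Type w} [Field k] {Q : Type u} [Quiver.{v} Q] [hQ : SLF Q]

/-- By uniqueness of minimal right almost split morphisms, `g` would be isomorphic to the inclusion
of the radical, a monomorphism, and `f` would be zero. -/
theorem not_isAlmostSplitSeq_prObj {X E : RepPlus.{u, v, w} k Q} {x : Q} (f : X ⟶ E)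
    (g : E ⟶ prObj k x) : ¬ IsAlmostSplitSeq f g := by
  intro h
  have hm : ∀ {W : RepPlus.{u, v, w} k Q} (a : W ⟶ radObj k x), a ≫ radInclObj k x = 0 → a = 0 := by
    intro W a ha
    obtain ⟨l, rfl⟩ := radInclObj_kernel x W a ha
    exact Limits.comp_zero
  obtain ⟨e, he⟩ := exists_iso_of_isRightAlmostSplit h.right_almostSplit h.right_minimal
    (isRightAlmostSplit_radInclObj x) (fun a ha => by
      have h1 := hm (a - 𝟙 _) (by rw [Preadditive.sub_comp, ha, Category.id_comp, sub_self])
      rw [sub_eq_zero.1 h1]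
      infer_instance)
  apply h.left_ne_zero
  rw [← cancel_mono e.hom, Limits.zero_comp]
  exact hm _ (by rw [Category.assoc, he, h.pseudoKernel.1])

variable (hconn : Subsingleton (Quiver.WeaklyConnectedComponent Q)) (hinf : Infinite Q)

include hconn hinf in
theorem mono_trMap_of_dom {n : ℕ} {x : Q} (hD : Dom.{u, v, w} k n x)
    (hfd : IsFD (XO.{u, v, w} k n x).obj) : Mono (trMap (XO.{u, v, w} k n x).obj) :=
  mono_trMap_XO hconn hinf (N := n) (fun m _ x h => isGood_XO hconn hinf m x h) n le_rfl x hD hfd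

include hconn hinf in
theorem exists_isAlmostSplitSeq_XO {n : ℕ} {x : Q} (hD : Dom.{u, v, w} k (n + 1) x) :
    ∃ (E : RepPlus.{u, v, w} k Q) (f : XO k n x ⟶ E) (g : E ⟶ XO k (n + 1) x),
      IsAlmostSplitSeq f g := by
  obtain ⟨hD, hfd⟩ := dom_succ_iff.1 hD
  obtain ⟨E, f, g, h, -⟩ := exists_isAlmostSplitSeq_trdObj (mono_trMap_of_dom hconn hinf hD hfd)
    (isGood_XO hconn hinf n x hD).brick
  exact ⟨E, f, g, h⟩

include hconn hinf in
-- Almost split sequences allow the translation to be undone on both sides until a projective is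
-- reached; an inverse translate is not projective.
theorem eq_of_iso_XO {n m : ℕ} {x y : Q} (hx : Dom.{u, v, w} k n x) (hy : Dom.{u, v, w} k m y)
    (e : XO.{u, v, w} k n x ≅ XO k m y) : n = m ∧ x = y := by
  have key : ∀ {n : ℕ} {x y : Q}, Dom.{u, v, w} k (n + 1) x →
      (XO.{u, v, w} k (n + 1) x ≅ prObj k y) → False := by
    intro n x y hD e
    obtain ⟨E, f, g, h⟩ := exists_isAlmostSplitSeq_XO hconn hinf hD
    have hG := isGood_XO hconn hinf (n + 1) x hD
    obtain ⟨h1, hfd⟩ := dom_succ_iff.1 hD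
    have h0 := hom_star_trdObj (XO k n x) (mono_trMap_of_dom hconn hinf h1 hfd)
      (isStar_Fr (k := k) fun _ : PUnit => y) e.hom.hom
    refine hG.brick.1 ?_
    rw [Limits.IsZero.iff_id_eq_zero, ← e.hom_inv_id]
    have h1 : e.hom = 0 := ObjectProperty.hom_ext _ h0
    rw [h1, Limits.zero_comp]
  induction n generalizing m with
  | zero =>
    cases m with
    | zero => exact ⟨rfl, eq_of_iso_Pr (k := k) ((ObjectProperty.ι _).mapIso e)⟩
    | succ m => exact (key hy e.symm).elim
  | succ n ih =>
    cases m with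
    | zero => exact (key hx e).elim
    | succ m =>
      obtain ⟨E, f, g, h⟩ := exists_isAlmostSplitSeq_XO hconn hinf hx
      obtain ⟨E', f', g', h'⟩ := exists_isAlmostSplitSeq_XO hconn hinf hy
      have hx' := (dom_succ_iff.1 hx).1
      have hy' := (dom_succ_iff.1 hy).1
      obtain ⟨e'⟩ := h.nonempty_iso_left h' (isGood_XO hconn hinf n x hx').brick.isLoc
        (isGood_XO hconn hinf m y hy').brick.isLoc e
      obtain ⟨rfl, rfl⟩ := ih hx' hy' e'
      exact ⟨rfl, rfl⟩

include hconn hinf in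
/-- The translation. -/
theorem exists_eq_succ_of_isAlmostSplitSeq {X E : RepPlus.{u, v, w} k Q} (hX : IsLoc X) {m : ℕ} {y : Q}
    (hy : Dom.{u, v, w} k m y) {f : X ⟶ E} {g : E ⟶ XO k m y} (h : IsAlmostSplitSeq f g) :
    ∃ n, m = n + 1 ∧ Nonempty (X ≅ XO k n y) := by
  cases m with
  | zero => exact (not_isAlmostSplitSeq_prObj f g h).elim
  | succ n =>
    obtain ⟨E', f', g', h'⟩ := exists_isAlmostSplitSeq_XO hconn hinf hy
    exact ⟨n, rfl, h.nonempty_iso_left h' hX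
      (isGood_XO hconn hinf n y (dom_succ_iff.1 hy).1).brick.isLoc (Iso.refl _)⟩

include hconn hinf in
open Classical in
-- By the knitting rule, `irr(X, τ⁻¹Y)` has the dimension of `irr(Y, X)`. Each such exchange lowers
-- the sum of the levels by one, and the numbers for projectives count the arrows of `Q`.
theorem irrK_XO {n m : ℕ} {x y : Q} (hx : Dom.{u, v, w} k n x) (hy : Dom.{u, v, w} k m y) :
    irrK k (XO.{u, v, w} k n x) (XO k m y) =
      if n = m then Nat.card (y ⟶ x) else if n + 1 = m then Nat.card (x ⟶ y) else 0 := by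
  induction hs : n + m using Nat.strong_induction_on generalizing n m x y with
  | _ s ih =>
    have hGx := isGood_XO hconn hinf n x hx
    cases m with
    | zero =>
      cases n with
      | zero =>
        rw [if_pos rfl]
        exact irrK_prObj y x
      | succ n =>
        rw [if_neg (by omega), if_neg (by omega)]
        by_contra h
        obtain ⟨z, -, ⟨e⟩⟩ := IrrNZ.exists_iso_prObj hGx.brick.isLoc
          ((irrK_pos_iff k).1 (Nat.pos_of_ne_zero h))
        exact absurd (eq_of_iso_XO hconn hinf hx (dom_zero z) e).1 (by omega)
    | succ m =>
      obtain ⟨E, f, g, h⟩ := exists_isAlmostSplitSeq_XO hconn hinf hy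
      have hy' := (dom_succ_iff.1 hy).1
      rw [← irrK_eq_of_isAlmostSplitSeq k h (isGood_XO hconn hinf m y hy').brick.isLoc
        (isGood_XO hconn hinf (m + 1) y hy).brick.isLoc hGx.brick, ih (m + n) (by omega) hy' hx rfl]
      split_ifs <;> first | rfl | omega

end Preprojective

/-! ### Finite dimension along arrows, and right infinite paths -/

section Preprojective

variable {k : Type w} [Field k] {Q : Type u} [Quiver.{v} Q] [hQ : SLF Q]

/-- Arrows of `ℕQᵒᵖ` in coordinates. -/
def Arr (p q : ℕ × Q) : Prop :=
  (p.1 = q.1 ∧ Nonempty (q.2 ⟶ p.2)) ∨ (q.1 = p.1 + 1 ∧ Nonempty (p.2 ⟶ q.2))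

variable (hconn : Subsingleton (Quiver.WeaklyConnectedComponent Q)) (hinf : Infinite Q)

include hconn hinf in
theorem irrNZ_XO_iff {n m : ℕ} {x y : Q} (hx : Dom.{u, v, w} k n x) (hy : Dom.{u, v, w} k m y) :
    IrrNZ (XO.{u, v, w} k n x) (XO k m y) ↔ Arr (n, x) (m, y) := by
  have hc : ∀ a b : Q, 0 < Nat.card (a ⟶ b) ↔ Nonempty (a ⟶ b) := fun a b => by
    rw [Nat.card_pos_iff]
    exact and_iff_left inferInstance
  rw [← irrK_pos_iff k, irrK_XO hconn hinf hx hy, Arr]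
  split_ifs with h1 h2
  · subst h1
    rw [hc]
    simp
  · subst h2
    rw [hc]
    simp
  · simp [h1, Ne.symm h2]

include hconn hinf in
/-- Predecessors of finite dimensional objects are finite dimensional. -/
theorem isFD_of_arr {n m : ℕ} {x y : Q} (hx : Dom.{u, v, w} k n x) (hy : Dom.{u, v, w} k m y)
    (h : Arr (n, x) (m, y)) (hfd : IsFD (XO.{u, v, w} k m y).obj) :
    IsFD (XO.{u, v, w} k n x).obj := by
  have hG := isGood_XO hconn hinf m y hy
  have hGx := isGood_XO hconn hinf n x hx
  obtain ⟨A, E, a, g, hg, ha, hag, hE⟩ := hG.exists_ras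
  obtain ⟨t, ht⟩ := (irrNZ_right_iff hg hG.brick.isLoc ha hag).1
    ((irrNZ_XO_iff hconn hinf hx hy).2 h)
  obtain ⟨s, hs⟩ := (not_inRad_iff' hGx.brick.isLoc).1 ht
  refine (hE hfd).of_retract t.hom (s ≫ inv (t ≫ s)).hom ?_
  have h1 : t ≫ s ≫ inv (t ≫ s) = 𝟙 _ := by rw [← Category.assoc, IsIso.hom_inv_id]
  exact congrArg (fun f => f.hom) h1

include hconn hinf in
/-- The iterated inverse translates are closed under neighbours. -/
theorem exists_iso_XO_of_irrNZ {n : ℕ} {x : Q} (hx : Dom.{u, v, w} k n x)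
    {Y : RepPlus.{u, v, w} k Q} (hY : IsLoc Y) (h : IrrNZ Y (XO k n x) ∨ IrrNZ (XO k n x) Y) :
    ∃ m y, Dom.{u, v, w} k m y ∧ Nonempty (Y ≅ XO k m y) := by
  rcases h with h | h
  · obtain ⟨m, y, hD, he, -⟩ := (isGood_XO hconn hinf n x hx).exists_iso_left Y hY h
    exact ⟨m, y, hD, he⟩
  · obtain ⟨m, y, hD, he, -⟩ := exists_iso_right hconn hinf (N := n)
      (fun m _ x h => isGood_XO hconn hinf m x h) x hx Y hY h
    exact ⟨m, y, hD, he⟩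

/-- König's argument: the successors of `x` are `x` itself and those of the finitely many targets of
arrows from `x`. -/
theorem exists_arrow_infinite_succ {x : Q} (h : (Succ {x}).Infinite) :
    ∃ y, Nonempty (x ⟶ y) ∧ (Succ {y}).Infinite := by
  by_contra hc
  push Not at hc
  refine h (((Set.finite_singleton x).union (Set.finite_iUnion
    fun s : Σ y : Q, (x ⟶ y) => hc s.1 ⟨s.2⟩)).subset ?_)
  rintro y ⟨x', hx, ⟨p⟩⟩
  obtain rfl : x' = x := hx
  have key : ∀ {y} (p : Quiver.Path x' y), y = x' ∨ ∃ z, Nonempty (x' ⟶ z) ∧ y ∈ Succ {z} := by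
    intro y p
    induction p with
    | nil => exact Or.inl rfl
    | @cons b c p α ih =>
      right
      rcases ih with rfl | ⟨z, hz, hb⟩
      · exact ⟨c, ⟨α⟩, subset_Succ _ rfl⟩
      · exact ⟨z, hz, Succ.arrow hb α⟩
  rcases key p with rfl | ⟨z, ⟨α⟩, hy⟩
  · exact Or.inl rfl
  · exact Or.inr (Set.mem_iUnion.2 ⟨⟨z, α⟩, hy⟩)

theorem finite_succ_of_not_hasRightInfinitePath (h : ¬ HasRightInfinitePath Q) (x : Q) :
    (Succ {x}).Finite := by
  by_contra hx
  choose f hf using fun a : {x : Q // (Succ {x}).Infinite} => exists_arrow_infinite_succ a.2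
  let g : ℕ → {x : Q // (Succ {x}).Infinite} := fun n =>
    Nat.rec ⟨x, hx⟩ (fun _ a => ⟨f a, (hf a).2⟩) n
  exact h ⟨fun n => (g n).1, fun n => (hf (g n)).1⟩

theorem IsFP.isFD (h : ¬ HasRightInfinitePath Q) {M : Rep.{u, v, w} k Q} (hM : IsFP M) : IsFD M where
  fin := hM.fin
  supp := by
    obtain ⟨s, hs, hsM⟩ := hM.supp
    refine (hs.biUnion fun a _ => finite_succ_of_not_hasRightInfinitePath h a).subset ?_
    intro x hx
    obtain ⟨a, ha, hp⟩ := hsM x hx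
    exact Set.mem_biUnion ha ⟨a, rfl, hp⟩

variable (k) in
-- The vertices of a right infinite path are distinct, since there are no oriented cycles, and all
-- of them support the projective of the first one.
theorem exists_not_isFD_prObj (h : HasRightInfinitePath Q) : ∃ x : Q, ¬ IsFD (XO.{u, v, w} k 0 x).obj := by
  obtain ⟨x, hx⟩ := h
  refine ⟨x 0, fun hfd => ?_⟩
  have hp : ∀ n d, ∃ p : Quiver.Path (x n) (x (n + d)), p.length = d := by
    intro n d
    induction d with
    | zero => exact ⟨Quiver.Path.nil, rfl⟩
    | succ d ih =>
      obtain ⟨p, hp⟩ := ih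
      exact ⟨p.cons (hx (n + d)).some, by rw [Quiver.Path.length_cons, hp]⟩
  have hlt : ∀ a b, a < b → x a ≠ x b := by
    intro a b hab
    obtain ⟨d, rfl⟩ := Nat.exists_eq_add_of_lt hab
    obtain ⟨p, hp⟩ := hp a (d + 1)
    intro h
    have key : ∀ {y : Q} (q : Quiver.Path (x a) y), x a = y → q.length = 0 := by
      rintro y q rfl
      exact path_length_eq_zero q
    have := key p h
    omega
  have hinj : Function.Injective x := by
    intro a b hab
    rcases lt_trichotomy a b with h | h | h
    · exact absurd hab (hlt a b h)
    · exact h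
    · exact absurd hab.symm (hlt b a h)
  refine Set.infinite_range_of_injective hinj ((finite_succ_of_isFD hfd).subset ?_)
  rintro _ ⟨n, rfl⟩
  obtain ⟨p, -⟩ := hp 0 n
  rw [Nat.zero_add] at p
  exact ⟨x 0, rfl, ⟨p⟩⟩

end Preprojective

/-! ### Translation quivers in coordinates: sections, orbits and connectedness -/

/-- Coordinates of a translation quiver in `ℕQᵒᵖ`: the vertex `(n, x)` occurs if and only if
`F m x` for all `m < n`. -/
structure Coords (Γ : TransQuiver.{u', v'}) (Q : Type u) [Quiver.{v} Q] (F : ℕ → Q → Prop) where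
  c : Γ.V → ℕ × Q
  inj : Function.Injective c
  range : ∀ p : ℕ × Q, (∃ X, c X = p) ↔ ∀ m < p.1, F m p.2
  adj : ∀ X Y, Γ.Adj X Y ↔ Arr (c X) (c Y)
  tau : ∀ Z X, Γ.tau Z X ↔ c Z = ((c X).1 + 1, (c X).2)
  pred : ∀ X Y, Arr (c X) (c Y) → F (c Y).1 (c Y).2 → F (c X).1 (c X).2

namespace Coords

variable {Q : Type u} [Quiver.{v} Q] {Γ : TransQuiver.{u', v'}} {F : ℕ → Q → Prop}
  (φ : Coords Γ Q F)

theorem exists_of_le (X : Γ.V) {n : ℕ} (h : n ≤ (φ.c X).1) : ∃ Y, φ.c Y = (n, (φ.c X).2) :=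
  (φ.range _).2 fun m hm => (φ.range (φ.c X)).1 ⟨X, rfl⟩ m (lt_of_lt_of_le hm h)

theorem exists_succ_iff (X : Γ.V) :
    (∃ Y, φ.c Y = ((φ.c X).1 + 1, (φ.c X).2)) ↔ F (φ.c X).1 (φ.c X).2 := by
  rw [φ.range]
  refine ⟨fun h => h _ (Nat.lt_succ_self _), fun h m hm => ?_⟩
  rcases Nat.lt_succ_iff_lt_or_eq.1 hm with hm | hm
  · exact (φ.range (φ.c X)).1 ⟨X, rfl⟩ m hm
  · rw [hm]
    exact h

theorem tauPow_iff (n : ℕ) (Z X : Γ.V) : Γ.TauPow n Z X ↔ φ.c Z = ((φ.c X).1 + n, (φ.c X).2) := by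
  induction n generalizing Z with
  | zero => exact φ.inj.eq_iff.symm
  | succ n ih =>
    simp only [TransQuiver.TauPow, ih, φ.tau]
    constructor
    · rintro ⟨Y, h1, h2⟩
      rw [h1, h2]
      rfl
    · intro h
      obtain ⟨Y, hY⟩ := φ.exists_of_le Z (n := (φ.c X).1 + n) (by rw [h]; simp)
      rw [h] at hY
      exact ⟨Y, by rw [hY, h]; rfl, hY⟩

theorem mem_orbit_iff (X Y : Γ.V) : Y ∈ Γ.orbit X ↔ (φ.c Y).2 = (φ.c X).2 := by
  change (∃ n, Γ.TauPow n X Y ∨ Γ.TauPow n Y X) ↔ _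
  simp only [φ.tauPow_iff]
  constructor
  · rintro ⟨n, h | h⟩
    · rw [h]
    · rw [h]
  · intro h
    rcases le_total (φ.c X).1 (φ.c Y).1 with hle | hle
    · exact ⟨(φ.c Y).1 - (φ.c X).1, Or.inr (Prod.ext (by simp only; omega) h)⟩
    · exact ⟨(φ.c X).1 - (φ.c Y).1, Or.inl (Prod.ext (by simp only; omega) h.symm)⟩

theorem fst_le {X Y : Γ.V} (h : Relation.ReflTransGen Γ.Adj X Y) : (φ.c X).1 ≤ (φ.c Y).1 := by
  induction h with
  | refl => exact le_rfl
  | tail _ h ih =>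
    rcases (φ.adj _ _).1 h with h | h <;> omega

/-- Along arrows the level increases, or stays the same while a path of `Q` is traversed backwards.
As `Q` has no oriented cycles, neither has the translation quiver. -/
theorem transGen {X Y : Γ.V} (h : Relation.TransGen Γ.Adj X Y) : (φ.c X).1 < (φ.c Y).1 ∨
    ((φ.c X).1 = (φ.c Y).1 ∧ ∃ p : Quiver.Path (φ.c Y).2 (φ.c X).2, p.length ≠ 0) := by
  induction h with
  | single h =>
    rcases (φ.adj _ _).1 h with ⟨h1, ⟨α⟩⟩ | h
    · exact Or.inr ⟨h1, α.toPath, by simp⟩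
    · left; omega
  | tail _ h ih =>
    rcases (φ.adj _ _).1 h with ⟨h1, ⟨α⟩⟩ | h
    · rcases ih with ih | ⟨ih, p, hp⟩
      · left; omega
      · exact Or.inr ⟨ih.trans h1, α.toPath.comp p, by rw [Quiver.Path.length_comp]; omega⟩
    · left; rcases ih with ih | ⟨ih, -⟩ <;> omega

include φ in
theorem not_transGen [SLF Q] {S : Set Γ.V} (x : S)
    (h : Relation.TransGen (fun a b : S => Γ.Adj a b) x x) : False := by
  have h1 : Relation.TransGen Γ.Adj x.1 x.1 := h.lift Subtype.val fun _ _ h => h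
  rcases φ.transGen h1 with h | ⟨-, p, hp⟩
  · exact lt_irrefl _ h
  · exact hp (path_length_eq_zero p)

theorem zigzag_induction (hconn : Subsingleton (Quiver.WeaklyConnectedComponent Q)) (x : Q)
    {p : Q → Prop} (hx : p x) (h : ∀ y z, Nonempty (y ⟶ z) ∨ Nonempty (z ⟶ y) → p y → p z) (y : Q) :
    p y := by
  obtain ⟨q⟩ := (Quiver.WeaklyConnectedComponent.eq x y).1 (Subsingleton.elim _ _)
  induction q with
  | nil => exact hx
  | cons q α ih =>
    refine h _ _ ?_ ih
    rcases α with α | α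
    · exact Or.inl ⟨α⟩
    · exact Or.inr ⟨α⟩

/-- A set of vertices which meets the orbits in one vertex each is connected if neighbours in `Q`
have adjacent representatives. -/
theorem connected_of (hconn : Subsingleton (Quiver.WeaklyConnectedComponent Q)) {S : Set Γ.V}
    (hS : ∀ x : Q, ∃! X, X ∈ S ∧ (φ.c X).2 = x)
    (h : ∀ X ∈ S, ∀ Y ∈ S, Nonempty ((φ.c X).2 ⟶ (φ.c Y).2) → Γ.Adj X Y ∨ Γ.Adj Y X) (X Y : S) :
    Relation.EqvGen (fun a b : S => Γ.Adj a b) X Y := by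
  suffices H : ∀ y, ∀ Y : S, (φ.c Y).2 = y → Relation.EqvGen (fun a b : S => Γ.Adj a b) X Y from
    H _ Y rfl
  intro y
  induction y using zigzag_induction hconn (φ.c X).2 with
  | hx =>
    intro Y hY
    have := (hS (φ.c X).2).unique ⟨Y.2, hY⟩ ⟨X.2, rfl⟩
    rw [Subtype.ext this]
    exact Relation.EqvGen.refl _
  | h y z hyz ih =>
    intro Z hZ
    obtain ⟨Y, ⟨hY, hYy⟩, -⟩ := hS y
    refine (ih ⟨Y, hY⟩ hYy).trans _ _ _ ?_
    have hadj : Γ.Adj Y Z ∨ Γ.Adj Z Y := by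
      rcases hyz with ⟨⟨α⟩⟩ | ⟨⟨α⟩⟩
      · exact h Y hY Z Z.2 (by rw [hYy, hZ]; exact ⟨α⟩)
      · exact (h Z Z.2 Y hY (by rw [hYy, hZ]; exact ⟨α⟩)).symm
    rcases hadj with hadj | hadj
    · exact Relation.EqvGen.rel _ _ hadj
    · exact (Relation.EqvGen.rel (r := fun a b : S => Γ.Adj a b) Z ⟨Y, hY⟩ hadj).symm

theorem existsUnique_zero (x : Q) : ∃! X, X ∈ {X | (φ.c X).1 = 0} ∧ (φ.c X).2 = x := by
  obtain ⟨X, hX⟩ := (φ.range (0, x)).2 fun m hm => absurd hm (Nat.not_lt_zero m)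
  refine ⟨X, ⟨congrArg Prod.fst hX, congrArg Prod.snd hX⟩, ?_⟩
  rintro Y ⟨h1, h2⟩
  exact φ.inj ((Prod.ext h1 h2 : φ.c Y = (0, x)).trans hX.symm)

theorem isLeftMostSection [SLF Q] [Nonempty Q]
    (hconn : Subsingleton (Quiver.WeaklyConnectedComponent Q)) :
    Γ.IsLeftMostSection {X | (φ.c X).1 = 0} := by
  refine ⟨⟨?_, ?_, ?_, fun x h => φ.not_transGen x h, ?_⟩, ?_⟩
  · obtain ⟨X, ⟨hX, -⟩, -⟩ := φ.existsUnique_zero (Classical.arbitrary Q)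
    exact ⟨X, hX⟩
  · exact φ.connected_of hconn φ.existsUnique_zero fun X hX Y hY h =>
      Or.inr ((φ.adj _ _).2 (Or.inl ⟨Eq.trans hY (Eq.symm hX), h⟩))
  · intro X _ Y hY Z _ hZY
    have h1 := φ.fst_le hZY
    have h2 : (φ.c Y).1 = 0 := hY
    change (φ.c Z).1 = 0
    omega
  · intro Z
    simp only [φ.mem_orbit_iff]
    exact φ.existsUnique_zero _
  · intro Z
    obtain ⟨X, ⟨hX, hX2⟩, -⟩ := φ.existsUnique_zero (φ.c Z).2
    refine ⟨X, hX, (φ.c Z).1, (φ.tauPow_iff _ _ _).2 ?_⟩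
    have hX' : (φ.c X).1 = 0 := hX
    rw [hX', hX2, Nat.zero_add]

include φ in
/-- Neighbouring orbits end simultaneously. -/
theorem exists_last (hconn : Subsingleton (Quiver.WeaklyConnectedComponent Q)) {x₀ : Q}
    (hx₀ : ¬ F 0 x₀) (x : Q) : ∃ n, ¬ F n x := by
  induction x using zigzag_induction hconn x₀ with
  | hx => exact ⟨0, hx₀⟩
  | h y z hyz ih =>
    classical
    -- The vertex `(n, y)` is the last one of its orbit. If the orbit of `z` never ended, `(n, y)`
    -- would have a successor in it which satisfies `F`, and would satisfy `F` itself.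
    obtain ⟨n, hn, hmin⟩ : ∃ n, ¬ F n y ∧ ∀ m < n, F m y :=
      ⟨Nat.find ih, Nat.find_spec ih, fun m hm => not_not.1 (Nat.find_min ih hm)⟩
    obtain ⟨Y, hY⟩ := (φ.range (n, y)).2 hmin
    by_contra hc
    push Not at hc
    obtain ⟨Z, hZ⟩ := (φ.range (n, z)).2 fun m _ => hc m
    obtain ⟨Z', hZ'⟩ := (φ.range (n + 1, z)).2 fun m _ => hc m
    have hn' : ¬ F (φ.c Y).1 (φ.c Y).2 := by rwa [hY]
    rcases hyz with ⟨⟨α⟩⟩ | ⟨⟨α⟩⟩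
    · exact hn' (φ.pred Y Z' (by rw [hY, hZ']; exact Or.inr ⟨rfl, ⟨α⟩⟩) (by rw [hZ']; exact hc _))
    · exact hn' (φ.pred Y Z (by rw [hY, hZ]; exact Or.inl ⟨rfl, ⟨α⟩⟩) (by rw [hZ]; exact hc _))

theorem existsUnique_last (h : ∀ x, ∃ n, ¬ F n x) (x : Q) :
    ∃! X, X ∈ {X | ¬ F (φ.c X).1 (φ.c X).2} ∧ (φ.c X).2 = x := by
  classical
  have hmin : ∀ m < Nat.find (h x), F m x := fun m hm => not_not.1 (Nat.find_min (h x) hm)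
  obtain ⟨X, hX⟩ := (φ.range (Nat.find (h x), x)).2 hmin
  have hspec := Nat.find_spec (h x)
  refine ⟨X, ⟨?_, congrArg Prod.snd hX⟩, ?_⟩
  · change ¬ F (φ.c X).1 (φ.c X).2
    rwa [hX]
  · rintro Y ⟨h1, rfl⟩
    have h2 : (φ.c Y).1 = Nat.find (h (φ.c Y).2) := by
      refine le_antisymm ?_ (Nat.find_min' (h _) h1)
      by_contra hlt
      exact hspec ((φ.range (φ.c Y)).1 ⟨Y, rfl⟩ _ (not_le.1 hlt))
    exact φ.inj ((Prod.ext h2 rfl : φ.c Y = (_, (φ.c Y).2)).trans hX.symm)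

/-- The section consists of the last vertices of the orbits. For an arrow from `x` to `y`, the orbit
of `y` ends on the same level as that of `x` or one level later, so the two last vertices are joined
by an arrow. Convexity holds because the failure of `F` passes to successors. -/
theorem isRightMostSection [SLF Q] [Nonempty Q]
    (hconn : Subsingleton (Quiver.WeaklyConnectedComponent Q)) (h : ∀ x, ∃ n, ¬ F n x) :
    Γ.IsRightMostSection {X | ¬ F (φ.c X).1 (φ.c X).2} := by
  have hF : ∀ X : Γ.V, ∀ m < (φ.c X).1, F m (φ.c X).2 := fun X => (φ.range (φ.c X)).1 ⟨X, rfl⟩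
  refine ⟨⟨?_, ?_, ?_, fun x h => φ.not_transGen x h, ?_⟩, ?_⟩
  · obtain ⟨X, ⟨hX, -⟩, -⟩ := φ.existsUnique_last h (Classical.arbitrary Q)
    exact ⟨X, hX⟩
  · refine φ.connected_of hconn (φ.existsUnique_last h) fun X hX Y hY hα => ?_
    have h1 : (φ.c X).1 ≤ (φ.c Y).1 := by
      by_contra hlt
      rw [not_le] at hlt
      obtain ⟨X', hX'⟩ := φ.exists_of_le X hlt.le
      refine hY (φ.pred Y X' ?_ ?_)
      · rw [hX']; exact Or.inl ⟨rfl, hα⟩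
      · rw [hX']; exact hF X _ hlt
    have h2 : (φ.c Y).1 ≤ (φ.c X).1 + 1 := by
      by_contra hlt
      rw [not_le] at hlt
      obtain ⟨Y', hY'⟩ := φ.exists_of_le Y hlt.le
      refine hX (φ.pred X Y' ?_ ?_)
      · rw [hY']; exact Or.inr ⟨rfl, hα⟩
      · rw [hY']; exact hF Y _ hlt
    rcases Nat.le_succ_iff.1 h2 with h3 | h3
    · exact Or.inr ((φ.adj _ _).2 (Or.inl ⟨le_antisymm h3 h1, hα⟩))
    · exact Or.inl ((φ.adj _ _).2 (Or.inr ⟨h3, hα⟩))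
  · intro X hX Y _ Z hXZ _
    have key : ∀ {Z}, Relation.ReflTransGen Γ.Adj X Z → ¬ F (φ.c Z).1 (φ.c Z).2 := by
      intro Z hXZ
      induction hXZ with
      | refl => exact hX
      | tail _ hadj ih => exact fun hF => ih (φ.pred _ _ ((φ.adj _ _).1 hadj) hF)
    exact key hXZ
  · intro Z
    simp only [φ.mem_orbit_iff]
    exact φ.existsUnique_last h _
  · intro Z
    obtain ⟨X, ⟨hX, hX2⟩, -⟩ := φ.existsUnique_last h (φ.c Z).2
    refine ⟨X, hX, (φ.c X).1 - (φ.c Z).1, (φ.tauPow_iff _ _ _).2 (Prod.ext ?_ hX2)⟩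
    have : (φ.c Z).1 ≤ (φ.c X).1 := by
      by_contra hlt
      refine hX ?_
      rw [hX2]
      exact hF Z _ (not_le.1 hlt)
    simp only
    omega

include φ in
theorem finite_orbit (h : ∀ x, ∃ n, ¬ F n x) (X : Γ.V) : (Γ.orbit X).Finite := by
  obtain ⟨n, hn⟩ := h (φ.c X).2
  have h1 : (φ.c '' Γ.orbit X).Finite := by
    refine ((Set.finite_Iic n).image fun m => (m, (φ.c X).2)).subset ?_
    rintro _ ⟨Y, hY, rfl⟩
    rw [φ.mem_orbit_iff] at hY
    refine ⟨(φ.c Y).1, ?_, Prod.ext rfl hY.symm⟩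
    by_contra hlt
    refine hn ?_
    rw [← hY]
    exact (φ.range (φ.c Y)).1 ⟨Y, rfl⟩ _ (not_le.1 hlt)
  exact h1.of_finite_image φ.inj.injOn

include φ in
theorem isRightStable (h : ∀ n x, F n x) : Γ.IsRightStable := by
  intro X n
  obtain ⟨Z, hZ⟩ := (φ.range ((φ.c X).1 + n, (φ.c X).2)).2 fun m _ => h m _
  exact ⟨Z, (φ.tauPow_iff _ _ _).2 hZ⟩

theorem exists_arrow (hconn : Subsingleton (Quiver.WeaklyConnectedComponent Q)) (hinf : Infinite Q)
    (x : Q) : ∃ y, Nonempty (x ⟶ y) ∨ Nonempty (y ⟶ x) := by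
  by_contra hc
  push Not at hc
  obtain ⟨y, hy⟩ := exists_ne x
  refine hy (zigzag_induction (p := fun y => y = x) hconn x rfl ?_ y)
  rintro _ z (⟨⟨α⟩⟩ | ⟨⟨α⟩⟩) rfl
  · exact ((hc z).1.false α).elim
  · exact ((hc z).2.false α).elim

include φ in
/-- The quiver is connected. -/
theorem eqvGen (hconn : Subsingleton (Quiver.WeaklyConnectedComponent Q)) (hinf : Infinite Q)
    (X Y : Γ.V) : Relation.EqvGen Γ.Adj X Y := by
  have h0 : ∀ X Y : Γ.V, (φ.c X).1 = 0 → (φ.c Y).1 = 0 → Relation.EqvGen Γ.Adj X Y := by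
    intro X Y hX hY
    have := φ.connected_of hconn φ.existsUnique_zero (fun X hX Y hY h =>
      Or.inr ((φ.adj _ _).2 (Or.inl ⟨Eq.trans hY (Eq.symm hX), h⟩))) ⟨X, hX⟩ ⟨Y, hY⟩
    have key : ∀ {a b : {X | (φ.c X).1 = 0}},
        Relation.EqvGen (fun a b : {X | (φ.c X).1 = 0} => Γ.Adj a b) a b →
          Relation.EqvGen Γ.Adj a.1 b.1 := by
      intro a b h
      induction h with
      | rel a b h => exact Relation.EqvGen.rel _ _ h
      | refl => exact Relation.EqvGen.refl _
      | symm _ _ _ ih => exact ih.symm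
      | trans _ _ _ _ _ h1 h2 => exact h1.trans _ _ _ h2
    exact key this
  have h1 : ∀ n, ∀ X, (φ.c X).1 = n → ∃ Y, (φ.c Y).1 = 0 ∧ Relation.EqvGen Γ.Adj X Y := by
    intro n
    induction n with
    | zero => exact fun X hX => ⟨X, hX, Relation.EqvGen.refl _⟩
    | succ n ih =>
      intro X hX
      obtain ⟨Z, hZ⟩ := φ.exists_of_le X (n := n) (by omega)
      obtain ⟨Y, hY, hZY⟩ := ih Z (by rw [hZ])
      refine ⟨Y, hY, ?_⟩
      refine Relation.EqvGen.trans _ Z _ ?_ hZY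
      have hF : ∀ m ≤ n, F m (φ.c X).2 := fun m hm => (φ.range (φ.c X)).1 ⟨X, rfl⟩ m (by omega)
      have hFZ : ∀ m ≤ n, ∃ W, φ.c W = (m, (φ.c X).2) := fun m hm => φ.exists_of_le X (by omega)
      -- Consecutive vertices of an orbit are joined through the middle of the mesh, a vertex over a
      -- neighbour `y`. That vertex exists: climbing up the orbit of `y`, each vertex precedes one
      -- over `(φ.c X).2` satisfying `F`, so the orbit continues. The level reached is `n + 1` or
      -- `n` according to the direction of the arrow.
      obtain ⟨y, ⟨⟨α⟩⟩ | ⟨⟨α⟩⟩⟩ := exists_arrow hconn hinf (φ.c X).2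
      · have key : ∀ m ≤ n + 1, ∃ W, φ.c W = (m, y) := by
          intro m
          induction m with
          | zero => exact fun _ => (φ.range (0, y)).2 fun m hm => absurd hm (Nat.not_lt_zero m)
          | succ m ih =>
            intro hm
            obtain ⟨W, hW⟩ := ih (by omega)
            obtain ⟨W', hW'⟩ := hFZ m (by omega)
            have := (φ.exists_succ_iff W).2 (φ.pred W W' (by
              rw [hW, hW']; exact Or.inl ⟨rfl, ⟨α⟩⟩) (by rw [hW']; exact hF m (by omega)))
            rwa [hW] at this
        obtain ⟨W, hW⟩ := key (n + 1) le_rfl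
        have a1 : Γ.Adj Z W := (φ.adj _ _).2 (by rw [hZ, hW]; exact Or.inr ⟨rfl, ⟨α⟩⟩)
        have a2 : Γ.Adj W X := (φ.adj _ _).2 (by rw [hW]; exact Or.inl ⟨hX.symm, ⟨α⟩⟩)
        exact ((Relation.EqvGen.rel _ _ a1).trans _ _ _ (Relation.EqvGen.rel _ _ a2)).symm
      · have key : ∀ m ≤ n, ∃ W, φ.c W = (m, y) := by
          intro m
          induction m with
          | zero => exact fun _ => (φ.range (0, y)).2 fun m hm => absurd hm (Nat.not_lt_zero m)
          | succ m ih =>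
            intro hm
            obtain ⟨W, hW⟩ := ih (by omega)
            obtain ⟨W', hW'⟩ := hFZ (m + 1) (by omega)
            have := (φ.exists_succ_iff W).2 (φ.pred W W' (by
              rw [hW, hW']; exact Or.inr ⟨rfl, ⟨α⟩⟩) (by rw [hW']; exact hF _ (by omega)))
            rwa [hW] at this
        obtain ⟨W, hW⟩ := key n le_rfl
        have a1 : Γ.Adj Z W := (φ.adj _ _).2 (by rw [hZ, hW]; exact Or.inl ⟨rfl, ⟨α⟩⟩)
        have a2 : Γ.Adj W X := (φ.adj _ _).2 (by rw [hW]; exact Or.inr ⟨hX, ⟨α⟩⟩)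
        exact ((Relation.EqvGen.rel _ _ a1).trans _ _ _ (Relation.EqvGen.rel _ _ a2)).symm
  obtain ⟨X', hX', hX⟩ := h1 _ X rfl
  obtain ⟨Y', hY', hY⟩ := h1 _ Y rfl
  exact hX.trans _ _ _ ((h0 _ _ hX' hY').trans _ _ _ hY.symm)

end Coords

/-! ### Invariance under isomorphisms -/

theorem IsBrick.of_iso {k : Type w} [Field k] {C : Type u} [Category.{v} C] [Preadditive C]
    [Linear k C] {X Y : C} (h : IsBrick k X) (e : X ≅ Y) : IsBrick k Y := by
  refine ⟨fun h0 => h.1 (h0.of_iso e), fun a => ?_⟩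
  obtain ⟨c, hc⟩ := h.2 (e.hom ≫ a ≫ e.inv)
  refine ⟨c, ?_⟩
  rw [← cancel_epi e.hom, ← cancel_mono e.inv, Category.assoc, hc]
  simp

/-- Almost split sequences are stable under isomorphisms of the ends. -/
theorem IsAlmostSplitSeq.congr {C : Type u} [Category.{v} C] [Preadditive C] {X E Z X' Z' : C}
    {f : X ⟶ E} {g : E ⟶ Z} (h : IsAlmostSplitSeq f g) (a : X ≅ X') (b : Z ≅ Z') :
    IsAlmostSplitSeq (a.inv ≫ f) (g ≫ b.hom) where
  mid_ne_zero := h.mid_ne_zero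
  left_minimal t ht := h.left_minimal t (by
    rwa [Category.assoc, cancel_epi] at ht)
  left_almostSplit := by
    refine ⟨fun hs => h.left_almostSplit.1 (IsSplitMono.mk' ⟨retraction (a.inv ≫ f) ≫ a.inv, ?_⟩),
      fun W t ht => ?_⟩
    · rw [← cancel_epi a.inv, ← Category.assoc, ← Category.assoc, IsSplitMono.id]
      simp
    · obtain ⟨s, hs⟩ := h.left_almostSplit.2 W (a.hom ≫ t) fun hs => ht
        (IsSplitMono.mk' ⟨retraction (a.hom ≫ t) ≫ a.hom, by
          rw [← cancel_epi a.hom, ← Category.assoc, ← Category.assoc, IsSplitMono.id]; simp⟩)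
      exact ⟨s, by rw [Category.assoc, hs, a.inv_hom_id_assoc]⟩
  pseudoKernel := by
    refine ⟨by rw [Category.assoc, reassoc_of% h.pseudoKernel.1, Limits.zero_comp, Limits.comp_zero],
      fun W t ht => ?_⟩
    obtain ⟨l, hl⟩ := h.pseudoKernel.2 W t (by
      rw [← cancel_mono b.hom, Category.assoc, ht, Limits.zero_comp])
    exact ⟨l ≫ a.hom, by simp [hl]⟩
  right_minimal t ht := h.right_minimal t (by
    rwa [← Category.assoc, cancel_mono] at ht)
  right_almostSplit := by
    refine ⟨fun hs => h.right_almostSplit.1 (IsSplitEpi.mk' ⟨b.hom ≫ section_ (g ≫ b.hom), ?_⟩),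
      fun W t ht => ?_⟩
    · rw [← cancel_mono b.hom, Category.assoc, Category.assoc, IsSplitEpi.id]
      simp
    · obtain ⟨s, hs⟩ := h.right_almostSplit.2 W (t ≫ b.inv) fun hs => ht
        (IsSplitEpi.mk' ⟨b.inv ≫ section_ (t ≫ b.inv), by
          rw [← cancel_mono b.inv, Category.assoc, Category.assoc, IsSplitEpi.id]; simp⟩)
      exact ⟨s, by rw [← Category.assoc, hs, Category.assoc, b.inv_hom_id, Category.comp_id]⟩
  pseudoCokernel := by
    refine ⟨by rw [Category.assoc, reassoc_of% h.pseudoKernel.1, Limits.zero_comp, Limits.comp_zero],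
      fun W t ht => ?_⟩
    obtain ⟨l, hl⟩ := h.pseudoCokernel.2 W t (by
      rw [← cancel_epi a.inv, ← Category.assoc, ht, Limits.comp_zero])
    exact ⟨b.inv ≫ l, by simp [hl]⟩

/-! ### The translation quiver `ℕQᵒᵖ` in coordinates -/

section Quiver

/-- The number of arrows of `ℕQᵒᵖ` in coordinates. -/
noncomputable def arrCount {Q : Type u} [Quiver.{v} Q] (p q : ℕ × Q) : ℕ :=
  if p.1 = q.1 then Nat.card (q.2 ⟶ p.2) else if p.1 + 1 = q.1 then Nat.card (p.2 ⟶ q.2) else 0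

variable {Q : Type u} [Quiver.{v} Q]

/-- The vertices of `ℕQᵒᵖ` by their coordinates. -/
def nVertex (p : ℕ × Q) : (NQuiver Qᵒᵖ).V := ⟨((p.1 : ℤ), Opposite.op p.2), Int.natCast_nonneg p.1⟩

theorem nVertex_injective : Function.Injective (nVertex (Q := Q)) := by
  rintro ⟨n, x⟩ ⟨m, y⟩ h
  have h1 : ((n : ℤ), Opposite.op x) = ((m : ℤ), Opposite.op y) := congrArg Subtype.val h
  exact Prod.ext (Int.ofNat_inj.1 (congrArg Prod.fst h1))
    (Opposite.op_injective (congrArg Prod.snd h1))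

theorem nVertex_surjective : Function.Surjective (nVertex (Q := Q)) := by
  rintro ⟨⟨n, x⟩, hn⟩
  obtain ⟨m, rfl⟩ := Int.eq_ofNat_of_zero_le hn
  exact ⟨(m, x.unop), rfl⟩

theorem nQuiver_tau_iff (p q : ℕ × Q) :
    (NQuiver Qᵒᵖ).tau (nVertex p) (nVertex q) ↔ p = (q.1 + 1, q.2) := by
  change ((q.1 : ℤ), Opposite.op q.2) = ((p.1 : ℤ) - 1, Opposite.op p.2) ↔ _
  rw [Prod.ext_iff, Prod.ext_iff]
  refine and_congr ?_ (Opposite.op_injective.eq_iff.trans eq_comm)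
  simp only
  omega

theorem nat_card_subtype_const {A : Type*} (p : Prop) [Decidable p] :
    Nat.card {_a : A // p} = if p then Nat.card A else 0 := by
  split_ifs with h
  · exact Nat.card_congr (Equiv.subtypeUnivEquiv fun _ => h)
  · have : IsEmpty {_a : A // p} := ⟨fun a => h a.2⟩
    exact Nat.card_of_isEmpty

variable [hQ : SLF Q]

theorem finite_nQuiver_arrow (p q : ℕ × Q) : Finite ((NQuiver Qᵒᵖ).Arrow (nVertex p) (nVertex q)) := by
  have h : ∀ x y : Q, Finite (Opposite.op x ⟶ Opposite.op y) := fun x y =>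
    Finite.of_injective (fun f => (f.unop : y ⟶ x)) Quiver.Hom.unop_inj
  have := h p.2 q.2
  have := h q.2 p.2
  exact inferInstanceAs (Finite ({_a : Opposite.op p.2 ⟶ Opposite.op q.2 // (q.1 : ℤ) = p.1} ⊕
    {_a : Opposite.op q.2 ⟶ Opposite.op p.2 // (q.1 : ℤ) = p.1 + 1}))

theorem card_nQuiver_arrow (p q : ℕ × Q) :
    Nat.card ((NQuiver Qᵒᵖ).Arrow (nVertex p) (nVertex q)) = arrCount p q := by
  have h : ∀ x y : Q, Finite (Opposite.op x ⟶ Opposite.op y) := fun x y =>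
    Finite.of_injective (fun f => (f.unop : y ⟶ x)) Quiver.Hom.unop_inj
  have := h p.2 q.2
  have := h q.2 p.2
  have hc : ∀ x y : Q, Nat.card (Opposite.op x ⟶ Opposite.op y) = Nat.card (y ⟶ x) := fun x y =>
    Nat.card_congr ⟨fun f => f.unop, fun f => f.op, fun _ => rfl, fun _ => rfl⟩
  change Nat.card ({_a : Opposite.op p.2 ⟶ Opposite.op q.2 // (q.1 : ℤ) = p.1} ⊕
    {_a : Opposite.op q.2 ⟶ Opposite.op p.2 // (q.1 : ℤ) = p.1 + 1}) = _
  rw [Nat.card_sum, nat_card_subtype_const, nat_card_subtype_const, hc, hc, arrCount]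
  split_ifs <;> omega

theorem arrCount_pos_iff (p q : ℕ × Q) : 0 < arrCount p q ↔ Arr p q := by
  have hc : ∀ a b : Q, 0 < Nat.card (a ⟶ b) ↔ Nonempty (a ⟶ b) := fun a b => by
    rw [Nat.card_pos_iff]
    exact and_iff_left inferInstance
  rw [arrCount, Arr]
  split_ifs with h1 h2
  · rw [hc]
    simp [h1]
  · rw [hc]
    simp [h1, h2]
  · simp [h1, Ne.symm h2]

end Quiver

/-! ### The preprojective component and its coordinates -/

section Component

variable {k : Type w} [Field k] {Q : Type u} [Quiver.{v} Q]

/-- The object represented by a vertex of the Auslander-Reiten quiver. -/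
noncomputable abbrev vObj (X : (arRepPlus.{u, v, w} k Q).V) : RepPlus.{u, v, w} k Q :=
  (fromSkeleton (RepPlus.{u, v, w} k Q)).obj X.1

theorem eq_of_iso_vObj {X Y : (arRepPlus.{u, v, w} k Q).V} (e : vObj X ≅ vObj Y) : X = Y :=
  Subtype.ext (skeleton_skeletal _ ⟨(fromSkeleton _).preimageIso e⟩)

theorem exists_vObj_iso {Y : RepPlus.{u, v, w} k Q} (h : IsBrick k Y) :
    ∃ X : (arRepPlus.{u, v, w} k Q).V, Nonempty (vObj X ≅ Y) :=
  ⟨⟨toSkeleton Y, (h.of_iso (fromSkeletonToSkeletonIso Y).symm).isLoc.isIndec⟩,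
    ⟨fromSkeletonToSkeletonIso Y⟩⟩

variable [hQ : SLF Q]

theorem isLoc_vObj (X : (arRepPlus.{u, v, w} k Q).V) : IsLoc (vObj X) := X.2.isLoc

/-- If `irr(X, Y) = 0`, both dimensions are zero, hence equal, and the set of arrows is `Fin 0`; the
case of a single valued arrow does not arise. -/
theorem irrNZ_of_adj {X Y : (arRepPlus.{u, v, w} k Q).V} (h : (arRepPlus.{u, v, w} k Q).Adj X Y) :
    IrrNZ (vObj X) (vObj Y) := by
  by_contra hn
  obtain ⟨a⟩ := h
  have h1 : irrDim (vObj X) (vObj Y) = 0 := irrDim_eq_zero Y.2.1 hn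
  have h2 : irrDim' (vObj X) (vObj Y) = 0 := irrDim'_eq_zero X.2.1 hn
  have a' : Fin (if irrDim (vObj X) (vObj Y) = irrDim' (vObj X) (vObj Y) then
    irrDim (vObj X) (vObj Y) else 1) := a
  rw [h1, h2, if_pos rfl] at a'
  exact a'.elim0

variable (k Q) in
/-- The vertices of the preprojective component. -/
def compSet : Set (arRepPlus.{u, v, w} k Q).V :=
  {X | ∃ p : ℕ × Q, Dom.{u, v, w} k p.1 p.2 ∧ Nonempty (vObj X ≅ XO k p.1 p.2)}

/-- The coordinates of a vertex. -/
noncomputable def coord (X : compSet.{u, v, w} k Q) : ℕ × Q := X.2.choose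

theorem dom_coord (X : compSet.{u, v, w} k Q) : Dom.{u, v, w} k (coord X).1 (coord X).2 :=
  X.2.choose_spec.1

/-- A vertex as an iterated inverse translate. -/
noncomputable def coordIso (X : compSet.{u, v, w} k Q) :
    vObj X.1 ≅ XO.{u, v, w} k (coord X).1 (coord X).2 := X.2.choose_spec.2.some

variable (hconn : Subsingleton (Quiver.WeaklyConnectedComponent Q)) (hinf : Infinite Q)

include hconn hinf in
theorem coord_eq {X : compSet.{u, v, w} k Q} {p : ℕ × Q} (h : Dom.{u, v, w} k p.1 p.2)
    (e : vObj X.1 ≅ XO k p.1 p.2) : coord X = p := by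
  obtain ⟨h1, h2⟩ := eq_of_iso_XO hconn hinf (dom_coord X) h ((coordIso X).symm ≪≫ e)
  exact Prod.ext h1 h2

include hconn hinf in
theorem exists_coord_eq {p : ℕ × Q} (h : Dom.{u, v, w} k p.1 p.2) :
    ∃ X : compSet.{u, v, w} k Q, coord X = p := by
  obtain ⟨X, ⟨e⟩⟩ := exists_vObj_iso (isGood_XO.{u, v, w} (k := k) hconn hinf p.1 p.2 h).brick
  exact ⟨⟨X, p, h, ⟨e⟩⟩, coord_eq hconn hinf h e⟩

theorem coord_injective : Function.Injective (coord.{u, v, w} (k := k) (Q := Q)) := fun X Y h =>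
  Subtype.ext (eq_of_iso_vObj (coordIso X ≪≫ eqToIso (by rw [h]) ≪≫ (coordIso Y).symm))

include hconn hinf in
theorem isBrick_vObj (X : compSet.{u, v, w} k Q) : IsBrick k (vObj X.1) :=
  (isGood_XO hconn hinf _ _ (dom_coord X)).brick.of_iso (coordIso X).symm

include hconn hinf in
theorem irrDim_vObj (X Y : compSet.{u, v, w} k Q) :
    irrDim (vObj X.1) (vObj Y.1) = arrCount (coord X) (coord Y) := by
  rw [irrDim_eq_irrK k (isBrick_vObj hconn hinf Y), irrK_congr k (coordIso X) (coordIso Y),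
    irrK_XO hconn hinf (dom_coord X) (dom_coord Y), arrCount]

include hconn hinf in
theorem irrDim'_vObj (X Y : compSet.{u, v, w} k Q) :
    irrDim' (vObj X.1) (vObj Y.1) = arrCount (coord X) (coord Y) := by
  rw [irrDim'_eq_irrK k (isBrick_vObj hconn hinf X), ← irrDim_eq_irrK k (isBrick_vObj hconn hinf Y),
    irrDim_vObj hconn hinf]

include hconn hinf in
theorem valuation_trivial (X Y : compSet.{u, v, w} k Q) :
    irrDim (vObj X.1) (vObj Y.1) = irrDim' (vObj X.1) (vObj Y.1) :=
  (irrDim_vObj hconn hinf X Y).trans (irrDim'_vObj hconn hinf X Y).symm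

/-- The arrows of the component. -/
noncomputable def arrowEquiv (X Y : compSet.{u, v, w} k Q) :
    (arRepPlus.{u, v, w} k Q).Arrow X.1 Y.1 ≃ Fin (arrCount (coord X) (coord Y)) :=
  finCongr (by
    rw [valuation_trivial hconn hinf X Y, if_pos rfl]
    exact irrDim'_vObj hconn hinf X Y)

include hconn hinf in
theorem tau_iff (Z X : compSet.{u, v, w} k Q) :
    (arRepPlus.{u, v, w} k Q).tau Z.1 X.1 ↔ coord Z = ((coord X).1 + 1, (coord X).2) := by
  constructor
  · rintro ⟨E, f, g, h⟩
    obtain ⟨n, hn, ⟨e⟩⟩ := exists_eq_succ_of_isAlmostSplitSeq hconn hinf (isLoc_vObj X.1)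
      (dom_coord Z) (h.congr (Iso.refl _) (coordIso Z))
    rw [coord_eq hconn hinf (p := (n, (coord Z).2)) ((dom_coord Z).mono (by simp only; omega)) e]
    exact Prod.ext hn rfl
  · intro h
    have hD := dom_coord Z
    have e := coordIso Z
    rw [h] at hD e
    obtain ⟨E, f, g, hfg⟩ := exists_isAlmostSplitSeq_XO hconn hinf hD
    exact ⟨E, _, _, hfg.congr (coordIso X).symm e.symm⟩

/-- The component in coordinates. -/
noncomputable def compCoords :
    Coords ((arRepPlus.{u, v, w} k Q).full (compSet k Q)) Q fun n x => IsFD (XO.{u, v, w} k n x).obj where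
  c := coord
  inj := coord_injective
  range p := ⟨by rintro ⟨X, rfl⟩; exact dom_coord X, fun h => exists_coord_eq hconn hinf h⟩
  adj X Y := by
    rw [← arrCount_pos_iff, Fin.pos_iff_nonempty]
    exact (arrowEquiv hconn hinf X Y).nonempty_congr
  tau Z X := tau_iff hconn hinf Z X
  pred X Y h hF := isFD_of_arr hconn hinf (dom_coord X) (dom_coord Y) h hF

end Component

/-! ### Embedding, projective vertices and uniqueness of the component -/

section Component

variable {k : Type w} [Field k] {Q : Type u} [Quiver.{v} Q] [hQ : SLF Q]
  (hconn : Subsingleton (Quiver.WeaklyConnectedComponent Q)) (hinf : Infinite Q)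

/-- The embedding of the component in `ℕQᵒᵖ`. -/
noncomputable def compEmbedding :
    TransEmbedding ((arRepPlus.{u, v, w} k Q).full (compSet k Q)) (NQuiver Qᵒᵖ) where
  obj X := nVertex (coord X)
  obj_injective := nVertex_injective.comp coord_injective
  arrow X Y :=
    have := finite_nQuiver_arrow (coord X) (coord Y)
    (arrowEquiv hconn hinf X Y).trans
      (Finite.equivFinOfCardEq (card_nQuiver_arrow (coord X) (coord Y))).symm
  val_eq X Y _ := (if_pos (valuation_trivial hconn hinf X Y)).symm
  tau_iff Z X := (tau_iff hconn hinf Z X).trans (nQuiver_tau_iff _ _).symm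

theorem isP_iff {x : Q} {X : (arRepPlus.{u, v, w} k Q).V} :
    IsP x X ↔ Nonempty (vObj X ≅ XO k 0 x) := by
  obtain ⟨e⟩ := nonempty_iso_Fr.{u, v, w} (k := k) x
  rw [← nonempty_iso_obj_iff]
  exact ⟨fun ⟨e'⟩ => ⟨e' ≪≫ e⟩, fun ⟨e'⟩ => ⟨e' ≪≫ e.symm⟩⟩

theorem mem_compSet_of_isP {x : Q} {X : (arRepPlus.{u, v, w} k Q).V} (h : IsP x X) :
    X ∈ compSet k Q := ⟨(0, x), dom_zero x, isP_iff.1 h⟩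

include hconn hinf in
theorem isP_iff_coord {x : Q} {X : compSet.{u, v, w} k Q} : IsP x X.1 ↔ coord X = (0, x) := by
  rw [isP_iff]
  constructor
  · rintro ⟨e⟩
    exact coord_eq hconn hinf (p := (0, x)) (dom_zero x) e
  · intro h
    have e := coordIso X
    rw [h] at e
    exact ⟨e⟩

include hconn hinf in
theorem mem_compSet_of_adj {X Y : (arRepPlus.{u, v, w} k Q).V} (hX : X ∈ compSet k Q)
    (h : (arRepPlus.{u, v, w} k Q).Adj X Y ∨ (arRepPlus.{u, v, w} k Q).Adj Y X) :
    Y ∈ compSet k Q := by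
  obtain ⟨⟨n, x⟩, hD, ⟨e⟩⟩ := hX
  have h' : IrrNZ (vObj Y) (XO k n x) ∨ IrrNZ (XO k n x) (vObj Y) := by
    rcases h with h | h
    · exact Or.inr ((irrNZ_of_adj h).congr e (Iso.refl _))
    · exact Or.inl ((irrNZ_of_adj h).congr (Iso.refl _) e)
  obtain ⟨m, y, hy, he⟩ := exists_iso_XO_of_irrNZ hconn hinf hD (isLoc_vObj Y) h'
  exact ⟨(m, y), hy, he⟩

include hconn hinf in
-- The set is closed under neighbours, so it contains the connected component of `X`; conversely it
-- is connected by `Coords.eqvGen`.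
theorem eqvGen_iff {X Y : (arRepPlus.{u, v, w} k Q).V} (hX : X ∈ compSet k Q) :
    Relation.EqvGen (arRepPlus.{u, v, w} k Q).Adj X Y ↔ Y ∈ compSet k Q := by
  constructor
  · intro h
    have key : X ∈ compSet k Q ↔ Y ∈ compSet k Q := by
      clear hX
      induction h with
      | rel X Y h => exact ⟨fun hX => mem_compSet_of_adj hconn hinf hX (Or.inl h),
          fun hY => mem_compSet_of_adj hconn hinf hY (Or.inr h)⟩
      | refl => exact Iff.rfl
      | symm _ _ _ ih => exact ih.symm
      | trans _ _ _ _ _ h1 h2 => exact h1.trans h2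
    exact key.1 hX
  · intro hY
    have key : ∀ {X Y : compSet.{u, v, w} k Q},
        Relation.EqvGen ((arRepPlus.{u, v, w} k Q).full (compSet k Q)).Adj X Y →
          Relation.EqvGen (arRepPlus.{u, v, w} k Q).Adj X.1 Y.1 := by
      intro X Y h
      induction h with
      | rel _ _ h => exact Relation.EqvGen.rel _ _ h
      | refl => exact Relation.EqvGen.refl _
      | symm _ _ _ ih => exact ih.symm
      | trans _ _ _ _ _ h1 h2 => exact h1.trans _ _ _ h2
    exact key ((compCoords hconn hinf).eqvGen hconn hinf ⟨X, hX⟩ ⟨Y, hY⟩)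

include hconn hinf in
theorem exists_isP (x : Q) : ∃ X ∈ compSet.{u, v, w} k Q, IsP x X := by
  obtain ⟨X, hX⟩ := exists_coord_eq.{u, v, w} (k := k) hconn hinf (p := (0, x)) (dom_zero x)
  exact ⟨X.1, X.2, (isP_iff_coord hconn hinf).2 hX⟩

include hconn hinf in
theorem setOf_projVertices :
    {X : ((arRepPlus.{u, v, w} k Q).full (compSet k Q)).V | X.1 ∈ projVertices k Q} =
      {X | ((compCoords hconn hinf).c X).1 = 0} := by
  ext X
  constructor
  · rintro ⟨x, hx⟩
    exact congrArg Prod.fst ((isP_iff_coord hconn hinf).1 hx)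
  · intro h
    exact ⟨(coord X).2, (isP_iff_coord hconn hinf).2 (Prod.ext h rfl)⟩

end Component

end QuivRep

theorem mainTheorem5 {k : Type w} [Field k] {Q : Type u} [Quiver.{v} Q]
    (hQ : QuivRep.StronglyLocallyFinite Q)
    (hconn : Subsingleton (Quiver.WeaklyConnectedComponent Q))
    (hinf : Infinite Q) :
    ∃ C : Set (QuivRep.arRepPlus.{u, v, w} k Q).V,
      -- `C` is the unique preprojective component, and it contains all the `P_a`
      QuivRep.IsPreprojectiveComponent C ∧
      (∀ C' : Set (QuivRep.arRepPlus.{u, v, w} k Q).V,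
        QuivRep.IsPreprojectiveComponent C' → C' = C) ∧
      (∀ a : Q, ∃ X ∈ C, QuivRep.IsP a X) ∧
      -- the `P_a` generate a left-most section
      ((QuivRep.arRepPlus.{u, v, w} k Q).full C).IsLeftMostSection
        {X | X.1 ∈ QuivRep.projVertices k Q} ∧
      -- `C` embeds in `ℕQᵒᵖ`, with `P_a` corresponding to `(0, a)`
      (∃ φ : QuivRep.TransEmbedding ((QuivRep.arRepPlus.{u, v, w} k Q).full C)
          (QuivRep.NQuiver Qᵒᵖ),
        ∀ (a : Q) (X : C), QuivRep.IsP a X.1 → (φ.obj X).1 = (0, Opposite.op a)) ∧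
      -- (1)
      (¬ QuivRep.HasRightInfinitePath Q →
        ((QuivRep.arRepPlus.{u, v, w} k Q).full C).IsRightStable ∧
        ∃ φ : QuivRep.TransEmbedding ((QuivRep.arRepPlus.{u, v, w} k Q).full C)
            (QuivRep.NQuiver Qᵒᵖ),
          Function.Surjective φ.obj ∧
          ∀ (a : Q) (X : C), QuivRep.IsP a X.1 → (φ.obj X).1 = (0, Opposite.op a)) ∧
      -- (2)
      (QuivRep.HasRightInfinitePath Q →
        (∃ S, ((QuivRep.arRepPlus.{u, v, w} k Q).full C).IsRightMostSection S) ∧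
        ∀ X, (((QuivRep.arRepPlus.{u, v, w} k Q).full C).orbit X).Finite) := by
  open QuivRep in
  have : SLF Q := ⟨hQ⟩
  have hne : Nonempty Q := inferInstance
  have hφ : ∀ (a : Q) (X : compSet.{u, v, w} k Q), IsP a X.1 →
      ((compEmbedding hconn hinf).obj X).1 = (0, Opposite.op a) := by
    intro a X hX
    change (nVertex (coord X)).1 = _
    rw [(isP_iff_coord hconn hinf).1 hX]
    rfl
  refine ⟨compSet k Q, ?_, ?_, exists_isP hconn hinf, ?_, ⟨compEmbedding hconn hinf, hφ⟩,
    fun h => ?_, fun h => ?_⟩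
  · obtain ⟨X, hX, hP⟩ := exists_isP.{u, v, w} (k := k) hconn hinf (Classical.arbitrary Q)
    exact ⟨⟨X, Set.ext fun Y => (eqvGen_iff hconn hinf hX).symm⟩, X, hX, _, hP⟩
  · rintro C' ⟨⟨X, rfl⟩, Y, hXY, x, hY⟩
    have hYC := mem_compSet_of_isP hY
    have hXC := (eqvGen_iff hconn hinf hYC).1 (Relation.EqvGen.symm _ _ hXY)
    exact Set.ext fun Z => eqvGen_iff hconn hinf hXC
  · rw [setOf_projVertices hconn hinf]
    exact (compCoords hconn hinf).isLeftMostSection hconn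
  · have hFD : ∀ (n : ℕ) (x : Q), IsFD (XO.{u, v, w} k n x).obj := fun n x => (isFP_obj _).isFD h
    refine ⟨(compCoords.{u, v, w} (k := k) hconn hinf).isRightStable hFD,
      compEmbedding hconn hinf, fun p => ?_, hφ⟩
    obtain ⟨p, rfl⟩ := nVertex_surjective p
    obtain ⟨X, hX⟩ := exists_coord_eq.{u, v, w} (k := k) hconn hinf (p := p) fun m _ => hFD m _
    exact ⟨X, congrArg nVertex hX⟩
  · obtain ⟨x₀, hx₀⟩ := exists_not_isFD_prObj.{u, v, w} k h
    have hlast := (compCoords.{u, v, w} (k := k) hconn hinf).exists_last hconn hx₀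
    exact ⟨⟨_, (compCoords.{u, v, w} (k := k) hconn hinf).isRightMostSection hconn hlast⟩,
      (compCoords.{u, v, w} (k := k) hconn hinf).finite_orbit hlast⟩
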